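/- Let $D$ be a non-empty connected alternating oriented virtual link diagram with finitely many classical crossings, $n_+$ of them positive and $n_-$ negative; write $\varepsilon(c)=\pm1$ for the sign of a classical crossing $c$. Here "connected" means that the $4$-valent graph $|D|$ whose vertices are the classical crossings only is connected (equivalently, the surface $S_D$ of the abstract link diagram associated with $D$ is connected; a single component without classical crossings is allowed), and "alternating" means that going around each component one meets the classical crossings cyclically alternately as over- and under-crossings. Let $\Sigma$ be the closed oriented surface obtained by capping off the boundary of $S_D$ with disks, and let $g$, the supporting genus of $D$, be the genus of $\Sigma$. For a checkerboard coloring $\xi$ of the regions of $\Sigma\smallsetminus|D|$ (regions on the two sides of any edge have different colors) let $\xi^*$ be the coloring with black and white interchanged. For a crossing $c$ put $\eta(c)=+1$ if the two regions at $c$ that are merged by the $0$-smoothing (those swept out by the overcrossing arc when it is turned counterclockwise) are black, and $\eta(c)=-1$ if they are white. Let $X_0,\dots,X_m$ be the white regions, let $g_{ij}=-\sum\eta(c)$ for $i\ne j$, the sum being over the crossings $c$ adjacent to both $X_i$ and $X_j$, let $g_{ii}=-\sum_{k\neq i}g_{ik}$, and let $G_\xi(D)=(g_{ij})_{1\le i,j\le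 m}$. The signature is $\sigma_\xi=\operatorname{sig}(G_\xi(D))-\sum_{c:\ \varepsilon(c)\eta(c)=1}\eta(c)$. Let $V=\mathbb{Q}\mathbf 1\oplus\mathbb{Q}X$ with $\deg\mathbf 1=1$, $\deg X=-1$, with $m(\mathbf 1\otimes\mathbf 1)=\mathbf 1$, $m(\mathbf 1\otimes X)=m(X\otimes\mathbf 1)=X$, $m(X\otimes X)=0$ and $\Delta(\mathbf 1)=\mathbf 1\otimes X+X\otimes\mathbf 1$, $\Delta(X)=X\otimes X$. The Khovanov complex of $D$ is the sum of $V^{\otimes k_s}$ over the states $s$ of $D$, where $k_s$ is the number of cycles of $s$; if $s$ has $r_s$ one-smoothings then $V^{\otimes k_s}$ has homological degree $i=r_s-n_-$ and its quantum degree $j$ is shifted by $r_s+n_+-2n_-$. Along each edge of the cube of resolutions the differential is, up to a sign, $m$ if two cycles are joined, $\Delta$ if a cycle is split, and $0$ for a single cycle smoothing (tensored with the identity on the other cycles), with signs of the edges such that $d^2=0$. $Kh^{i,j}(D)$ is its homology. Then: (1) $D$ has a checkerboard coloring $\xi$ with $\eta(c)=-1$ for every crossing $c$, having regions of both colors; and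 the usual signs (minus one to the number of $1$-smoothings before the crossing that changes, in a fixed order of the crossings) give $d^2=0$. (2) For every checkerboard coloring $\xi$ with $\eta(c)=-1$ for all $c$, and for every choice of the removed white regions, $\sigma_\xi=\sigma_{\xi^*}+2g$. For every choice of edge signs with $d^2=0$, the Khovanov homology $Kh^{i,j}(D)$ is supported on the $g+2$ lines $$j=2i-\sigma_{\xi^*}+1,\quad j=2i-\sigma_{\xi^*}-1,\quad\dots,\quad j=2i-\sigma_{\xi}-1,$$ that is, if $Kh^{i,j}(D)\neq0$ then $j=2i-\sigma_{\xi^*}+1-2k$ for some integer $0\le k\le g+1$. -/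

import Mathlib

/-- The two strands at a classical crossing. -/
inductive Strand : Type
  | over
  | under
  deriving DecidableEq

instance : Fintype Strand := ⟨{.over, .under}, fun b => by cases b <;> decide⟩

/-- The other strand at the same crossing. -/
def Strand.flip : Strand → Strand
  | .over => .under
  | .under => .over

/-- The two ends of a strand at a crossing: the incoming and the outgoing one. -/
inductive End : Type
  | incoming
  | outgoing
  deriving DecidableEq

instance : Fintype End := ⟨{.incoming, .outgoing}, fun e => by cases e <;> decide⟩

/-- The other end of the same strand. -/
def End.flip : End → End
  | .incoming => .outgoing
  | .outgoing => .incoming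

/-- An oriented virtual link diagram with set of classical crossings `C`, given by its signed Gauss
diagram, that is, up to planar isotopy and detour moves (moves of arcs all of whose crossings are
virtual).  Following the orientation from strand `b` of crossing `c`, and passing straight through
all virtual crossings, the next classical crossing is met at `(c', b') = next (c, b)`.
`sign c` is the writhe of `c`.  `loops` is the number of components without classical crossings.
Every such datum is realized by a virtual link diagram in the plane. -/
structure VirtualLinkDiagram (C : Type*) where
  next : Equiv.Perm (C × Strand)
  sign : C → ℤˣ
  loops : ℕ

namespace VirtualLinkDiagram

variable {C : Type*}

/-- The crossings alternate between over and under along every component (cyclically). -/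
def IsAlternating (D : VirtualLinkDiagram C) : Prop :=
  ∀ p : C × Strand, (D.next p).2 = p.2.flip

/-- The connected pieces of the underlying graph `|D|` (virtual crossings are not vertices of it),
equivalently the connected components of the surface `S_D` of the abstract link diagram. -/
def Piece (D : VirtualLinkDiagram C) : Type _ :=
  Quot (fun c c' : C => ∃ b, (D.next (c, b)).1 = c') ⊕ Fin D.loops

/-- The diagram is connected (in particular it is not empty). -/
def IsConnected (D : VirtualLinkDiagram C) : Prop :=
  Nonempty D.Piece ∧ Subsingleton D.Piece

/-! ### The abstract link diagram, its closed surface, and the supporting genus -/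

/-- A leg is one of the four half-edges at a classical crossing. -/
abbrev Leg (_D : VirtualLinkDiagram C) : Type _ := C × Strand × End

/-- The other end of the edge of `|D|` to which a leg belongs. -/
def arc (D : VirtualLinkDiagram C) : D.Leg → D.Leg
  | (c, b, .outgoing) => ((D.next (c, b)).1, (D.next (c, b)).2, .incoming)
  | (c, b, .incoming) => ((D.next.symm (c, b)).1, (D.next.symm (c, b)).2, .outgoing)

/-- The next leg at the same crossing in counterclockwise order.  At a positive crossing the
counterclockwise order is over-out, under-out, over-in, under-in; at a negative crossing it is
over-out, under-in, over-in, under-out. -/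
def ccw (D : VirtualLinkDiagram C) : D.Leg → D.Leg
  | (c, .over, e) => (c, .under, if D.sign c = 1 then e else e.flip)
  | (c, .under, e) => (c, .over, if D.sign c = 1 then e.flip else e)

/-- The regions of `Σ \ |D|`, where `Σ` is the closed oriented surface obtained from `S_D` by
capping off its boundary components with disks.  A leg `l` stands for the corner between `l` and
`ccw l`, which lies to the left of `l` when one leaves the crossing along `l`.  Hence it is
continued, along the edge through `l`, by the corner of the leg `l'` with `ccw l' = arc l`.
A crossingless component has a region on each of its sides. -/
def Region (D : VirtualLinkDiagram C) : Type _ :=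
  Quot (fun l l' : D.Leg => D.ccw l' = D.arc l) ⊕ Fin D.loops × Bool

/-- The region containing the corner between `l` and `ccw l`. -/
def corner (D : VirtualLinkDiagram C) (l : D.Leg) : D.Region := Sum.inl (Quot.mk _ l)

/-- The Euler characteristic of `Σ`: `n` vertices, `2 n` edges, one disk for each region (a
crossingless component contributes an annulus and two disks). -/
noncomputable def eulerChar (D : VirtualLinkDiagram C) : ℤ :=
  (Nat.card C : ℤ) - 2 * Nat.card C + Nat.card D.Region

/-- The supporting genus of a connected diagram: the genus of `Σ`, from `χ(Σ) = 2 - 2 g`.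
(Capping off with disks gives the realization of least genus.) -/
noncomputable def supportingGenus (D : VirtualLinkDiagram C) : ℕ :=
  ((2 - D.eulerChar) / 2).toNat

/-! ### Checkerboard colorings, Goeritz matrices, signatures -/

/-- A checkerboard coloring of the regions of `Σ \ |D|`.  The corners of `l` and of `ccw l` are the
two sides of the edge through `ccw l`. -/
structure Coloring (D : VirtualLinkDiagram C) where
  black : D.Region → Bool
  black_ccw : ∀ l : D.Leg, black (D.corner (D.ccw l)) = !black (D.corner l)
  black_loop : ∀ f : Fin D.loops, black (Sum.inr (f, true)) = !black (Sum.inr (f, false))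

namespace Coloring

variable {D : VirtualLinkDiagram C}

/-- The dual coloring, with black and white interchanged. -/
def dual (ξ : D.Coloring) : D.Coloring where
  black r := !ξ.black r
  black_ccw l := by rw [ξ.black_ccw l]
  black_loop f := by rw [ξ.black_loop f]

/-- The incidence `η(c)`: it is `+1` (type A) if the two regions swept out by the overcrossing arc
when it is turned counterclockwise, i.e. those merged by the `0`-smoothing, are black, and `-1`
(type B) if they are white. -/
def incidence (ξ : D.Coloring) (c : C) : ℤ :=
  if ξ.black (D.corner (c, .over, .outgoing)) then 1 else -1

/-- The white regions. -/
def White (ξ : D.Coloring) : Type _ := {r : D.Region // ξ.black r = false}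

/-- The crossing `c` is adjacent to the region `r`. -/
def Adjacent (D : VirtualLinkDiagram C) (c : C) (r : D.Region) : Prop :=
  ∃ (b : Strand) (e : End), D.corner (c, b, e) = r

open Classical in
/-- The off-diagonal entries of the pre-Goeritz matrix. -/
noncomputable def goeritzEntry [Fintype C] (ξ : D.Coloring) (x y : ξ.White) : ℤ :=
  -∑ c with Adjacent D c x.1 ∧ Adjacent D c y.1, ξ.incidence c

instance [Finite C] (ξ : D.Coloring) : Finite ξ.White := by
  unfold White Region; infer_instance

noncomputable instance [Finite C] (ξ : D.Coloring) : Fintype ξ.White := Fintype.ofFinite _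

open Classical in
/-- The pre-Goeritz matrix. -/
noncomputable def preGoeritz [Fintype C] (ξ : D.Coloring) : Matrix ξ.White ξ.White ℤ :=
  fun x y => if x = y then -∑ z with z ≠ x, ξ.goeritzEntry x z else ξ.goeritzEntry x y

/-- The Goeritz matrix: the row and the column of the white region `x₀` are removed. -/
noncomputable def goeritz [Fintype C] (ξ : D.Coloring) (x₀ : ξ.White) :
    Matrix {x : ξ.White // x ≠ x₀} {x : ξ.White // x ≠ x₀} ℤ :=
  ξ.preGoeritz.submatrix Subtype.val Subtype.val

open Classical in
/-- The signature of a symmetric integer matrix, viewed as a real quadratic form. -/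
noncomputable def matrixSignature {ι : Type*} [Finite ι] (A : Matrix ι ι ℤ) : ℤ :=
  letI := Fintype.ofFinite ι
  let Q : QuadraticForm ℝ (ι → ℝ) := (A.map (fun a : ℤ => (a : ℝ))).toQuadraticForm'
  (sigPos Q : ℤ) - sigNeg Q

open Classical in
/-- The correction term: the sum of the incidences of the crossings of type II, i.e. of those with
`ε(c) η(c) = 1`. -/
noncomputable def correction [Fintype C] (ξ : D.Coloring) : ℤ :=
  ∑ c with (D.sign c : ℤ) * ξ.incidence c = 1, ξ.incidence c

/-- The signature `σ_ξ(D)`, computed by removing the white region `x₀`. -/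
noncomputable def signature [Fintype C] (ξ : D.Coloring) (x₀ : ξ.White) : ℤ :=
  matrixSignature (ξ.goeritz x₀) - ξ.correction

end Coloring

/-! ### Khovanov homology -/

/-- A state: `false` stands for the `0`-smoothing and `true` for the `1`-smoothing. -/
abbrev State (_D : VirtualLinkDiagram C) : Type _ := C → Bool

/-- The leg to which a leg is joined inside its crossing in the state `s`.  The smoothing that
respects the orientation is the `0`-smoothing of a positive and the `1`-smoothing of a negative
crossing; it joins each incoming leg to the outgoing leg of the other strand.  The other smoothing
joins the two incoming legs and the two outgoing legs. -/
def smooth (D : VirtualLinkDiagram C) (s : D.State) : D.Leg → D.Leg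
  | (c, b, e) => (c, b.flip, if (D.sign c = 1 ↔ s c = false) then e.flip else e)

/-- The cycles of a state. -/
def Cycle (D : VirtualLinkDiagram C) (s : D.State) : Type _ :=
  Quot (fun l l' : D.Leg => l' = D.arc l ∨ l' = D.smooth s l) ⊕ Fin D.loops

/-- The cycle of the state `s` through the leg `l`. -/
def cycle (D : VirtualLinkDiagram C) (s : D.State) (l : D.Leg) : D.Cycle s :=
  Sum.inl (Quot.mk _ l)

instance [Finite C] (D : VirtualLinkDiagram C) (s : D.State) : Finite (D.Cycle s) := by
  unfold Cycle; infer_instance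

noncomputable instance [Finite C] (D : VirtualLinkDiagram C) (s : D.State) :
    Fintype (D.Cycle s) := Fintype.ofFinite _

/-- The basis `1, X` of `V`. -/
inductive Gen : Type
  | one
  | X
  deriving DecidableEq

instance : Fintype Gen := ⟨{.one, .X}, fun a => by cases a <;> decide⟩

/-- The degree on `V`. -/
def Gen.deg : Gen → ℤ
  | .one => 1
  | .X => -1

/-- `mulCoeff a b c` is the coefficient of `c` in `m (a ⊗ b)`. -/
def mulCoeff : Gen → Gen → Gen → ℚ
  | .one, .one, .one => 1
  | .one, .X, .X => 1
  | .X, .one, .X => 1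
  | _, _, _ => 0

/-- `comulCoeff a b c` is the coefficient of `b ⊗ c` in `Δ a`. -/
def comulCoeff : Gen → Gen → Gen → ℚ
  | .one, .one, .X => 1
  | .one, .X, .one => 1
  | .X, .X, .X => 1
  | _, _, _ => 0

/-- The standard basis of `⨁ₛ V^{⊗ cycles of s}`: a state with a label `1` or `X` on each cycle. -/
def Enhanced (D : VirtualLinkDiagram C) : Type _ := Σ s : D.State, D.Cycle s → Gen

noncomputable instance [Finite C] (D : VirtualLinkDiagram C) : Fintype D.Enhanced :=
  letI : Finite D.Enhanced := by unfold Enhanced; infer_instance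
  Fintype.ofFinite _

/-- The number `r` of `1`-smoothings of a state. -/
def height [Fintype C] (D : VirtualLinkDiagram C) (s : D.State) : ℕ :=
  (Finset.univ.filter fun c => s c = true).card

/-- The number of positive crossings. -/
def nPos [Fintype C] (D : VirtualLinkDiagram C) : ℕ :=
  (Finset.univ.filter fun c => D.sign c = 1).card

/-- The number of negative crossings. -/
def nNeg [Fintype C] (D : VirtualLinkDiagram C) : ℕ :=
  (Finset.univ.filter fun c => D.sign c = -1).card

/-- The homological degree `i = r - n₋`. -/
def homDeg [Fintype C] (D : VirtualLinkDiagram C) (e : D.Enhanced) : ℤ :=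
  (D.height e.1 : ℤ) - D.nNeg

/-- The quantum degree: the degree in `V^{⊗ k}` shifted by `r + n₊ - 2 n₋`. -/
noncomputable def qDeg [Fintype C] (D : VirtualLinkDiagram C) (e : D.Enhanced) : ℤ :=
  ∑ z, (e.2 z).deg + ((D.height e.1 : ℤ) + D.nPos - 2 * D.nNeg)

open Classical in
/-- The matrix coefficient, without sign, of the map from the state `s` to the state `s'` (which
differs from `s` only by the smoothing of `c`) between the basis elements `v` and `w`.  In either
state the two strings at `c` are the one through over-out and the one through over-in.  If they
belong to two cycles of `s` and to one cycle of `s'` the map is `m`, in the opposite case it is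
`Δ`, and it is zero for a single cycle smoothing; the other cycles carry the identity. -/
noncomputable def edgeCoeff (D : VirtualLinkDiagram C) (c : C) {s s' : D.State}
    (v : D.Cycle s → Gen) (w : D.Cycle s' → Gen) : ℚ :=
  let p : D.Leg := (c, .over, .outgoing)
  let q : D.Leg := (c, .over, .incoming)
  if (∀ l : D.Leg, D.cycle s l ≠ D.cycle s p → D.cycle s l ≠ D.cycle s q →
        v (D.cycle s l) = w (D.cycle s' l)) ∧
      ∀ f : Fin D.loops, v (Sum.inr f) = w (Sum.inr f) then
    if D.cycle s p ≠ D.cycle s q ∧ D.cycle s' p = D.cycle s' q then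
      mulCoeff (v (D.cycle s p)) (v (D.cycle s q)) (w (D.cycle s' p))
    else if D.cycle s p = D.cycle s q ∧ D.cycle s' p ≠ D.cycle s' q then
      comulCoeff (v (D.cycle s p)) (w (D.cycle s' p)) (w (D.cycle s' q))
    else 0
  else 0

/-- Signs for the edges of the cube of resolutions: `ε s c` is the sign of the edge that starts at
`s` and changes the smoothing of `c` (it is used only if `s c = false`). -/
abbrev EdgeSigns (D : VirtualLinkDiagram C) : Type _ := D.State → C → ℤˣ

/-- The usual signs: `-1` to the number of `1`-smoothings before the crossing that changes. -/
def standardSigns [Fintype C] [LinearOrder C] (D : VirtualLinkDiagram C) : D.EdgeSigns :=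
  fun s c => (-1) ^ (Finset.univ.filter fun c' => c' < c ∧ s c' = true).card

open Classical in
/-- The differential on `⨁ₛ V^{⊗ cycles of s}` with edge signs `ε`. -/
noncomputable def differential [Fintype C] (D : VirtualLinkDiagram C) (ε : D.EdgeSigns) :
    (D.Enhanced → ℚ) →ₗ[ℚ] (D.Enhanced → ℚ) :=
  Matrix.mulVecLin (Matrix.of fun e' e : D.Enhanced =>
    ∑ c with e.1 c = false ∧ e'.1 = Function.update e.1 c true,
      (((ε e.1 c : ℤˣ) : ℤ) : ℚ) * D.edgeCoeff c e.2 e'.2)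

/-- The chains of bidegree `(i, j)`. -/
def chains [Fintype C] (D : VirtualLinkDiagram C) (i j : ℤ) : Submodule ℚ (D.Enhanced → ℚ) where
  carrier := {x | ∀ e, x e ≠ 0 → D.homDeg e = i ∧ D.qDeg e = j}
  zero_mem' := fun _ h => absurd rfl h
  add_mem' := by
    intro x y hx hy e h
    by_cases h0 : x e = 0
    · exact hy e (by simpa [h0] using h)
    · exact hx e h0
  smul_mem' := by
    intro a x hx e h
    exact hx e (by simpa using right_ne_zero_of_mul h)

/-- The cocycles of bidegree `(i, j)`. -/
noncomputable def cocycles [Fintype C] (D : VirtualLinkDiagram C) (ε : D.EdgeSigns) (i j : ℤ) :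
    Submodule ℚ (D.Enhanced → ℚ) :=
  LinearMap.ker (D.differential ε) ⊓ D.chains i j

/-- The coboundaries of bidegree `(i, j)`. -/
noncomputable def coboundaries [Fintype C] (D : VirtualLinkDiagram C) (ε : D.EdgeSigns)
    (i j : ℤ) : Submodule ℚ (D.Enhanced → ℚ) :=
  (D.chains (i - 1) j).map (D.differential ε)

/-- Khovanov homology `Kh^{i,j}(D)` with rational coefficients, for edge signs `ε` for which the
differential squares to zero. -/
abbrev Kh [Fintype C] (D : VirtualLinkDiagram C) (ε : D.EdgeSigns) (i j : ℤ) : Type _ :=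
  D.cocycles ε i j ⧸ (D.coboundaries ε i j).submoduleOf (D.cocycles ε i j)

end VirtualLinkDiagram

/-!
Let `n` be the number of crossings of `D`, and let `k₀` and `k₁` be the numbers of cycles of the
states in which all smoothings are `0`-smoothings and `1`-smoothings respectively.

*Signatures and genus.*  As `D` is alternating, the corners to the left of the over-legs and those
to the left of the under-legs are never in the same region, which gives the coloring with `η = -1`
(`IsAlternating.coloring`).  Its white regions are bounded by the `k₁` cycles of the second state,
its black regions by the `k₀` cycles of the first (`IsAlternating.card_white`).  The Goeritz form is
up to sign the Laplacian of the graph whose vertices are the white regions and whose edges are the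
crossings, with one vertex removed; this graph is connected, so that the form is definite
(`IsAlternating.matrixSignature_goeritz`).
Hence `σ_ξ = 1 - k₁ + n₋` and `σ_ξ* = k₀ - 1 - n₊`, and `χ(Σ) = k₀ + k₁ - n` gives the relation
`σ_ξ = σ_ξ* + 2 g`.

*Support of the homology.*  The diagonal degree `δ = j - 2 i - n₊` is, for a labelled state, the
degree of the labels minus the number of `1`-smoothings, and the differential lowers it by `2`.
It is congruent to `k₀` modulo `2` because a change of smoothing changes the number of cycles by
one:
single cycle smoothings do not occur, since in an alternating diagram the cycles of a state are the
cycles of a permutation, which a change of smoothing composes with a transposition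
(`IsAlternating.cycleRel_flip`).  It remains to show that the homology vanishes unless
`k₁ - n - 2 ≤ δ ≤ 2 - k₀`; these are `g + 2` values of `δ`.

The upper bound is proved by induction for all partially resolved diagrams, with `κ` components,
from a state `s` in which the unresolved crossings are `0`-smoothed: the homology vanishes for
`δ > 2 κ - k(s) - r(s)` (`Cube.exactOn_cell`).  Consider the graph whose vertices are
the cycles of `s` and whose edges are the unresolved crossings.  If some edge is not a bridge, both
resolutions of this crossing satisfy the induction hypothesis, and the long exact sequence applies.
If all crossings are bridges, the graph is a forest and has a leaf, and the crossing there
is removed as in the proof of invariance under the first Reidemeister move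
(`Cube.exactOn_cell_of_leaf`).  No planarity is used, and everything takes place in an abstract
cube of equivalence relations (`Cube`).  The lower bound is the upper bound for the mirror image,
whose complex is the dual one (`Cube.exactOn_univ_of_lt`).  Resolving the crossings one by one
also gives `k₀ + k₁ ≤ n + 2`, that is, `χ(Σ) ≤ 2` (`Cube.numClasses_add_le`).

*The differential.*  The edge maps commute with the multiplication by `X` at a point of the diagram,
and the states with all labels `1` generate under these multiplications.  On such states an edge map
is the identity for a merge and multiplication by `X_p + X_q` for a split, so that the faces of the
cube commute (`Cube.edgeMap_comm`), and edge signs that anticommute on each face give `d² = 0`.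
-/

namespace VirtualLinkDiagram

/-! ### The usual edge signs -/

section StandardSigns

variable {C : Type*} [Fintype C] [LinearOrder C] (D : VirtualLinkDiagram C)

theorem standardSigns_update_of_gt (s : D.State) {c c' : C} (h : c < c') :
    D.standardSigns (Function.update s c' true) c = D.standardSigns s c := by
  unfold standardSigns
  congr 2
  refine Finset.filter_congr fun x _ => and_congr_right fun hx => ?_
  rw [Function.update_of_ne (hx.trans h).ne]

theorem standardSigns_update_of_lt {s : D.State} {c c' : C} (h : c < c') (hs : s c = false) :
    D.standardSigns (Function.update s c true) c' = -D.standardSigns s c' := by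
  have h1 : (Finset.univ.filter fun x => x < c' ∧ Function.update s c true x = true) =
      insert c (Finset.univ.filter fun x => x < c' ∧ s x = true) := by
    ext x
    by_cases hx : x = c
    · simp [hx, h]
    · simp [hx]
  unfold standardSigns
  rw [h1, Finset.card_insert_of_notMem (by simp [hs]), pow_succ, mul_neg_one]

/-- The usual signs anticommute on every face of the cube: the sign at the larger of two crossings
depends on the smoothing of the smaller one, but not conversely. -/
theorem standardSigns_anticomm (s : D.State) (c c' : C) (hne : c ≠ c') (hc : s c = false)
    (hc' : s c' = false) :
    D.standardSigns s c * D.standardSigns (Function.update s c true) c' =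
      -(D.standardSigns s c' * D.standardSigns (Function.update s c' true) c) := by
  rcases lt_or_gt_of_ne hne with h | h
  · rw [D.standardSigns_update_of_gt s h, D.standardSigns_update_of_lt h hc, mul_neg, mul_comm]
  · rw [D.standardSigns_update_of_gt s h, D.standardSigns_update_of_lt h hc', mul_neg, neg_neg,
      mul_comm]

end StandardSigns

open Classical

/-! ### Equivalence relations and their numbers of classes -/

section Setoids

variable {L : Type*}

/-- The equivalence relation obtained from `E` by identifying the classes of `p` and `q`. -/
def glue (E : Setoid L) (p q : L) : Setoid L where
  r x y := E x y ∨ ((E x p ∨ E x q) ∧ (E y p ∨ E y q))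
  iseqv :=
    { refl := fun x => Or.inl (E.refl x)
      symm := by
        rintro x y (h | ⟨hx, hy⟩)
        · exact Or.inl (E.symm h)
        · exact Or.inr ⟨hy, hx⟩
      trans := by
        rintro x y z (h | ⟨hx, hy⟩) (h' | ⟨hy', hz⟩)
        · exact Or.inl (E.trans h h')
        · exact Or.inr ⟨hy'.imp (E.trans h) (E.trans h), hz⟩
        · exact Or.inr ⟨hx, hy.imp (E.trans (E.symm h')) (E.trans (E.symm h'))⟩
        · exact Or.inr ⟨hx, hz⟩ }

theorem le_glue (E : Setoid L) (p q : L) : E ≤ glue E p q := fun _ _ h => Or.inl h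

theorem glue_pair (E : Setoid L) (p q : L) : glue E p q p q :=
  Or.inr ⟨Or.inl (E.refl p), Or.inr (E.refl q)⟩

theorem glue_le {E F : Setoid L} {p q : L} (h : E ≤ F) (hpq : F p q) : glue E p q ≤ F := by
  have key : ∀ x, (E x p ∨ E x q) → F x p := by
    rintro x (hx | hx)
    · exact h hx
    · exact F.trans (h hx) (F.symm hpq)
  rintro x y (hxy | ⟨hx, hy⟩)
  · exact h hxy
  · exact F.trans (key x hx) (F.symm (key y hy))

theorem glue_eq_self {E : Setoid L} {p q : L} (h : E p q) : glue E p q = E :=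
  le_antisymm (glue_le le_rfl h) (le_glue E p q)

theorem glue_comm (E : Setoid L) (p q : L) : glue E p q = glue E q p :=
  le_antisymm (glue_le (le_glue _ _ _) ((glue E q p).symm (glue_pair E q p)))
    (glue_le (le_glue _ _ _) ((glue E p q).symm (glue_pair E p q)))

/-- The number of classes. -/
noncomputable def numClasses (E : Setoid L) : ℕ := Nat.card (Quotient E)

/-- The sum over the classes of a function that is constant on each of them. -/
noncomputable def classSum (E : Setoid L) (f : L → ℤ) : ℤ := ∑ᶠ z : Quotient E, f z.out

theorem classSum_one [Finite L] (E : Setoid L) : classSum E (fun _ => 1) = numClasses E := by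
  let := Fintype.ofFinite (Quotient E)
  simp [classSum, numClasses, finsum_eq_sum_of_fintype, Nat.card_eq_fintype_card]

/-- Gluing the classes of `p` and `q` replaces two summands by one. -/
theorem classSum_glue [Finite L] {E : Setoid L} {p q : L} (hpq : ¬ E p q) {f f' : L → ℤ}
    (hf : ∀ x y, E x y → f x = f y) (hf' : ∀ x y, glue E p q x y → f' x = f' y)
    (h : ∀ l, ¬ E l p → ¬ E l q → f l = f' l) :
    classSum E f = classSum (glue E p q) f' + f p + f q - f' p := by
  let := Fintype.ofFinite (Quotient E)
  let := Fintype.ofFinite (Quotient (glue E p q))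
  simp only [classSum, finsum_eq_sum_of_fintype]
  have out : ∀ x, E (Quotient.mk E x).out x := fun x => Quotient.mk_out (s := E) x
  have out' : ∀ x, glue E p q (Quotient.mk (glue E p q) x).out x :=
    fun x => Quotient.mk_out (s := glue E p q) x
  have hne : Quotient.mk E p ≠ Quotient.mk E q := fun h => hpq (Quotient.exact h)
  rw [← Finset.add_sum_erase _ _ (Finset.mem_univ (Quotient.mk E q)),
    ← Finset.add_sum_erase _ _ (Finset.mem_erase.2 ⟨hne, Finset.mem_univ (Quotient.mk E p)⟩),
    ← Finset.add_sum_erase _ _ (Finset.mem_univ (Quotient.mk (glue E p q) p)),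
    hf _ _ (out p), hf _ _ (out q), hf' _ _ (out' p)]
  have main : ∑ z ∈ (Finset.univ.erase (Quotient.mk E q)).erase (Quotient.mk E p), f z.out =
      ∑ z ∈ Finset.univ.erase (Quotient.mk (glue E p q) p), f' z.out := by
    have notin : ∀ z ∈ (Finset.univ.erase (Quotient.mk E q)).erase (Quotient.mk E p),
        ¬ E z.out p ∧ ¬ E z.out q := by
      intro z hz
      simp only [Finset.mem_erase, Finset.mem_univ, and_true] at hz
      constructor
      · intro h; exact hz.1 (by rw [← Quotient.out_eq z]; exact Quotient.sound h)
      · intro h; exact hz.2 (by rw [← Quotient.out_eq z]; exact Quotient.sound h)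
    refine Finset.sum_bij (fun z _ => Quotient.mk (glue E p q) z.out) ?_ ?_ ?_ ?_
    · intro z hz
      have hz' := notin z hz
      simp only [Finset.mem_erase, Finset.mem_univ, and_true]
      intro h
      rcases (Quotient.exact h : glue E p q z.out p) with h | ⟨h | h, _⟩
      · exact hz'.1 h
      · exact hz'.1 h
      · exact hz'.2 h
    · intro z hz w hw h
      have hz' := notin z hz
      rcases (Quotient.exact h : glue E p q z.out w.out) with h | ⟨h | h, _⟩
      · rw [← Quotient.out_eq z, ← Quotient.out_eq w]; exact Quotient.sound h
      · exact (hz'.1 h).elim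
      · exact (hz'.2 h).elim
    · intro w hw
      simp only [Finset.mem_erase, Finset.mem_univ, and_true] at hw
      refine ⟨Quotient.mk E w.out, ?_, ?_⟩
      · simp only [Finset.mem_erase, Finset.mem_univ, and_true]
        constructor
        · intro h
          apply hw
          rw [← Quotient.out_eq w]
          exact Quotient.sound (Or.inl (Quotient.exact h))
        · intro h
          apply hw
          rw [← Quotient.out_eq w]
          exact Quotient.sound ((glue E p q).trans (Or.inl (Quotient.exact h))
            ((glue E p q).symm (glue_pair E p q)))
      · conv_rhs => rw [← Quotient.out_eq w]
        exact Quotient.sound (Or.inl (out w.out))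
    · intro z hz
      have hz' := notin z hz
      rw [h _ hz'.1 hz'.2]
      exact (hf' _ _ (out' z.out)).symm
  rw [main]
  ring

theorem numClasses_glue [Finite L] {E : Setoid L} {p q : L} (hpq : ¬ E p q) :
    numClasses E = numClasses (glue E p q) + 1 := by
  have := classSum_glue hpq (f := fun _ => 1) (f' := fun _ => 1) (fun _ _ _ => rfl)
    (fun _ _ _ => rfl) (fun _ _ _ => rfl)
  rw [classSum_one, classSum_one] at this
  omega

theorem numClasses_glue_le [Finite L] (E : Setoid L) (p q : L) :
    numClasses (glue E p q) ≤ numClasses E := by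
  by_cases h : E p q
  · rw [glue_eq_self h]
  · have := numClasses_glue h; omega

end Setoids

/-! ### Cubes of resolutions without single cycle smoothings -/

/-- The combinatorial skeleton of a cube of resolutions without single cycle smoothings: for each
state an equivalence relation on a set of points (its classes are the cycles of the state), and at
each crossing two points through which the two strings of a state at this crossing pass.  Changing
the smoothing of the crossing merges the cycles of these points if they are different, and splits
their common cycle into the cycles of the two points otherwise. -/
structure Cube (C L : Type*) where
  rel : (C → Bool) → Setoid L
  p : C → L
  q : C → L
  glue_flip : ∀ s c, glue (rel (Function.update s c (!s c))) (p c) (q c) = glue (rel s) (p c) (q c)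
  rel_flip : ∀ s c, rel (Function.update s c (!s c)) (p c) (q c) ↔ ¬ rel s (p c) (q c)

namespace Cube

variable {C L : Type*} (Q : Cube C L)

/-- A state with a label `1` or `X` on each cycle, the labels being recorded at all points of the
cycle. -/
@[ext]
structure Labelled where
  state : C → Bool
  label : L → Gen
  compat : ∀ x y, Q.rel state x y → label x = label y

instance [Finite C] [Finite L] : Finite Q.Labelled :=
  Finite.of_injective (fun a : Q.Labelled => (a.state, a.label)) (by
    intro a b h
    simp only [Prod.mk.injEq] at h
    exact Labelled.ext h.1 h.2)

noncomputable instance [Finite C] [Finite L] : Fintype Q.Labelled := Fintype.ofFinite _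

/-- The matrix coefficient of the edge map at `c` from `a` to `b`, without sign. -/
noncomputable def coef (c : C) (a b : Q.Labelled) : ℚ :=
  if ∀ l, ¬ Q.rel a.state l (Q.p c) → ¬ Q.rel a.state l (Q.q c) → a.label l = b.label l then
    if ¬ Q.rel a.state (Q.p c) (Q.q c) ∧ Q.rel b.state (Q.p c) (Q.q c) then
      mulCoeff (a.label (Q.p c)) (a.label (Q.q c)) (b.label (Q.p c))
    else if Q.rel a.state (Q.p c) (Q.q c) ∧ ¬ Q.rel b.state (Q.p c) (Q.q c) then
      comulCoeff (a.label (Q.p c)) (b.label (Q.p c)) (b.label (Q.q c))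
    else 0
  else 0

/-- The state `s'` arises from `s` by changing the smoothing of `c` from `0` to `1`. -/
def Step (c : C) (s s' : C → Bool) : Prop := s c = false ∧ s' = Function.update s c true

/-- The matrix coefficients of the differential, from `a` to `b`. -/
noncomputable def diff [Fintype C] (ε : (C → Bool) → C → ℤˣ) (b a : Q.Labelled) : ℚ :=
  ∑ c with Step c a.state b.state, (((ε a.state c : ℤˣ) : ℤ) : ℚ) * Q.coef c a b

/-- The degree of the labels. -/
noncomputable def deg (a : Q.Labelled) : ℤ := classSum (Q.rel a.state) (fun l => (a.label l).deg)

/-- The number of `1`-smoothings. -/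
noncomputable def ht [Fintype C] (s : C → Bool) : ℕ := (Finset.univ.filter fun c => s c = true).card

/-- The diagonal degree; up to a constant it is `j - 2 i` in terms of the quantum degree and the
homological degree. -/
noncomputable def gr [Fintype C] (a : Q.Labelled) : ℤ := Q.deg a - ht a.state

variable {Q}

theorem Step.eq_flip {c : C} {s s' : C → Bool} (h : Step c s s') :
    s' = Function.update s c (!s c) := by rw [h.2, h.1]; rfl

theorem Step.glue_eq {c : C} {s s' : C → Bool} (h : Step c s s') :
    glue (Q.rel s') (Q.p c) (Q.q c) = glue (Q.rel s) (Q.p c) (Q.q c) := by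
  rw [h.eq_flip, Q.glue_flip]

theorem Step.rel_iff {c : C} {s s' : C → Bool} (h : Step c s s') :
    Q.rel s' (Q.p c) (Q.q c) ↔ ¬ Q.rel s (Q.p c) (Q.q c) := by
  rw [h.eq_flip, Q.rel_flip]

theorem Step.unique {c c' : C} {s s' : C → Bool} (h : Step c s s') (h' : Step c' s s') :
    c' = c := by
  by_contra hne
  have h1 : s' c' = true := by rw [h'.2]; simp
  rw [h.2, Function.update_of_ne hne, h'.1] at h1
  exact absurd h1 (by simp)

theorem Step.ht_eq [Fintype C] {c : C} {s s' : C → Bool} (h : Step c s s') :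
    ht s' = ht s + 1 := by
  unfold ht
  have : (Finset.univ.filter fun x => s' x = true) =
      insert c (Finset.univ.filter fun x => s x = true) := by
    ext x
    rw [h.2]
    by_cases hx : x = c
    · simp [hx]
    · simp [hx]
  rw [this, Finset.card_insert_of_notMem (by simp [h.1])]

/-- A step that merges two cycles. -/
theorem Step.rel_eq_glue {c : C} {s s' : C → Bool} (h : Step c s s')
    (hs : ¬ Q.rel s (Q.p c) (Q.q c)) : Q.rel s' = glue (Q.rel s) (Q.p c) (Q.q c) := by
  rw [← h.glue_eq, glue_eq_self (h.rel_iff.2 hs)]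

/-- A step that splits a cycle. -/
theorem Step.rel_eq_glue' {c : C} {s s' : C → Bool} (h : Step c s s')
    (hs : Q.rel s (Q.p c) (Q.q c)) : Q.rel s = glue (Q.rel s') (Q.p c) (Q.q c) := by
  rw [h.glue_eq, glue_eq_self hs]

/-- Away from the two strings at `c`, the condition in `coef` may be read off either state. -/
theorem Step.off_iff {c : C} {s s' : C → Bool} (h : Step c s s') (l : L) :
    (Q.rel s' l (Q.p c) ∨ Q.rel s' l (Q.q c)) ↔ (Q.rel s l (Q.p c) ∨ Q.rel s l (Q.q c)) := by
  have key : ∀ (E : Setoid L) (p q : L), (E l p ∨ E l q) ↔ glue E p q l p := by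
    intro E p q
    constructor
    · intro h; exact Or.inr ⟨h, Or.inl (E.refl p)⟩
    · rintro (h | ⟨h, _⟩)
      · exact Or.inl h
      · exact h
  rw [key, key, h.glue_eq]

theorem diff_of_step [Fintype C] {ε : (C → Bool) → C → ℤˣ} {c : C} {a b : Q.Labelled}
    (h : Step c a.state b.state) :
    Q.diff ε b a = (((ε a.state c : ℤˣ) : ℤ) : ℚ) * Q.coef c a b := by
  unfold diff
  rw [Finset.sum_eq_single c]
  · intro c' hc' hne
    simp only [Finset.mem_filter, Finset.mem_univ, true_and] at hc'
    exact absurd (h.unique hc') hne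
  · intro hc
    simp only [Finset.mem_filter, Finset.mem_univ, true_and] at hc
    exact absurd h hc

theorem exists_step_of_diff_ne_zero [Fintype C] {ε : (C → Bool) → C → ℤˣ} {a b : Q.Labelled}
    (h : Q.diff ε b a ≠ 0) : ∃ c, Step c a.state b.state ∧ Q.coef c a b ≠ 0 := by
  by_contra hcon
  push Not at hcon
  apply h
  unfold diff
  refine Finset.sum_eq_zero fun c hc => ?_
  simp only [Finset.mem_filter, Finset.mem_univ, true_and] at hc
  rw [hcon c hc, mul_zero]

theorem mulCoeff_deg {x y z : Gen} (h : mulCoeff x y z ≠ 0) : z.deg + 1 = x.deg + y.deg := by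
  cases x <;> cases y <;> cases z <;> simp [mulCoeff, Gen.deg] at h ⊢

theorem comulCoeff_deg {x y z : Gen} (h : comulCoeff x y z ≠ 0) : y.deg + z.deg + 1 = x.deg := by
  cases x <;> cases y <;> cases z <;> simp [comulCoeff, Gen.deg] at h ⊢

theorem deg_of_coef_ne_zero [Finite L] {c : C} {a b : Q.Labelled} (h : Step c a.state b.state)
    (hc : Q.coef c a b ≠ 0) : Q.deg a = Q.deg b + 1 := by
  unfold coef at hc
  split_ifs at hc with h1 h2 h3
  · have := mulCoeff_deg hc
    unfold deg
    rw [classSum_glue h2.1 (f' := fun l => (b.label l).deg), ← h.rel_eq_glue h2.1]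
    · linarith
    · intro x y hxy; rw [a.compat x y hxy]
    · intro x y hxy
      rw [← h.rel_eq_glue h2.1] at hxy
      rw [b.compat x y hxy]
    · intro l hp hq; rw [h1 l hp hq]
  · have := comulCoeff_deg hc
    unfold deg
    rw [classSum_glue (E := Q.rel b.state) h3.2 (f' := fun l => (a.label l).deg),
      ← h.rel_eq_glue' h3.1]
    · linarith
    · intro x y hxy; rw [b.compat x y hxy]
    · intro x y hxy
      rw [← h.rel_eq_glue' h3.1] at hxy
      rw [a.compat x y hxy]
    · intro l hp hq
      have := h.off_iff (Q := Q) l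
      rw [h1 l (by tauto) (by tauto)]
  all_goals exact absurd rfl hc

theorem gr_of_diff_ne_zero [Fintype C] [Finite L] {ε : (C → Bool) → C → ℤˣ} {a b : Q.Labelled}
    (h : Q.diff ε b a ≠ 0) : Q.gr a = Q.gr b + 2 := by
  obtain ⟨c, hc, hne⟩ := exists_step_of_diff_ne_zero h
  have := deg_of_coef_ne_zero hc hne
  have := hc.ht_eq
  unfold gr
  omega

end Cube

/-! ### Exactness of based complexes -/

section Exactness

variable {B : Type*} [Fintype B]

/-- Exactness in degree `n` of the complex spanned by the basis elements in `S`, where `d b a` is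
the coefficient of `b` in the differential of `a` and the differential lowers the degree `g`
by `2`. -/
def ExactOn (d : B → B → ℚ) (g : B → ℤ) (S : Set B) (n : ℤ) : Prop :=
  ∀ x : B → ℚ, (∀ b, x b ≠ 0 → b ∈ S ∧ g b = n) → (∀ b ∈ S, ∑ a, d b a * x a = 0) →
    ∃ y : B → ℚ, (∀ b, y b ≠ 0 → b ∈ S ∧ g b = n + 2) ∧ ∀ b ∈ S, ∑ a, d b a * y a = x b

/-- The matrix `d` restricted to `S` squares to zero. -/
def SqZeroOn (d : B → B → ℚ) (S : Set B) : Prop :=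
  ∀ a ∈ S, ∀ b ∈ S, ∑ m, (if m ∈ S then d b m * d m a else 0) = 0

variable {d : B → B → ℚ} {g : B → ℤ}

/-- The differential of `x - d y` restricted to `S` agrees with that of `x`. -/
theorem SqZeroOn.sum_sub {S : Set B} (hd : SqZeroOn d S) {x y : B → ℚ}
    (hx : ∀ b, x b ≠ 0 → b ∈ S) (hy : ∀ b, y b ≠ 0 → b ∈ S) {b : B} (hb : b ∈ S) :
    ∑ a, d b a * (if a ∈ S then x a - ∑ m, d a m * y m else 0) = ∑ a, d b a * x a := by
  have h1 : ∀ a, d b a * (if a ∈ S then x a - ∑ m, d a m * y m else 0) =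
      d b a * x a - ∑ m, (if a ∈ S then d b a * d a m else 0) * y m := by
    intro a
    by_cases ha : a ∈ S
    · simp only [ha, if_true, mul_sub, Finset.mul_sum, mul_assoc]
    · have : x a = 0 := by by_contra h; exact ha (hx a h)
      simp [ha, this]
  simp only [h1, Finset.sum_sub_distrib]
  rw [Finset.sum_comm, sub_eq_self]
  refine Finset.sum_eq_zero fun m _ => ?_
  rw [← Finset.sum_mul]
  by_cases hm : y m = 0
  · rw [hm, mul_zero]
  · rw [hd m (hy m hm) b hb, zero_mul]

/-- The long exact sequence: `S₁` spans a subcomplex with quotient spanned by `S₀`. -/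
theorem ExactOn.union {S S₀ S₁ : Set B} {n : ℤ} (hg : ∀ a b, d b a ≠ 0 → g a = g b + 2)
    (hd : SqZeroOn d S) (hS : S = S₀ ∪ S₁)
    (hz : ∀ b ∈ S₀, ∀ a ∈ S₁, d b a = 0) (h₀ : ExactOn d g S₀ n) (h₁ : ExactOn d g S₁ n) :
    ExactOn d g S n := by
  intro x hx hdx
  have sub₀ : S₀ ⊆ S := hS ▸ Set.subset_union_left
  have sub₁ : S₁ ⊆ S := hS ▸ Set.subset_union_right
  obtain ⟨y₀, hy₀, hdy₀⟩ := h₀ (fun b => if b ∈ S₀ then x b else 0)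
    (by
      intro b hb
      by_cases h : b ∈ S₀
      · rw [if_pos h] at hb; exact ⟨h, (hx b hb).2⟩
      · exact absurd (if_neg h) hb)
    (by
      intro b hb
      refine (Finset.sum_congr rfl fun a _ => ?_).trans (hdx b (sub₀ hb))
      by_cases h : a ∈ S₀
      · rw [if_pos h]
      · rw [if_neg h, mul_zero]
        by_cases hxa : x a = 0
        · rw [hxa, mul_zero]
        · have := (hx a hxa).1
          rw [hS] at this
          rw [hz b hb a (this.resolve_left h), zero_mul])
  have hy₀S : ∀ b, y₀ b ≠ 0 → b ∈ S := fun b hb => sub₀ (hy₀ b hb).1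
  obtain ⟨y₁, hy₁, hdy₁⟩ := h₁ (fun b => if b ∈ S then x b - ∑ a, d b a * y₀ a else 0)
    (by
      intro b hb
      by_cases h : b ∈ S
      swap
      · exact absurd (if_neg h) hb
      rw [if_pos h] at hb
      constructor
      · by_contra h1
        have h0 : b ∈ S₀ := by rw [hS] at h; exact h.resolve_right h1
        apply hb
        rw [hdy₀ b h0, if_pos h0, sub_self]
      · by_cases hxb : x b = 0
        · rw [hxb, zero_sub, neg_ne_zero] at hb
          obtain ⟨a, -, ha⟩ := Finset.exists_ne_zero_of_sum_ne_zero hb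
          have h1 := hg a b (left_ne_zero_of_mul ha)
          have h2 := (hy₀ a (right_ne_zero_of_mul ha)).2
          omega
        · exact (hx b hxb).2)
    (by
      intro b hb
      rw [hd.sum_sub (fun b hb => (hx b hb).1) hy₀S (sub₁ hb), hdx b (sub₁ hb)])
  refine ⟨fun b => y₀ b + y₁ b, ?_, ?_⟩
  · intro b hb
    by_cases h : y₀ b = 0
    · simp only [h, zero_add] at hb
      exact ⟨sub₁ (hy₁ b hb).1, (hy₁ b hb).2⟩
    · exact ⟨sub₀ (hy₀ b h).1, (hy₀ b h).2⟩
  · intro b hb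
    simp only [mul_add, Finset.sum_add_distrib]
    have hb' := hb
    rw [hS] at hb'
    rcases hb' with h | h
    · rw [hdy₀ b h, if_pos h, add_eq_left]
      refine Finset.sum_eq_zero fun a _ => ?_
      by_cases ha : y₁ a = 0
      · rw [ha, mul_zero]
      · rw [hz b h a (hy₁ a ha).1, zero_mul]
    · rw [hdy₁ b h, if_pos hb]; ring

/-- The cone of an isomorphism is acyclic: the coefficients from `P₀` to `P₁` form a monomial
matrix. -/
theorem ExactOn.of_monomial {S P₀ P₁ : Set B} (n : ℤ) (hg : ∀ a b, d b a ≠ 0 → g a = g b + 2)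
    (hd : SqZeroOn d S) (hS : S = P₀ ∪ P₁)
    (h1 : ∀ a ∈ P₀, ∃ b ∈ P₁, d b a ≠ 0) (h2 : ∀ b ∈ P₁, ∃ a ∈ P₀, d b a ≠ 0)
    (h3 : ∀ a ∈ P₀, ∀ b ∈ P₁, ∀ b' ∈ P₁, d b a ≠ 0 → d b' a ≠ 0 → b = b')
    (h4 : ∀ b ∈ P₁, ∀ a ∈ P₀, ∀ a' ∈ P₀, d b a ≠ 0 → d b a' ≠ 0 → a = a') :
    ExactOn d g S n := by
  intro x hx hdx
  have sub₀ : P₀ ⊆ S := hS ▸ Set.subset_union_left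
  have sub₁ : P₁ ⊆ S := hS ▸ Set.subset_union_right
  choose! φ hφ hφd using h1
  -- for elements supported on `P₀` only one coefficient contributes to each value on `P₁`
  have single : ∀ y : B → ℚ, (∀ b, y b ≠ 0 → b ∈ P₀) → ∀ a ∈ P₀,
      ∑ m, d (φ a) m * y m = d (φ a) a * y a := by
    intro y hy a ha
    refine Finset.sum_eq_single a ?_ (fun h => absurd (Finset.mem_univ a) h)
    intro m _ hm
    by_cases hym : y m = 0
    · rw [hym, mul_zero]
    · by_cases hdm : d (φ a) m = 0
      · rw [hdm, zero_mul]
      · exact absurd (h4 _ (hφ a ha) m (hy m hym) a ha hdm (hφd a ha)) hm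
  set y : B → ℚ := fun b => if b ∈ P₀ then x (φ b) / d (φ b) b else 0 with hy
  have hyP : ∀ b, y b ≠ 0 → b ∈ P₀ := by
    intro b hb
    by_contra h
    exact hb (if_neg h)
  have hd1 : ∀ b ∈ P₁, ∑ a, d b a * y a = x b := by
    intro b hb
    obtain ⟨a, ha, hda⟩ := h2 b hb
    have : φ a = b := h3 a ha _ (hφ a ha) b hb (hφd a ha) hda
    subst this
    rw [single y hyP a ha, hy]
    simp only [if_pos ha]
    field_simp
  refine ⟨y, ?_, ?_⟩
  · intro b hb
    have hbP := hyP b hb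
    refine ⟨sub₀ hbP, ?_⟩
    simp only [hy, if_pos hbP] at hb
    have hx1 : x (φ b) ≠ 0 := fun h => hb (by rw [h, zero_div])
    rw [hg b _ (hφd b hbP), (hx _ hx1).2]
  · intro b hb
    rw [hS] at hb
    rcases hb with hb | hb
    · set w : B → ℚ := fun b => if b ∈ S then x b - ∑ a, d b a * y a else 0 with hw
      have hwP : ∀ b, w b ≠ 0 → b ∈ P₀ := by
        intro b hb
        by_cases h : b ∈ S
        · have h' := h
          rw [hS] at h'
          refine h'.resolve_right fun h1 => hb ?_
          simp only [hw, if_pos h, hd1 b h1, sub_self]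
        · exact absurd (if_neg h) hb
      have hw0 := single w hwP b hb
      rw [hd.sum_sub (fun b hb => (hx b hb).1) (fun b hb => sub₀ (hyP b hb)) (sub₁ (hφ b hb)),
        hdx _ (sub₁ (hφ b hb))] at hw0
      have : w b = 0 := by
        rcases mul_eq_zero.1 hw0.symm with h | h
        · exact absurd h (hφd b hb)
        · exact h
      simp only [hw, if_pos (sub₀ hb)] at this
      linarith
    · exact hd1 b hb

/-- A direct summand `A'` that is isomorphic, up to a shift of the degree by `2`, to the
complementary summand. -/
theorem ExactOn.of_summand {D A A' : Set B} {n : ℤ} (hD : D = A ∪ A')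
    (hz : ∀ b ∈ A', ∀ a ∈ A, d b a = 0) (hz' : ∀ b ∈ A, ∀ a ∈ A', d b a = 0)
    (τ : B → B) (hτ : ∀ a, τ (τ a) = a)
    (hτA : ∀ a, a ∈ A' ↔ τ a ∈ A) (hτd : ∀ a ∈ A', ∀ b ∈ A', d (τ b) (τ a) = d b a)
    (hτg : ∀ a ∈ A', g (τ a) = g a + 2) (h : ExactOn d g D (n + 2)) : ExactOn d g A' n := by
  intro x hx hdx
  have hτA' : ∀ a, a ∈ A ↔ τ a ∈ A' := fun a => by rw [hτA, hτ]
  have reindex : ∀ (z : B → ℚ) b, ∑ a, d b a * z (τ a) = ∑ a, d b (τ a) * z a := by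
    intro z b
    refine Fintype.sum_bijective τ (Function.Involutive.bijective hτ) _ _ fun a => ?_
    rw [hτ]
  have hxA : ∀ b, x (τ b) ≠ 0 → b ∈ A := fun b hb => (hτA' b).2 (hx _ hb).1
  obtain ⟨y, hy, hdy⟩ := h (fun b => x (τ b))
    (by
      intro b hb
      refine ⟨hD ▸ Or.inl (hxA b hb), ?_⟩
      have := hτg _ (hx _ hb).1
      rw [hτ, (hx _ hb).2] at this
      exact this)
    (by
      intro b hb
      rw [hD] at hb
      rcases hb with hb | hb
      · rw [reindex, ← hdx (τ b) ((hτA' b).1 hb)]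
        refine Finset.sum_congr rfl fun a _ => ?_
        by_cases hxa : x a = 0
        · rw [hxa, mul_zero, mul_zero]
        · rw [← hτd a (hx a hxa).1 (τ b) ((hτA' b).1 hb), hτ]
      · refine Finset.sum_eq_zero fun a _ => ?_
        by_cases hxa : x (τ a) = 0
        · rw [hxa, mul_zero]
        · rw [hz b hb a (hxA a hxa), zero_mul])
  refine ⟨fun b => if b ∈ A' then y (τ b) else 0, ?_, ?_⟩
  · intro b hb
    by_cases h : b ∈ A'
    · simp only [if_pos h] at hb
      have h1 := hτg b h
      have h2 := (hy _ hb).2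
      exact ⟨h, by omega⟩
    · exact absurd (if_neg h) hb
  · intro b hb
    have hτb := (hτA b).1 hb
    have h1 := hdy (τ b) (hD ▸ Or.inl hτb)
    rw [hτ] at h1
    rw [← h1]
    have h2 := reindex (fun c => if c ∈ A then y c else 0) b
    simp only [← hτA] at h2
    rw [h2]
    refine Finset.sum_congr rfl fun a _ => ?_
    by_cases ha : a ∈ A
    · rw [if_pos ha]
      have h3 := hτd _ ((hτA' a).1 ha) b hb
      rw [hτ] at h3
      rw [← h3]
    · rw [if_neg ha, mul_zero]
      by_cases hya : y a = 0
      · rw [hya, mul_zero]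
      · have := (hy a hya).1
        rw [hD] at this
        rw [hz' _ hτb a (this.resolve_left ha), zero_mul]

end Exactness

/-! ### Partially resolved diagrams -/

theorem classSum_le {L : Type*} [Finite L] (E : Setoid L) {f f' : L → ℤ} (h : ∀ l, f l ≤ f' l) :
    classSum E f ≤ classSum E f' := by
  let := Fintype.ofFinite (Quotient E)
  simp only [classSum, finsum_eq_sum_of_fintype]
  exact Finset.sum_le_sum fun z _ => h _

/-- The sum over the classes, after a change of the function on the class of `x` only. -/
theorem classSum_eq_of_off {L : Type*} [Finite L] (E : Setoid L) (x : L) {f f' : L → ℤ}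
    (hf : ∀ y z, E y z → f y = f z) (hf' : ∀ y z, E y z → f' y = f' z)
    (h : ∀ l, ¬ E l x → f l = f' l) : classSum E f = classSum E f' + f x - f' x := by
  let := Fintype.ofFinite (Quotient E)
  simp only [classSum, finsum_eq_sum_of_fintype]
  have out : ∀ x, E (Quotient.mk E x).out x := fun x => Quotient.mk_out (s := E) x
  rw [← Finset.add_sum_erase _ _ (Finset.mem_univ (Quotient.mk E x)),
    ← Finset.add_sum_erase _ (fun z : Quotient E => f' z.out)
      (Finset.mem_univ (Quotient.mk E x)), hf _ _ (out x), hf' _ _ (out x)]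
  rw [Finset.sum_congr rfl (g := fun z : Quotient E => f' z.out)]
  · ring
  · intro z hz
    refine h _ fun hzx => Finset.ne_of_mem_erase hz ?_
    rw [← Quotient.out_eq z]
    exact Quotient.sound hzx

namespace Gen

/-- Interchange of `1` and `X`. -/
def swap : Gen → Gen
  | .one => .X
  | .X => .one

@[simp] theorem swap_swap (x : Gen) : x.swap.swap = x := by cases x <;> rfl

theorem deg_swap (x : Gen) : x.swap.deg = -x.deg := by cases x <;> rfl

theorem swap_eq_one {x : Gen} : x.swap = .one ↔ x = .X := by cases x <;> simp [swap]

theorem ne_one {x : Gen} : x ≠ .one ↔ x = .X := by cases x <;> simp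

end Gen

namespace Cube

variable {C L : Type*} {Q : Cube C L}

section Merge

variable (Q) in
/-- The connected components of the partially resolved diagram in which the crossings of `T` are
kept and the others are smoothed according to `s`. -/
def merge (s : C → Bool) (T : Finset C) : Setoid L :=
  Relation.EqvGen.setoid fun x y => Q.rel s x y ∨ ∃ c ∈ T, x = Q.p c ∧ y = Q.q c

variable {s s' : C → Bool} {T T' : Finset C}

theorem rel_le_merge (s : C → Bool) (T : Finset C) : Q.rel s ≤ Q.merge s T :=
  fun x y h => Relation.EqvGen.rel x y (Or.inl h)

theorem merge_pair (s : C → Bool) {T : Finset C} {c : C} (hc : c ∈ T) :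
    Q.merge s T (Q.p c) (Q.q c) :=
  Relation.EqvGen.rel _ _ (Or.inr ⟨c, hc, rfl, rfl⟩)

theorem merge_le {F : Setoid L} (h : Q.rel s ≤ F) (hT : ∀ c ∈ T, F (Q.p c) (Q.q c)) :
    Q.merge s T ≤ F := by
  refine Setoid.eqvGen_le ?_
  rintro x y (hxy | ⟨c, hc, rfl, rfl⟩)
  · exact h hxy
  · exact hT c hc

theorem merge_mono (s : C → Bool) (h : T' ⊆ T) : Q.merge s T' ≤ Q.merge s T :=
  merge_le (rel_le_merge s T) fun _ hc => merge_pair s (h hc)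

theorem merge_empty (s : C → Bool) : Q.merge s ∅ = Q.rel s :=
  le_antisymm (merge_le le_rfl (by simp)) (rel_le_merge s ∅)

theorem merge_insert (s : C → Bool) (T : Finset C) (c : C) :
    Q.merge s (insert c T) = glue (Q.merge s T) (Q.p c) (Q.q c) := by
  apply le_antisymm
  · refine merge_le ((rel_le_merge s T).trans (le_glue _ _ _)) fun c' hc' => ?_
    rcases Finset.mem_insert.1 hc' with rfl | h
    · exact glue_pair _ _ _
    · exact le_glue _ _ _ (merge_pair s h)
  · exact glue_le (merge_mono s (Finset.subset_insert c T))
      (merge_pair s (Finset.mem_insert_self c T))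

theorem merge_flip_le (s : C → Bool) {T : Finset C} {c : C} (hc : c ∈ T) :
    Q.merge s T ≤ Q.merge (Function.update s c (!s c)) T := by
  refine merge_le ?_ fun c' hc' => merge_pair _ hc'
  refine (le_glue _ (Q.p c) (Q.q c)).trans ?_
  rw [← Q.glue_flip]
  exact glue_le (rel_le_merge _ T) (merge_pair _ hc)

theorem merge_flip (s : C → Bool) {T : Finset C} {c : C} (hc : c ∈ T) :
    Q.merge (Function.update s c (!s c)) T = Q.merge s T := by
  refine le_antisymm ?_ (merge_flip_le s hc)
  have := merge_flip_le (Q := Q) (Function.update s c (!s c)) hc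
  simpa using this

/-- The smoothings at the crossings of `T` do not matter. -/
theorem merge_congr [Fintype C] (h : ∀ c, c ∉ T → s c = s' c) : Q.merge s T = Q.merge s' T := by
  suffices H : ∀ (A : Finset C) (s : C → Bool), A ⊆ T → (∀ c, c ∉ A → s c = s' c) →
      Q.merge s T = Q.merge s' T from H T s le_rfl h
  intro A
  induction A using Finset.induction with
  | empty =>
    intro s _ hs
    rw [show s = s' from funext fun c => hs c (by simp)]
  | insert c A hcA ih =>
    intro s hA hs
    by_cases hc : s c = s' c
    · refine ih s ((Finset.subset_insert c A).trans hA) fun c' hc' => ?_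
      by_cases h : c' = c
      · rw [h, hc]
      · exact hs c' (by simp [h, hc'])
    · rw [← merge_flip s (hA (Finset.mem_insert_self c A))]
      refine ih _ ((Finset.subset_insert c A).trans hA) fun c' hc' => ?_
      by_cases h : c' = c
      · subst h
        rw [Function.update_self]
        cases h1 : s c' <;> cases h2 : s' c' <;> simp_all
      · rw [Function.update_of_ne h]
        exact hs c' (by simp [h, hc'])

/-- A component that meets no crossing of `T` outside `T'` does not change when these crossings
are smoothed. -/
theorem merge_of_local {b z : L} (hz : Q.merge s T z b)
    (h : ∀ c ∈ T, c ∉ T' → ¬ Q.merge s T (Q.p c) b) : Q.merge s T' z b := by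
  let R : Setoid L :=
    { r := fun x y => Q.merge s T' x y ∧ Q.merge s T x y ∨
        ¬ Q.merge s T x b ∧ ¬ Q.merge s T y b
      iseqv :=
        { refl := fun x => Or.inl ⟨Setoid.refl' _ _, Setoid.refl' _ _⟩
          symm := by
            rintro x y (⟨h, h'⟩ | ⟨h, h'⟩)
            · exact Or.inl ⟨Setoid.symm' _ h, Setoid.symm' _ h'⟩
            · exact Or.inr ⟨h', h⟩
          trans := by
            rintro x y z (⟨h1, h1'⟩ | ⟨h1, h1'⟩) (⟨h2, h2'⟩ | ⟨h2, h2'⟩)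
            · exact Or.inl ⟨Setoid.trans' _ h1 h2, Setoid.trans' _ h1' h2'⟩
            · exact Or.inr ⟨fun h => h2 (Setoid.trans' _ (Setoid.symm' _ h1') h), h2'⟩
            · exact Or.inr ⟨h1, fun h => h1' (Setoid.trans' _ h2' h)⟩
            · exact Or.inr ⟨h1, h2'⟩ } }
  have hR : Q.merge s T ≤ R := by
    refine merge_le (fun x y hxy => Or.inl ⟨rel_le_merge s T' hxy, rel_le_merge s T hxy⟩) ?_
    intro c hc
    by_cases hc' : c ∈ T'
    · exact Or.inl ⟨merge_pair s hc', merge_pair s hc⟩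
    · have := h c hc hc'
      exact Or.inr ⟨this, fun hq => this (Setoid.trans' _ (merge_pair s hc) hq)⟩
  rcases hR hz with ⟨h1, _⟩ | ⟨h1, _⟩
  · exact h1
  · exact absurd hz h1

/-- A forest with an edge has a leaf: if every crossing of `T` is a bridge, one of them has a side
that meets no other crossing of `T`.  A side with the fewest points will do. -/
theorem exists_leaf [Finite L] (hT : T.Nonempty)
    (hbr : ∀ e ∈ T, ¬ Q.merge s (T.erase e) (Q.p e) (Q.q e)) :
    ∃ e ∈ T, ∃ x y, (x = Q.p e ∧ y = Q.q e ∨ x = Q.q e ∧ y = Q.p e) ∧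
      ∀ c ∈ T.erase e, ¬ Q.merge s (T.erase e) (Q.p c) x := by
  suffices H : ∀ (n : ℕ) (e : C) (x y : L), e ∈ T →
      (x = Q.p e ∧ y = Q.q e ∨ x = Q.q e ∧ y = Q.p e) →
      {z | Q.merge s (T.erase e) z x}.ncard = n →
      ∃ e ∈ T, ∃ x y, (x = Q.p e ∧ y = Q.q e ∨ x = Q.q e ∧ y = Q.p e) ∧
        ∀ c ∈ T.erase e, ¬ Q.merge s (T.erase e) (Q.p c) x by
    obtain ⟨e, he⟩ := hT
    exact H _ e (Q.p e) (Q.q e) he (Or.inl ⟨rfl, rfl⟩) rfl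
  intro n
  induction n using Nat.strong_induction_on with
  | _ n ih =>
    intro e x y he hxy hn
    by_cases hleaf : ∀ c ∈ T.erase e, ¬ Q.merge s (T.erase e) (Q.p c) x
    · exact ⟨e, he, x, y, hxy, hleaf⟩
    push Not at hleaf
    obtain ⟨c, hc, hcx⟩ := hleaf
    have hcT : c ∈ T := Finset.mem_of_mem_erase hc
    have hec : e ∈ T.erase c := Finset.mem_erase.2 ⟨(Finset.ne_of_mem_erase hc).symm, he⟩
    have hcq : Q.merge s (T.erase e) (Q.q c) x :=
      Setoid.trans' _ (Setoid.symm' _ (merge_pair s hc)) hcx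
    -- the end of `c` that is separated from `e` by `c`
    obtain ⟨b, y', hb, hbx, hbe⟩ : ∃ b y', (b = Q.p c ∧ y' = Q.q c ∨ b = Q.q c ∧ y' = Q.p c) ∧
        Q.merge s (T.erase e) b x ∧ ¬ Q.merge s (T.erase c) x b := by
      by_cases h : Q.merge s (T.erase c) x (Q.p c)
      · exact ⟨Q.q c, Q.p c, Or.inr ⟨rfl, rfl⟩, hcq,
          fun h' => hbr c hcT (Setoid.trans' _ (Setoid.symm' _ h) h')⟩
      · exact ⟨Q.p c, Q.q c, Or.inl ⟨rfl, rfl⟩, hcx, h⟩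
    have hpe : ¬ Q.merge s (T.erase c) (Q.p e) b := by
      intro h
      rcases hxy with ⟨rfl, -⟩ | ⟨rfl, -⟩
      · exact hbe h
      · exact hbe (Setoid.trans' _ (Setoid.symm' _ (merge_pair s hec)) h)
    refine ih _ ?_ c b y' hcT hb rfl
    rw [← hn]
    refine Set.ncard_lt_ncard ⟨?_, ?_⟩ (Set.toFinite _)
    · intro z hz
      have h1 : Q.merge s ((T.erase c).erase e) z b := by
        refine merge_of_local hz fun c' hc' hc'' => ?_
        have : c' = e := by
          by_contra h
          exact hc'' (Finset.mem_erase.2 ⟨h, hc'⟩)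
        rwa [this]
      exact Setoid.trans' _
        (merge_mono s (Finset.erase_subset_erase e (Finset.erase_subset c T)) h1) hbx
    · intro h
      exact hbe (h (show Q.merge s (T.erase e) x x from Setoid.refl' _ _))

end Merge

end Cube

/-! ### Removal of a crossing by the Reidemeister I argument -/

theorem mulCoeff_comm (x y z : Gen) : mulCoeff x y z = mulCoeff y x z := by
  cases x <;> cases y <;> cases z <;> rfl

theorem mulCoeff_one_ne_zero {y z : Gen} : mulCoeff .one y z ≠ 0 ↔ y = z := by
  cases y <;> cases z <;> simp [mulCoeff]

namespace Cube

variable {C L : Type*} {Q : Cube C L}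

theorem Step.eq_false_of {c e : C} {s s' : C → Bool} (h : Step c s s') (he : s' e = false) :
    s e = false := by
  by_cases hce : e = c
  · rw [hce]; exact h.1
  · rwa [h.2, Function.update_of_ne hce] at he

/-- Interchange of `1` and `X` on the cycle through `x`. -/
noncomputable def Labelled.toggle (a : Q.Labelled) (x : L) : Q.Labelled where
  state := a.state
  label z := if Q.rel a.state z x then (a.label z).swap else a.label z
  compat y z h := by
    have h1 : Q.rel a.state y x ↔ Q.rel a.state z x :=
      ⟨fun h' => Setoid.trans' _ (Setoid.symm' _ h) h', fun h' => Setoid.trans' _ h h'⟩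
    rw [a.compat y z h]
    simp only [h1]

theorem Labelled.toggle_toggle (a : Q.Labelled) (x : L) : (a.toggle x).toggle x = a := by
  ext z
  · rfl
  · change (if Q.rel a.state z x then (if Q.rel a.state z x then _ else _ : Gen).swap else
      (if Q.rel a.state z x then _ else _)) = _
    by_cases h : Q.rel a.state z x <;> simp [h]

theorem Labelled.toggle_label_self (a : Q.Labelled) (x : L) :
    (a.toggle x).label x = (a.label x).swap := if_pos (Setoid.refl' _ x)

/-- Toggling the label of a cycle not involved in a step does not change the coefficients. -/
theorem coef_toggle {c : C} {a b : Q.Labelled} {x : L}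
    (hab : ∀ z, Q.rel a.state z x ↔ Q.rel b.state z x)
    (hp : ¬ Q.rel a.state (Q.p c) x) (hq : ¬ Q.rel a.state (Q.q c) x) :
    Q.coef c (a.toggle x) (b.toggle x) = Q.coef c a b := by
  have e1 : (a.toggle x).label (Q.p c) = a.label (Q.p c) := if_neg hp
  have e2 : (a.toggle x).label (Q.q c) = a.label (Q.q c) := if_neg hq
  have e3 : (b.toggle x).label (Q.p c) = b.label (Q.p c) := if_neg (by rwa [← hab])
  have e4 : (b.toggle x).label (Q.q c) = b.label (Q.q c) := if_neg (by rwa [← hab])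
  have e5 : ∀ l, (a.toggle x).label l = (b.toggle x).label l ↔ a.label l = b.label l := by
    intro l
    simp only [Labelled.toggle, ← hab]
    by_cases h : Q.rel a.state l x
    · simp only [h, if_true]
      cases a.label l <;> cases b.label l <;> simp [Gen.swap]
    · simp [h]
  unfold coef
  simp only [e1, e2, e3, e4, e5]
  rfl

theorem label_eq_of_coef_ne_zero {c : C} {a b : Q.Labelled} {x : L} (h : Q.coef c a b ≠ 0)
    (hp : ¬ Q.rel a.state x (Q.p c)) (hq : ¬ Q.rel a.state x (Q.q c)) :
    a.label x = b.label x := by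
  unfold coef at h
  split_ifs at h with h1
  all_goals first | exact h1 x hp hq | exact absurd rfl h

/-- Multiplication by `1` is the identity. -/
theorem coef_ne_zero_iff_of_label_one {e : C} {a b : Q.Labelled} {x y : L}
    (hxy : x = Q.p e ∧ y = Q.q e ∨ x = Q.q e ∧ y = Q.p e) (hab : Step e a.state b.state)
    (hx : a.label x = .one) (hne : ¬ Q.rel a.state (Q.p e) (Q.q e)) :
    Q.coef e a b ≠ 0 ↔ b.label y = a.label y ∧
      ∀ l, ¬ Q.rel a.state l x → ¬ Q.rel a.state l y → a.label l = b.label l := by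
  have hb : Q.rel b.state (Q.p e) (Q.q e) := hab.rel_iff.2 hne
  have hl := b.compat _ _ hb
  unfold coef
  rw [if_pos (⟨hne, hb⟩ : ¬ Q.rel a.state (Q.p e) (Q.q e) ∧ Q.rel b.state (Q.p e) (Q.q e))]
  rcases hxy with ⟨rfl, rfl⟩ | ⟨rfl, rfl⟩
  · rw [hx, ← hl]
    by_cases h : ∀ l, ¬ Q.rel a.state l (Q.p e) → ¬ Q.rel a.state l (Q.q e) →
        a.label l = b.label l
    · rw [if_pos h, mulCoeff_one_ne_zero]
      exact ⟨fun h' => ⟨h'.symm, h⟩, fun h' => h'.1.symm⟩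
    · rw [if_neg h]
      exact ⟨fun h' => absurd rfl h', fun h' => absurd h'.2 h⟩
  · rw [hx, mulCoeff_comm]
    by_cases h : ∀ l, ¬ Q.rel a.state l (Q.p e) → ¬ Q.rel a.state l (Q.q e) →
        a.label l = b.label l
    · rw [if_pos h, mulCoeff_one_ne_zero]
      exact ⟨fun h' => ⟨h'.symm, fun l h1 h2 => h l h2 h1⟩, fun h' => h'.1.symm⟩
    · rw [if_neg h]
      exact ⟨fun h' => absurd rfl h', fun h' => absurd (fun l h1 h2 => h'.2 l h2 h1) h⟩

section Leaf

variable [Fintype C] {ε : (C → Bool) → C → ℤˣ}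

variable (Q) in
/-- The labelled states that resolve the crossings outside `T` as `s` does. -/
def cell (s : C → Bool) (T : Finset C) : Set Q.Labelled := {a | ∀ c, c ∉ T → a.state c = s c}

/-- The differential does not leave and re-enter a cell. -/
theorem diff_mul_diff_of_notMem_cell {s : C → Bool} {T : Finset C} {a b m : Q.Labelled}
    (ha : a ∈ Q.cell s T) (hb : b ∈ Q.cell s T) (hm : m ∉ Q.cell s T) :
    Q.diff ε b m * Q.diff ε m a = 0 := by
  by_contra h
  obtain ⟨c, hc, -⟩ := exists_step_of_diff_ne_zero (right_ne_zero_of_mul h)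
  obtain ⟨c', hc', -⟩ := exists_step_of_diff_ne_zero (left_ne_zero_of_mul h)
  apply hm
  intro e he
  have h1 := ha e he
  have h2 := hb e he
  rw [hc.2]
  by_cases hec : e = c
  · subst hec
    have h3 : m.state e = true := by rw [hc.2]; simp
    rw [hc'.2] at h2
    by_cases hec' : e = c'
    · subst hec'
      have := hc'.1
      rw [h3] at this
      exact absurd this (by simp)
    · rw [Function.update_of_ne hec', h3] at h2
      rw [← h2]; simp
  · rw [Function.update_of_ne hec, h1]

theorem sqZeroOn_of_convex [Finite L]
    (hd : ∀ a b, ∑ m, Q.diff ε b m * Q.diff ε m a = 0) {S : Set Q.Labelled}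
    (hS : ∀ a ∈ S, ∀ b ∈ S, ∀ m, m ∉ S → Q.diff ε b m * Q.diff ε m a = 0) :
    SqZeroOn (Q.diff ε) S := by
  intro a ha b hb
  refine (Finset.sum_congr rfl fun m _ => ?_).trans (hd a b)
  by_cases hm : m ∈ S
  · rw [if_pos hm]
  · rw [if_neg hm, hS a ha b hb m hm]

theorem Labelled.gr_toggle [Finite L] (a : Q.Labelled) (x : L) (hx : a.label x = .X) :
    Q.gr (a.toggle x) = Q.gr a + 2 := by
  have h := classSum_eq_of_off (Q.rel a.state) x (f := fun l => ((a.toggle x).label l).deg)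
    (f' := fun l => (a.label l).deg) (fun y z hyz => by rw [(a.toggle x).compat y z hyz])
    (fun y z hyz => by rw [a.compat y z hyz]) (fun l hl => by simp [toggle, hl])
  simp only [a.toggle_label_self x, Gen.deg_swap, hx] at h
  have h' : Q.deg (a.toggle x) = Q.deg a + 2 := by
    unfold deg
    change classSum (Q.rel a.state) _ = _
    rw [h]
    simp [Gen.deg]; ring
  unfold gr
  rw [h']
  change _ - (ht a.state : ℤ) = _
  ring

theorem diff_ne_zero_iff_of_step {c : C} {a b : Q.Labelled} (h : Step c a.state b.state) :
    Q.diff ε b a ≠ 0 ↔ Q.coef c a b ≠ 0 := by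
  rw [diff_of_step h]
  have : (((ε a.state c : ℤˣ) : ℤ) : ℚ) ≠ 0 := by exact_mod_cast (ε a.state c).ne_zero
  simp [this]

/-- The Reidemeister I argument.  If `e` is a bridge with a side `x` that meets no other unresolved
crossing, the label `1` on the cycle of `x` cancels against the part in which `e` has been
`1`-smoothed, and there remains the part with label `X`, a shifted copy of the one with
label `1`. -/
theorem exactOn_cell_of_leaf [Finite L]
    (hd : ∀ a b, ∑ m, Q.diff ε b m * Q.diff ε m a = 0)
    {s : C → Bool} {T : Finset C} {e : C} {x y : L} {n : ℤ}
    (hs : ∀ c ∈ T, s c = false) (he : e ∈ T)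
    (hbr : ¬ Q.merge s (T.erase e) (Q.p e) (Q.q e))
    (hxy : x = Q.p e ∧ y = Q.q e ∨ x = Q.q e ∧ y = Q.p e)
    (hleaf : ∀ c ∈ T.erase e, ¬ Q.merge s (T.erase e) (Q.p c) x)
    (h : ExactOn (Q.diff ε) Q.gr (Q.cell s (T.erase e)) (n + 2)) :
    ExactOn (Q.diff ε) Q.gr (Q.cell s T) n := by
  set D₀ := Q.cell s (T.erase e) with hD₀
  have hse := hs e he
  have sub : D₀ ⊆ Q.cell s T := fun a ha c hc => ha c fun h => hc (Finset.mem_of_mem_erase h)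
  have he0 : ∀ a ∈ D₀, a.state e = false := fun a ha => by
    rw [ha e (Finset.notMem_erase e T), hse]
  have mem_iff : ∀ a ∈ Q.cell s T, a ∈ D₀ ↔ a.state e = false := by
    intro a ha
    refine ⟨he0 a, fun h c hc => ?_⟩
    by_cases hce : c = e
    · rw [hce, h, hse]
    · exact ha c fun h' => hc (Finset.mem_erase.2 ⟨hce, h'⟩)
  -- in all states of `D₀` the side of `x` is one and the same cycle
  have hK : ∀ a ∈ D₀, ∀ z, Q.rel a.state z x ↔ Q.merge s (T.erase e) z x := by
    intro a ha z
    have hm : Q.merge a.state (T.erase e) = Q.merge s (T.erase e) := merge_congr ha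
    rw [← hm]
    refine ⟨fun h => rel_le_merge _ _ h, fun h => ?_⟩
    rw [← merge_empty]
    refine merge_of_local h fun c hc _ => ?_
    rw [hm]
    exact hleaf c hc
  have hKpq : ∀ a ∈ D₀, ∀ c ∈ T.erase e,
      ¬ Q.rel a.state (Q.p c) x ∧ ¬ Q.rel a.state (Q.q c) x := by
    intro a ha c hc
    rw [hK a ha, hK a ha]
    exact ⟨hleaf c hc, fun h => hleaf c hc (Setoid.trans' _ (merge_pair s hc) h)⟩
  have hne : ∀ a ∈ D₀, ¬ Q.rel a.state (Q.p e) (Q.q e) := by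
    intro a ha h
    apply hbr
    rcases hxy with ⟨hx, hy⟩ | ⟨hx, hy⟩
    · rw [← hx, ← hy] at h ⊢
      exact Setoid.symm' _ ((hK a ha y).1 (Setoid.symm' _ h))
    · rw [← hx, ← hy] at h ⊢
      exact (hK a ha y).1 h
  have hne' : ∀ a ∈ D₀, ¬ Q.rel a.state y x := by
    intro a ha h
    apply hne a ha
    rcases hxy with ⟨hx, hy⟩ | ⟨hx, hy⟩
    · rw [← hx, ← hy]; exact Setoid.symm' _ h
    · rw [← hx, ← hy]; exact h
  -- steps inside `D₀` take place at crossings of `T.erase e`, steps that leave it at `e`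
  have step₀ : ∀ a ∈ D₀, ∀ b ∈ D₀, ∀ c, Step c a.state b.state → c ∈ T.erase e := by
    intro a ha b hb c hc
    by_contra hcT
    have h1 := ha c hcT
    have h2 := hb c hcT
    rw [← h1, hc.1, hc.2] at h2
    simp at h2
  have step₁ : ∀ a ∈ D₀, ∀ b : Q.Labelled, b.state e = true → ∀ c, Step c a.state b.state →
      c = e := by
    intro a ha b hb c hc
    by_contra hce
    rw [hc.2, Function.update_of_ne (Ne.symm hce), he0 a ha] at hb
    exact absurd hb (by simp)
  have label_eq : ∀ a ∈ D₀, ∀ b ∈ D₀, Q.diff ε b a ≠ 0 → a.label x = b.label x := by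
    intro a ha b hb hab
    obtain ⟨c, hc, hcoef⟩ := exists_step_of_diff_ne_zero hab
    have := hKpq a ha c (step₀ a ha b hb c hc)
    exact label_eq_of_coef_ne_zero hcoef (fun h => this.1 (Setoid.symm' _ h))
      (fun h => this.2 (Setoid.symm' _ h))
  set A : Set Q.Labelled := {a | a ∈ D₀ ∧ a.label x = .one} with hA
  set A' : Set Q.Labelled := {a | a ∈ D₀ ∧ a.label x = .X} with hA'
  set D₁ : Set Q.Labelled := {a | a ∈ Q.cell s T ∧ a.state e = true} with hD₁
  have D₀_eq : D₀ = A ∪ A' := by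
    ext a
    simp only [hA, hA', Set.mem_union, Set.mem_ofPred_eq, ← and_or_left]
    refine ⟨fun h => ⟨h, ?_⟩, fun h => h.1⟩
    cases a.label x <;> simp
  have cell_eq : Q.cell s T = A' ∪ (A ∪ D₁) := by
    rw [← Set.union_assoc, Set.union_comm A' A, ← D₀_eq]
    ext a
    refine ⟨fun h => ?_, fun h => h.elim (fun h => sub h) (fun h => h.1)⟩
    by_cases h' : a.state e = true
    · exact Or.inr ⟨h, h'⟩
    · exact Or.inl ((mem_iff a h).2 (by simpa using h'))
  have zAA' : ∀ b ∈ A', ∀ a ∈ A, Q.diff ε b a = 0 := by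
    intro b hb a ha
    by_contra h
    have := label_eq a ha.1 b hb.1 h
    rw [ha.2, hb.2] at this
    exact absurd this (by simp)
  have zA'A : ∀ b ∈ A, ∀ a ∈ A', Q.diff ε b a = 0 := by
    intro b hb a ha
    by_contra h
    have := label_eq a ha.1 b hb.1 h
    rw [ha.2, hb.2] at this
    exact absurd this (by simp)
  have zD₁ : ∀ b ∈ D₀, ∀ a ∈ D₁, Q.diff ε b a = 0 := by
    intro b hb a ha
    by_contra h
    obtain ⟨c, hc, -⟩ := exists_step_of_diff_ne_zero h
    have := hc.eq_false_of (he0 b hb)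
    rw [ha.2] at this
    exact absurd this (by simp)
  have sqT : SqZeroOn (Q.diff ε) (Q.cell s T) :=
    sqZeroOn_of_convex hd fun a ha b hb m hm => diff_mul_diff_of_notMem_cell ha hb hm
  have hg : ∀ a b : Q.Labelled, Q.diff ε b a ≠ 0 → Q.gr a = Q.gr b + 2 :=
    fun a b => gr_of_diff_ne_zero
  refine ExactOn.union hg sqT cell_eq ?_ ?_ ?_
  · rintro b hb a (ha | ha)
    · exact zAA' b hb a ha
    · exact zD₁ b hb.1 a ha
  · refine ExactOn.of_summand D₀_eq zAA' zA'A (fun a => a.toggle x)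
      (fun a => a.toggle_toggle x) ?_ ?_ ?_ h
    · intro a
      simp only [hA, hA', Set.mem_ofPred_eq, Labelled.toggle_label_self, Gen.swap_eq_one]
      exact Iff.rfl
    · intro a ha b hb
      by_cases hex : ∃ c, Step c a.state b.state
      · obtain ⟨c, hc⟩ := hex
        have hcT := hKpq a ha.1 c (step₀ a ha.1 b hb.1 c hc)
        rw [diff_of_step hc, diff_of_step (a := a.toggle x) (b := b.toggle x) hc,
          coef_toggle (fun z => by rw [hK a ha.1, hK b hb.1]) hcT.1 hcT.2]
        rfl
      · have h1 : Q.diff ε b a = 0 := by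
          by_contra h
          obtain ⟨c, hc, -⟩ := exists_step_of_diff_ne_zero h
          exact hex ⟨c, hc⟩
        have h2 : Q.diff ε (b.toggle x) (a.toggle x) = 0 := by
          by_contra h
          obtain ⟨c, hc, -⟩ := exists_step_of_diff_ne_zero h
          exact hex ⟨c, hc⟩
        rw [h1, h2]
    · intro a ha
      exact a.gr_toggle x ha.2
  · -- the differential does not leave `A ∪ D₁` for `A'`
    have sq : SqZeroOn (Q.diff ε) (A ∪ D₁) := by
      refine sqZeroOn_of_convex hd fun a ha b hb m hm => ?_
      have sub' : A ∪ D₁ ⊆ Q.cell s T := by rw [cell_eq]; exact Set.subset_union_right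
      by_cases hmT : m ∈ Q.cell s T
      · rw [cell_eq] at hmT
        have hmA := hmT.resolve_right hm
        rcases ha with ha | ha
        · rw [zAA' m hmA a ha, mul_zero]
        · rw [zD₁ m hmA.1 a ha, mul_zero]
      · exact diff_mul_diff_of_notMem_cell (sub' ha) (sub' hb) hmT
    have key : ∀ a ∈ A, ∀ b ∈ D₁, Q.diff ε b a ≠ 0 ↔ Step e a.state b.state ∧
        b.label y = a.label y ∧
        ∀ l, ¬ Q.rel a.state l x → ¬ Q.rel a.state l y → a.label l = b.label l := by
      intro a ha b hb
      constructor
      · intro h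
        obtain ⟨c, hc, hcoef⟩ := exists_step_of_diff_ne_zero h
        obtain rfl := step₁ a ha.1 b hb.2 c hc
        exact ⟨hc, (coef_ne_zero_iff_of_label_one hxy hc ha.2 (hne a ha.1)).1 hcoef⟩
      · rintro ⟨hc, h⟩
        exact (diff_ne_zero_iff_of_step hc).2
          ((coef_ne_zero_iff_of_label_one hxy hc ha.2 (hne a ha.1)).2 h)
    have glue_eq : ∀ a ∈ D₀, ∀ s', Step e a.state s' → Q.rel s' = glue (Q.rel a.state) x y := by
      intro a ha s' hs'
      rw [hs'.rel_eq_glue (hne a ha)]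
      rcases hxy with ⟨rfl, rfl⟩ | ⟨rfl, rfl⟩
      · rfl
      · exact glue_comm _ _ _
    refine ExactOn.of_monomial n hg sq rfl ?_ ?_ ?_ ?_
    · intro a ha
      have hst : Step e a.state (Function.update a.state e true) := ⟨he0 a ha.1, rfl⟩
      have hg' := glue_eq a ha.1 _ hst
      refine ⟨⟨Function.update a.state e true,
        fun z => if Q.rel a.state z x then a.label y else a.label z, ?_⟩, ⟨?_, ?_⟩, ?_⟩
      · intro u v huv
        rw [hg'] at huv
        have h1 : ∀ z, Q.rel a.state z x ∨ Q.rel a.state z y →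
            (if Q.rel a.state z x then a.label y else a.label z) = a.label y := by
          intro z hz
          by_cases h : Q.rel a.state z x
          · rw [if_pos h]
          · rw [if_neg h]; exact a.compat _ _ (hz.resolve_left h)
        rcases huv with huv | ⟨hu, hv⟩
        · have : Q.rel a.state u x ↔ Q.rel a.state v x :=
            ⟨fun h' => Setoid.trans' _ (Setoid.symm' _ huv) h',
              fun h' => Setoid.trans' _ huv h'⟩
          rw [a.compat u v huv]
          simp only [this]
        · rw [h1 u hu, h1 v hv]
      · intro c hc
        have : c ≠ e := fun h => hc (h ▸ he)
        simp only [Function.update_of_ne this]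
        exact sub ha.1 c hc
      · simp
      · rw [key a ha _ ⟨?_, ?_⟩]
        · refine ⟨hst, if_neg (hne' a ha.1), fun l hl _ => ?_⟩
          simp only [if_neg hl]
        · intro c hc
          have : c ≠ e := fun h => hc (h ▸ he)
          simp only [Function.update_of_ne this]
          exact sub ha.1 c hc
        · simp
    · intro b hb
      have hst : Step e (Function.update b.state e false) b.state := by
        refine ⟨by simp, ?_⟩
        rw [Function.update_idem, ← hb.2, Function.update_eq_self]
      have mem : ∀ c, c ∉ T.erase e → Function.update b.state e false c = s c := by
        intro c hc
        by_cases hce : c = e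
        · rw [hce, Function.update_self, hse]
        · rw [Function.update_of_ne hce]
          exact hb.1 c fun h => hc (Finset.mem_erase.2 ⟨hce, h⟩)
      -- any labelled state will do to read off how the relations change
      have a₀mem : (⟨Function.update b.state e false, fun _ => .one, fun _ _ _ => rfl⟩ :
        Q.Labelled) ∈ D₀ := mem
      have hg' := glue_eq _ a₀mem _ hst
      have hle : Q.rel (Function.update b.state e false) ≤ Q.rel b.state := by
        rw [hg']; exact le_glue _ _ _
      let a : Q.Labelled := ⟨Function.update b.state e false,
        fun z => if Q.rel (Function.update b.state e false) z x then .one else b.label z, by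
          intro u v huv
          have : Q.rel (Function.update b.state e false) u x ↔
              Q.rel (Function.update b.state e false) v x :=
            ⟨fun h' => Setoid.trans' _ (Setoid.symm' _ huv) h',
              fun h' => Setoid.trans' _ huv h'⟩
          rw [b.compat u v (hle huv)]
          simp only [this]⟩
      have haA : a ∈ A := ⟨mem, if_pos (Setoid.refl' _ x)⟩
      refine ⟨a, haA, (key a haA b hb).2 ⟨hst, ?_, ?_⟩⟩
      · exact (if_neg (hne' a haA.1)).symm
      · intro l hl _
        exact if_neg hl
    · intro a ha b hb b' hb' h h'
      obtain ⟨h1, h2, h3⟩ := (key a ha b hb).1 h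
      obtain ⟨h1', h2', h3'⟩ := (key a ha b' hb').1 h'
      ext l
      · rw [h1.2, h1'.2]
      · by_cases hl : Q.rel a.state l x ∨ Q.rel a.state l y
        · have e1 : Q.rel b.state l y := by
            rw [glue_eq a ha.1 _ h1]; exact Or.inr ⟨hl, Or.inr (Setoid.refl' _ y)⟩
          have e2 : Q.rel b'.state l y := by
            rw [glue_eq a ha.1 _ h1']; exact Or.inr ⟨hl, Or.inr (Setoid.refl' _ y)⟩
          rw [b.compat _ _ e1, b'.compat _ _ e2, h2, h2']
        · push Not at hl
          rw [← h3 l hl.1 hl.2, ← h3' l hl.1 hl.2]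
    · intro b hb a ha a' ha' h h'
      obtain ⟨h1, h2, h3⟩ := (key a ha b hb).1 h
      obtain ⟨h1', h2', h3'⟩ := (key a' ha' b hb).1 h'
      have hst : a.state = a'.state := by
        have e1 : a.state = Function.update b.state e false := by
          rw [h1.2, Function.update_idem, ← h1.1, Function.update_eq_self]
        have e2 : a'.state = Function.update b.state e false := by
          rw [h1'.2, Function.update_idem, ← h1'.1, Function.update_eq_self]
        rw [e1, e2]
      ext l
      · rw [hst]
      · by_cases hl : Q.rel a.state l x
        · rw [a.compat _ _ hl, ha.2, a'.compat _ _ (hst ▸ hl), ha'.2]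
        · by_cases hl' : Q.rel a.state l y
          · rw [a.compat _ _ hl', ← h2, h2', a'.compat l y (hst ▸ hl')]
          · rw [h3 l hl hl', h3' l (hst ▸ hl) (hst ▸ hl')]

end Leaf

end Cube

/-! ### The upper bound for the diagonal degree -/

namespace Cube

variable {C L : Type*} {Q : Cube C L}

section Bound

theorem ht_update [Fintype C] {s : C → Bool} {c : C} (h : s c = false) :
    ht (Function.update s c true) = ht s + 1 :=
  Step.ht_eq ⟨h, rfl⟩

theorem merge_erase {s : C → Bool} {T : Finset C} {e : C} (he : e ∈ T) :
    Q.merge s T = glue (Q.merge s (T.erase e)) (Q.p e) (Q.q e) := by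
  rw [← merge_insert, Finset.insert_erase he]

theorem deg_le [Finite L] (a : Q.Labelled) : Q.deg a ≤ numClasses (Q.rel a.state) := by
  rw [← classSum_one]
  refine classSum_le _ fun l => ?_
  cases a.label l <;> simp [Gen.deg]

theorem numClasses_merge_erase {s : C → Bool} {T : Finset C} {e : C} (he : e ∈ T)
    (h : Q.merge s (T.erase e) (Q.p e) (Q.q e)) :
    numClasses (Q.merge s (T.erase e)) = numClasses (Q.merge s T) := by
  rw [merge_erase he, glue_eq_self h]

variable [Finite L]

theorem numClasses_merge_erase_of_bridge {s : C → Bool} {T : Finset C} {e : C} (he : e ∈ T)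
    (h : ¬ Q.merge s (T.erase e) (Q.p e) (Q.q e)) :
    numClasses (Q.merge s (T.erase e)) = numClasses (Q.merge s T) + 1 := by
  rw [merge_erase he, numClasses_glue h]

/-- The `1`-smoothing of a crossing either disconnects a component of the partially resolved
diagram, and then it splits a cycle, or it does not, and then it loses at most one cycle. -/
theorem numClasses_update {s : C → Bool} {T : Finset C} {e : C} (he : e ∈ T)
    (hs : s e = false) :
    numClasses (Q.merge (Function.update s e true) (T.erase e)) = numClasses (Q.merge s T) + 1 ∧
      numClasses (Q.rel (Function.update s e true)) = numClasses (Q.rel s) + 1 ∨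
    numClasses (Q.merge (Function.update s e true) (T.erase e)) = numClasses (Q.merge s T) ∧
      numClasses (Q.rel s) ≤ numClasses (Q.rel (Function.update s e true)) + 1 := by
  have hst : Step e s (Function.update s e true) := ⟨hs, rfl⟩
  have hm : Q.merge (Function.update s e true) T = Q.merge s T := by
    rw [hst.eq_flip, merge_flip s he]
  by_cases h : Q.merge (Function.update s e true) (T.erase e) (Q.p e) (Q.q e)
  · right
    refine ⟨by rw [numClasses_merge_erase he h, hm], ?_⟩
    by_cases hpq : Q.rel s (Q.p e) (Q.q e)
    · rw [hst.rel_eq_glue' hpq]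
      exact (numClasses_glue_le _ _ _).trans (Nat.le_succ _)
    · rw [hst.rel_eq_glue hpq, numClasses_glue hpq]
  · left
    refine ⟨by rw [numClasses_merge_erase_of_bridge he h, hm], ?_⟩
    have h1 : ¬ Q.rel (Function.update s e true) (Q.p e) (Q.q e) :=
      fun h' => h (rel_le_merge _ _ h')
    have h2 : Q.rel s (Q.p e) (Q.q e) := by
      by_contra h2
      exact h1 (hst.rel_iff.2 h2)
    rw [hst.rel_eq_glue' h2, numClasses_glue h1]

/-- The number of cycles in two opposite states: this is the inequality `χ ≤ 2` for the surface of
a connected diagram. -/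
theorem numClasses_add_le (n : ℕ) : ∀ (T : Finset C) (s s' : C → Bool), T.card = n →
    (∀ c ∈ T, s c = false) → (∀ c, s' c = if c ∈ T then true else s c) →
    numClasses (Q.rel s) + numClasses (Q.rel s') ≤ n + 2 * numClasses (Q.merge s T) := by
  induction n with
  | zero =>
    intro T s s' hT hs hs'
    obtain rfl := Finset.card_eq_zero.1 hT
    obtain rfl : s' = s := funext fun c => by simp [hs' c]
    rw [merge_empty]; omega
  | succ n ih =>
    intro T s s' hT hs hs'
    obtain ⟨e, he⟩ : T.Nonempty := Finset.card_pos.1 (by omega)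
    have h1 := ih (T.erase e) (Function.update s e true) s'
      (by rw [Finset.card_erase_of_mem he, hT]; rfl)
      (by
        intro c hc
        rw [Function.update_of_ne (Finset.ne_of_mem_erase hc)]
        exact hs c (Finset.mem_of_mem_erase hc))
      (by
        intro c
        rw [hs' c]
        by_cases h : c = e
        · subst h; simp [he]
        · simp [h])
    rcases numClasses_update (Q := Q) he (hs e he) with h | h <;> omega

variable [Fintype C] {ε : (C → Bool) → C → ℤˣ}

/-- The upper bound for the diagonal gradings that support homology, for partially resolved
diagrams.  A crossing that is not a bridge is resolved by means of the long exact sequence; if all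
crossings are bridges, a leaf is removed. -/
theorem exactOn_cell (hd : ∀ a b, ∑ m, Q.diff ε b m * Q.diff ε m a = 0) (k : ℕ) :
    ∀ (T : Finset C) (s : C → Bool) (n : ℤ), T.card = k → (∀ c ∈ T, s c = false) →
    2 * (numClasses (Q.merge s T) : ℤ) - numClasses (Q.rel s) - ht s < n →
    ExactOn (Q.diff ε) Q.gr (Q.cell s T) n := by
  induction k with
  | zero =>
    intro T s n hT hs hn
    obtain rfl := Finset.card_eq_zero.1 hT
    rw [merge_empty] at hn
    intro x hx _
    have hx0 : ∀ a, x a = 0 := by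
      intro a
      by_contra h
      obtain ⟨ha, hga⟩ := hx a h
      have hst : a.state = s := funext fun c => ha c (by simp)
      have := deg_le a
      unfold gr at hga
      rw [hst] at this hga
      omega
    exact ⟨0, fun b hb => absurd rfl hb, fun b _ => by simp [hx0]⟩
  | succ k ih =>
    intro T s n hT hs hn
    have hTne : T.Nonempty := Finset.card_pos.1 (by omega)
    have hcard : ∀ e ∈ T, (T.erase e).card = k := fun e he => by
      rw [Finset.card_erase_of_mem he, hT]; rfl
    by_cases hbr : ∀ e ∈ T, ¬ Q.merge s (T.erase e) (Q.p e) (Q.q e)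
    · obtain ⟨e, he, x, y, hxy, hleaf⟩ := exists_leaf hTne hbr
      refine exactOn_cell_of_leaf hd hs he (hbr e he) hxy hleaf ?_
      refine ih _ s _ (hcard e he) (fun c hc => hs c (Finset.mem_of_mem_erase hc)) ?_
      rw [numClasses_merge_erase_of_bridge he (hbr e he)]
      push_cast
      linarith
    · push Not at hbr
      obtain ⟨e, he, hpq⟩ := hbr
      have hse := hs e he
      have h0 : ExactOn (Q.diff ε) Q.gr (Q.cell s (T.erase e)) n := by
        refine ih _ s _ (hcard e he) (fun c hc => hs c (Finset.mem_of_mem_erase hc)) ?_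
        rwa [numClasses_merge_erase he hpq]
      have h1 : ExactOn (Q.diff ε) Q.gr
          (Q.cell (Function.update s e true) (T.erase e)) n := by
        refine ih _ _ _ (hcard e he) (fun c hc => ?_) ?_
        · rw [Function.update_of_ne (Finset.ne_of_mem_erase hc)]
          exact hs c (Finset.mem_of_mem_erase hc)
        · rw [ht_update hse]
          rcases numClasses_update (Q := Q) he hse with h | h
          · rw [h.1, h.2]; push_cast; linarith
          · rw [h.1]
            have := h.2
            push_cast
            omega
      have state_e : ∀ b : Bool, ∀ a ∈ Q.cell (Function.update s e b) (T.erase e),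
          a.state e = b := fun b a ha => by
        rw [ha e (Finset.notMem_erase e T), Function.update_self]
      have hs_eq : Function.update s e false = s := by rw [← hse, Function.update_eq_self]
      refine ExactOn.union (fun a b => gr_of_diff_ne_zero)
        (sqZeroOn_of_convex hd fun a ha b hb m hm => diff_mul_diff_of_notMem_cell ha hb hm)
        ?_ ?_ h0 h1
      · ext a
        constructor
        · intro ha
          have key : ∀ b, a.state e = b → a ∈ Q.cell (Function.update s e b) (T.erase e) := by
            intro b hb c hc
            by_cases hce : c = e
            · rw [hce, Function.update_self, hb]
            · rw [Function.update_of_ne hce]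
              exact ha c fun h => hc (Finset.mem_erase.2 ⟨hce, h⟩)
          cases hb : a.state e
          · left; rw [← hs_eq]; exact key _ hb
          · right; exact key _ hb
        · have key : ∀ b, a ∈ Q.cell (Function.update s e b) (T.erase e) → a ∈ Q.cell s T := by
            intro b hb c hc
            have hce : c ≠ e := fun h => hc (h ▸ he)
            rw [hb c fun h => hc (Finset.mem_of_mem_erase h), Function.update_of_ne hce]
          rintro (ha | ha)
          · exact key false (by rwa [hs_eq])
          · exact key true ha
      · intro b hb a ha
        by_contra h
        obtain ⟨c, hc, -⟩ := exists_step_of_diff_ne_zero h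
        have h1 := hc.eq_false_of (state_e false b (by rwa [hs_eq]))
        rw [state_e true a ha] at h1
        exact absurd h1 (by simp)

/-- The upper bound for a connected diagram. -/
theorem exactOn_univ (hd : ∀ a b, ∑ m, Q.diff ε b m * Q.diff ε m a = 0)
    (hconn : numClasses (Q.merge (fun _ => false) Finset.univ) = 1) {n : ℤ}
    (hn : 2 - (numClasses (Q.rel fun _ => false) : ℤ) < n) :
    ExactOn (Q.diff ε) Q.gr Set.univ n := by
  have h := exactOn_cell (ε := ε) hd _ Finset.univ (fun _ => false) n rfl (fun _ _ => rfl)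
    (by rw [hconn]; simpa [ht] using hn)
  have : Q.cell (fun _ => false) Finset.univ = Set.univ := by
    ext a; simp [cell]
  rwa [this] at h

end Bound

end Cube

/-! ### The mirror image and the lower bound -/

namespace Cube

variable {C L : Type*} {Q : Cube C L}

section Mirror

variable (Q) in
/-- The mirror image: the two smoothings of every crossing are interchanged. -/
def mirror : Cube C L where
  rel s := Q.rel fun c => !s c
  p := Q.p
  q := Q.q
  glue_flip s c := by
    rw [← Q.glue_flip (fun c => !s c) c]
    congr 2
    funext c'
    by_cases h : c' = c
    · subst h; simp
    · simp [h]
  rel_flip s c := by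
    rw [← Q.rel_flip (fun c => !s c) c]
    have : (fun c' => !Function.update s c (!s c) c') =
        Function.update (fun c => !s c) c (!!s c) := by
      funext c'
      by_cases h : c' = c
      · subst h; simp
      · simp [h]
    rw [this]

/-- The dual basis element of the mirror image: the complementary state, with `1` and `X`
interchanged. -/
def Labelled.mirror (a : Q.Labelled) : Q.mirror.Labelled where
  state c := !a.state c
  label l := (a.label l).swap
  compat x y h := by
    have e : (fun c => !!a.state c) = a.state := funext fun c => Bool.not_not _
    have h' : Q.rel (fun c => !!a.state c) x y := h
    rw [e] at h'
    rw [a.compat x y h']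

/-- The basis elements of a cube correspond to those of its mirror image. -/
def mirrorEquiv : Q.Labelled ≃ Q.mirror.Labelled where
  toFun := Labelled.mirror
  invFun a := ⟨fun c => !a.state c, fun l => (a.label l).swap, fun x y h => by
    rw [a.compat x y h]⟩
  left_inv a := by ext <;> simp [Labelled.mirror]
  right_inv a := by ext <;> simp [Labelled.mirror]

theorem Step.mirror {c : C} {s s' : C → Bool} (h : Step c s s') :
    Step c (fun c => !s' c) (fun c => !s c) := by
  refine ⟨by simp [h.2], ?_⟩
  funext c'
  by_cases hc : c' = c
  · subst hc; simp [h.1]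
  · simp [h.2, hc]

theorem mulCoeff_swap (x y z : Gen) :
    mulCoeff x.swap y.swap z.swap = comulCoeff z x y := by
  cases x <;> cases y <;> cases z <;> rfl

theorem comulCoeff_swap (x y z : Gen) :
    comulCoeff x.swap y.swap z.swap = mulCoeff y z x := by
  cases x <;> cases y <;> cases z <;> rfl

/-- The multiplication and the comultiplication are dual to each other. -/
theorem coef_mirror {c : C} {a b : Q.Labelled} (h : Step c a.state b.state) :
    Q.mirror.coef c b.mirror a.mirror = Q.coef c a b := by
  have hrel : ∀ a : Q.Labelled, Q.mirror.rel a.mirror.state = Q.rel a.state := by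
    intro a; simp [Cube.mirror, Labelled.mirror]
  have hl : ∀ (a : Q.Labelled) l, a.mirror.label l = (a.label l).swap := fun _ _ => rfl
  have hp : Q.mirror.p = Q.p := rfl
  have hq : Q.mirror.q = Q.q := rfl
  have hinj : ∀ x y : Gen, x.swap = y.swap ↔ x = y := by
    intro x y; cases x <;> cases y <;> simp [Gen.swap]
  have hcond : (∀ l, ¬ Q.rel b.state l (Q.p c) → ¬ Q.rel b.state l (Q.q c) →
      b.label l = a.label l) ↔ (∀ l, ¬ Q.rel a.state l (Q.p c) → ¬ Q.rel a.state l (Q.q c) →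
      a.label l = b.label l) := by
    refine forall_congr' fun l => ?_
    have := h.off_iff (Q := Q) l
    constructor
    · intro h' h1 h2; exact (h' (by tauto) (by tauto)).symm
    · intro h' h1 h2; exact (h' (by tauto) (by tauto)).symm
  unfold coef
  rw [hrel, hrel, hp, hq]
  simp only [hl, hinj, mulCoeff_swap, comulCoeff_swap, hcond]
  have := h.rel_iff (Q := Q)
  by_cases h1 : Q.rel a.state (Q.p c) (Q.q c)
  · have h2 : ¬ Q.rel b.state (Q.p c) (Q.q c) := fun h2 => this.1 h2 h1
    simp [h1, h2]
  · have h2 : Q.rel b.state (Q.p c) (Q.q c) := this.2 h1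
    simp [h1, h2]

/-- The edge signs of the mirror image: those of the same edges, which now start at the
complement of their former end. -/
noncomputable def mirrorSigns (ε : (C → Bool) → C → ℤˣ) : (C → Bool) → C → ℤˣ :=
  fun s c => ε (Function.update (fun c' => !s c') c false) c

theorem diff_mirror [Fintype C] (ε : (C → Bool) → C → ℤˣ) (a b : Q.Labelled) :
    Q.mirror.diff (mirrorSigns ε) a.mirror b.mirror = Q.diff ε b a := by
  by_cases hex : ∃ c, Step c a.state b.state
  · obtain ⟨c, hc⟩ := hex
    have hc' : Step c b.mirror.state a.mirror.state := hc.mirror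
    rw [diff_of_step hc, diff_of_step hc', coef_mirror hc]
    congr 4
    unfold mirrorSigns
    congr 1
    have : (fun c' => !b.mirror.state c') = b.state := by
      funext c'; simp [Labelled.mirror]
    rw [this, hc.2, Function.update_idem, ← hc.1, Function.update_eq_self]
  · have h1 : Q.diff ε b a = 0 := by
      by_contra h
      obtain ⟨c, hc, -⟩ := exists_step_of_diff_ne_zero h
      exact hex ⟨c, hc⟩
    rw [h1]
    by_contra h
    obtain ⟨c, hc, -⟩ := exists_step_of_diff_ne_zero h
    have := hc.mirror
    simp only [Labelled.mirror, Bool.not_not] at this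
    exact hex ⟨c, this⟩

theorem classSum_neg {L : Type*} [Finite L] (E : Setoid L) (f : L → ℤ) :
    classSum E (fun l => -f l) = -classSum E f := by
  let := Fintype.ofFinite (Quotient E)
  simp [classSum, finsum_eq_sum_of_fintype]

theorem gr_mirror [Fintype C] [Finite L] (a : Q.Labelled) :
    Q.mirror.gr a.mirror = -Q.gr a - Fintype.card C := by
  have h1 : Q.mirror.deg a.mirror = -Q.deg a := by
    unfold deg
    rw [← classSum_neg]
    have hrel : Q.mirror.rel a.mirror.state = Q.rel a.state := by
      simp [Cube.mirror, Labelled.mirror]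
    rw [hrel]
    congr 1
    funext l
    exact Gen.deg_swap _
  have h2 : ht a.mirror.state + ht a.state = Fintype.card C := by
    unfold ht
    have : (Finset.univ.filter fun c => a.mirror.state c = true) =
        Finset.univ.filter fun c => ¬ a.state c = true := by
      ext c; simp [Labelled.mirror]
    rw [this, add_comm, Finset.card_filter_add_card_filter_not]
    rfl
  unfold gr
  omega

/-- A complex of finite-dimensional vector spaces is exact where its dual is. -/
theorem ExactOn.of_transpose {B : Type*} [Fintype B] {d : B → B → ℚ} {g : B → ℤ} {n : ℤ}
    (hg : ∀ a b, d b a ≠ 0 → g a = g b + 2)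
    (h : ∀ x : B → ℚ, (∀ b, x b ≠ 0 → g b = n) → (∀ a, ∑ b, d b a * x b = 0) →
      ∃ y : B → ℚ, (∀ b, y b ≠ 0 → g b = n - 2) ∧ ∀ a, ∑ b, d b a * y b = x a) :
    ExactOn d g Set.univ n := by
  intro x hx hdx
  -- the image of the differential from degree `n + 2`
  let D : (B → ℚ) →ₗ[ℚ] (B → ℚ) :=
    Matrix.mulVecLin (Matrix.of fun b a => if g a = n + 2 then d b a else 0)
  have hD : ∀ y b, D y b = ∑ a, (if g a = n + 2 then d b a else 0) * y a := fun y b => rfl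
  by_cases hmem : x ∈ LinearMap.range D
  · obtain ⟨y, rfl⟩ := hmem
    refine ⟨fun a => if g a = n + 2 then y a else 0, ?_, ?_⟩
    · intro b hb
      by_cases h' : g b = n + 2
      · exact ⟨trivial, h'⟩
      · exact absurd (if_neg h') hb
    · intro b _
      rw [hD]
      refine Finset.sum_congr rfl fun a _ => ?_
      by_cases h' : g a = n + 2 <;> simp [h']
  · exfalso
    obtain ⟨f, hfx, hfD⟩ := Submodule.exists_le_ker_of_notMem hmem
    set φ : B → ℚ := fun b => f (fun j => if b = j then 1 else 0) with hφ
    have hf : ∀ z : B → ℚ, f z = ∑ b, z b * φ b := fun z => by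
      rw [LinearMap.pi_apply_eq_sum_univ]; rfl
    obtain ⟨y, -, hdy⟩ := h (fun b => if g b = n then φ b else 0)
      (fun b hb => by
        by_contra h'
        exact hb (if_neg h'))
      (fun a => by
        by_cases ha : g a = n + 2
        · have h0 : f (D fun j => if a = j then 1 else 0) = 0 :=
            hfD (LinearMap.mem_range_self D _)
          rw [hf] at h0
          refine (Finset.sum_congr rfl fun b _ => ?_).trans h0
          rw [hD]
          simp only [mul_ite, mul_one, mul_zero, Finset.sum_ite_eq, Finset.mem_univ, if_true,
            if_pos ha]
          by_cases hb : g b = n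
          · rw [if_pos hb]
          · have : d b a = 0 := by
              by_contra hne
              have := hg a b hne
              omega
            rw [if_neg hb, this, zero_mul]
        · refine Finset.sum_eq_zero fun b _ => ?_
          by_cases hb : g b = n
          · have : d b a = 0 := by
              by_contra hne
              have := hg a b hne
              omega
            rw [this, zero_mul]
          · rw [if_neg hb, mul_zero])
    apply hfx
    rw [hf]
    have h1 : ∀ a, x a * φ a = ∑ b, d b a * y b * x a := by
      intro a
      rw [← Finset.sum_mul, hdy a]
      by_cases ha : x a = 0
      · rw [ha, zero_mul, mul_zero]
      · rw [if_pos (hx a ha).2, mul_comm]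
    simp only [h1]
    rw [Finset.sum_comm]
    refine Finset.sum_eq_zero fun b _ => ?_
    have h2 := hdx b trivial
    calc ∑ a, d b a * y b * x a = y b * ∑ a, d b a * x a := by
          rw [Finset.mul_sum]
          exact Finset.sum_congr rfl fun a _ => by ring
      _ = 0 := by rw [h2, mul_zero]

/-- The lower bound for a connected diagram, by passing to the dual complex of the mirror
image. -/
theorem exactOn_univ_of_lt [Fintype C] [Finite L] {ε : (C → Bool) → C → ℤˣ}
    (hd : ∀ a b, ∑ m, Q.diff ε b m * Q.diff ε m a = 0)
    (hconn : numClasses (Q.merge (fun _ => false) Finset.univ) = 1) {n : ℤ}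
    (hn : n < (numClasses (Q.rel fun _ => true) : ℤ) - Fintype.card C - 2) :
    ExactOn (Q.diff ε) Q.gr Set.univ n := by
  have hd' : ∀ a b, ∑ m, Q.mirror.diff (mirrorSigns ε) b m *
      Q.mirror.diff (mirrorSigns ε) m a = 0 := by
    intro a b
    obtain ⟨a, rfl⟩ := mirrorEquiv.surjective a
    obtain ⟨b, rfl⟩ := mirrorEquiv.surjective b
    rw [← mirrorEquiv.sum_comp, ← hd b a]
    refine Finset.sum_congr rfl fun m _ => ?_
    rw [mul_comm]
    exact congrArg₂ _ (diff_mirror ε m a) (diff_mirror ε b m)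
  have hconn' : numClasses (Q.mirror.merge (fun _ => false) Finset.univ) = 1 := by
    rw [← hconn]
    have : Q.mirror.merge (fun _ => false) Finset.univ =
        Q.merge (fun _ => true) Finset.univ := rfl
    rw [this, merge_congr (s' := fun _ => false) (by simp)]
  have hex := exactOn_univ hd' hconn' (n := -n - Fintype.card C) (by
    have : Q.mirror.rel (fun _ => false) = Q.rel fun _ => true := rfl
    rw [this]
    linarith)
  refine ExactOn.of_transpose (fun a b => gr_of_diff_ne_zero) fun x hx hdx => ?_
  obtain ⟨y, hy, hdy⟩ := hex (fun a => x (mirrorEquiv.symm a))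
    (fun b hb => by
      obtain ⟨b, rfl⟩ := mirrorEquiv.surjective b
      rw [Equiv.symm_apply_apply] at hb
      refine ⟨trivial, ?_⟩
      have h1 := gr_mirror b
      rw [hx b hb] at h1
      exact h1)
    (fun b _ => by
      obtain ⟨b, rfl⟩ := mirrorEquiv.surjective b
      rw [← mirrorEquiv.sum_comp, ← hdx b]
      refine Finset.sum_congr rfl fun m _ => ?_
      rw [Equiv.symm_apply_apply]
      exact congrArg (· * x m) (diff_mirror ε b m))
  refine ⟨fun a => y (mirrorEquiv a), ?_, ?_⟩
  · intro b hb
    have h1 := (hy _ hb).2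
    have h2 : Q.mirror.gr (mirrorEquiv b) = -Q.gr b - Fintype.card C := gr_mirror b
    omega
  · intro a
    have h1 := hdy (mirrorEquiv a) trivial
    rw [← mirrorEquiv.sum_comp, Equiv.symm_apply_apply] at h1
    rw [← h1]
    refine Finset.sum_congr rfl fun m _ => ?_
    exact congrArg (· * y (mirrorEquiv m)) (diff_mirror ε a m).symm

end Mirror

end Cube

/-! ### The edge maps commute -/

/-- Points that become equivalent by gluing `p` and `q` lie one in the class of `p` and one in
the class of `q`. -/
theorem glue_cases {L : Type*} {E : Setoid L} {p q x y : L} (h : glue E p q x y) (hn : ¬ E x y) :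
    E x p ∧ E y q ∨ E x q ∧ E y p := by
  rcases h with h | ⟨hx | hx, hy | hy⟩
  · exact absurd h hn
  · exact absurd (Setoid.trans' _ hx (Setoid.symm' _ hy)) hn
  · exact Or.inl ⟨hx, hy⟩
  · exact Or.inr ⟨hx, hy⟩
  · exact absurd (Setoid.trans' _ hx (Setoid.symm' _ hy)) hn

namespace Cube

variable {C L : Type*} {Q : Cube C L}

theorem Labelled.toggle_label (a : Q.Labelled) (l z : L) :
    (a.toggle l).label z = if Q.rel a.state z l then (a.label z).swap else a.label z := rfl

/-- The edge maps commute with the multiplication by `X` at a point `l`. -/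
theorem coef_toggle_comm {c : C} {a b : Q.Labelled} (h : Step c a.state b.state) (l : L) :
    (if a.label l = .one then Q.coef c (a.toggle l) b else 0) =
      if b.label l = .X then Q.coef c a (b.toggle l) else 0 := by
  have hoff := h.off_iff (Q := Q)
  have htog : ∀ (a : Q.Labelled) z z', Q.rel (a.toggle l).state z z' ↔ Q.rel a.state z z' :=
    fun _ _ _ => Iff.rfl
  by_cases hl : Q.rel a.state l (Q.p c) ∨ Q.rel a.state l (Q.q c)
  · -- the point lies on one of the strings at `c`
    have hl' := (hoff l).2 hl
    have h1 : ∀ z, ¬ Q.rel a.state z (Q.p c) → ¬ Q.rel a.state z (Q.q c) →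
        ¬ Q.rel a.state z l ∧ ¬ Q.rel b.state z l := by
      intro z hp hq
      refine ⟨fun hz => hl.elim (fun h => hp (Setoid.trans' _ hz h))
        (fun h => hq (Setoid.trans' _ hz h)), fun hz => ?_⟩
      have := (hoff z).1 (hl'.imp (Setoid.trans' _ hz) (Setoid.trans' _ hz))
      exact this.elim hp hq
    have hcond : (∀ z, ¬ Q.rel a.state z (Q.p c) → ¬ Q.rel a.state z (Q.q c) →
        (a.toggle l).label z = b.label z) ↔ (∀ z, ¬ Q.rel a.state z (Q.p c) →
        ¬ Q.rel a.state z (Q.q c) → a.label z = (b.toggle l).label z) := by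
      refine forall_congr' fun z => forall_congr' fun hp => forall_congr' fun hq => ?_
      rw [Labelled.toggle_label, Labelled.toggle_label, if_neg (h1 z hp hq).1,
        if_neg (h1 z hp hq).2]
    unfold coef
    simp only [htog, hcond]
    by_cases hc : ∀ z, ¬ Q.rel a.state z (Q.p c) →
        ¬ Q.rel a.state z (Q.q c) → a.label z = (b.toggle l).label z
    swap
    · simp only [if_neg hc, ite_self]
    simp only [if_pos hc]
    simp only [Labelled.toggle_label]
    by_cases hpq : Q.rel a.state (Q.p c) (Q.q c)
    · have hpq' : ¬ Q.rel b.state (Q.p c) (Q.q c) := fun h' => h.rel_iff.1 h' hpq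
      have e1 : Q.rel a.state (Q.p c) l := by
        rcases hl with hl | hl
        · exact Setoid.symm' _ hl
        · exact Setoid.trans' _ hpq (Setoid.symm' _ hl)
      rw [a.compat _ _ (Setoid.symm' _ e1)]
      simp only [hpq, hpq', e1, if_true, not_true, not_false_iff, false_and, true_and, if_false]
      rcases hl' with hl' | hl'
      · have e2 : Q.rel b.state (Q.p c) l := Setoid.symm' _ hl'
        have e3 : ¬ Q.rel b.state (Q.q c) l := fun h' =>
          hpq' (Setoid.trans' _ e2 (Setoid.symm' _ h'))
        rw [b.compat _ _ hl']
        simp only [e2, e3, if_true, if_false]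
        cases a.label (Q.p c) <;> cases b.label (Q.p c) <;> cases b.label (Q.q c) <;>
          simp [comulCoeff, Gen.swap]
      · have e2 : Q.rel b.state (Q.q c) l := Setoid.symm' _ hl'
        have e3 : ¬ Q.rel b.state (Q.p c) l := fun h' => hpq' (Setoid.trans' _ h' hl')
        rw [b.compat _ _ hl']
        simp only [e2, e3, if_true, if_false]
        cases a.label (Q.p c) <;> cases b.label (Q.p c) <;> cases b.label (Q.q c) <;>
          simp [comulCoeff, Gen.swap]
    · have hpq' : Q.rel b.state (Q.p c) (Q.q c) := h.rel_iff.2 hpq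
      have e1 : Q.rel b.state (Q.p c) l := by
        rcases hl' with hl | hl
        · exact Setoid.symm' _ hl
        · exact Setoid.trans' _ hpq' (Setoid.symm' _ hl)
      rw [b.compat _ _ (Setoid.symm' _ e1)]
      simp only [hpq, hpq', e1, if_true, not_false_iff, true_and]
      rcases hl with hl | hl
      · have e2 : Q.rel a.state (Q.p c) l := Setoid.symm' _ hl
        have e3 : ¬ Q.rel a.state (Q.q c) l := fun h' =>
          hpq (Setoid.trans' _ e2 (Setoid.symm' _ h'))
        rw [a.compat _ _ hl]
        simp only [e2, e3, if_true, if_false]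
        cases a.label (Q.p c) <;> cases a.label (Q.q c) <;> cases b.label (Q.p c) <;>
          simp [mulCoeff, Gen.swap]
      · have e2 : Q.rel a.state (Q.q c) l := Setoid.symm' _ hl
        have e3 : ¬ Q.rel a.state (Q.p c) l := fun h' => hpq (Setoid.trans' _ h' hl)
        rw [a.compat _ _ hl]
        simp only [e2, e3, if_true, if_false]
        cases a.label (Q.p c) <;> cases a.label (Q.q c) <;> cases b.label (Q.p c) <;>
          simp [mulCoeff, Gen.swap]
  · -- the point lies on a cycle that carries the identity
    have hl' : ¬ (Q.rel b.state l (Q.p c) ∨ Q.rel b.state l (Q.q c)) := fun h' =>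
      hl ((hoff l).1 h')
    push Not at hl hl'
    have same : ∀ z, Q.rel a.state z l ↔ Q.rel b.state z l := by
      intro z
      have h1 := h.glue_eq (Q := Q)
      constructor
      · intro hz
        have h2 : glue (Q.rel b.state) (Q.p c) (Q.q c) z l := by rw [h1]; exact Or.inl hz
        rcases h2 with h2 | ⟨_, h2⟩
        · exact h2
        · exact absurd h2 (by tauto)
      · intro hz
        have h2 : glue (Q.rel a.state) (Q.p c) (Q.q c) z l := by rw [← h1]; exact Or.inl hz
        rcases h2 with h2 | ⟨_, h2⟩
        · exact h2
        · exact absurd h2 (by tauto)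
    have hpa : ¬ Q.rel a.state (Q.p c) l := fun h => hl.1 (Setoid.symm' _ h)
    have hqa : ¬ Q.rel a.state (Q.q c) l := fun h => hl.2 (Setoid.symm' _ h)
    have hba : b.label l = .X → (b.toggle l).label l = .one := fun hb => by
      rw [b.toggle_label_self, hb]; rfl
    by_cases ha : a.label l = .one
    · by_cases hb : b.label l = .X
      · rw [if_pos ha, if_pos hb]
        have := coef_toggle (c := c) (a := a) (b := b.toggle l) same hpa hqa
        rw [Labelled.toggle_toggle] at this
        exact this
      · rw [if_pos ha, if_neg hb]
        by_contra hne
        have h2 := label_eq_of_coef_ne_zero (a := a.toggle l) hne hl.1 hl.2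
        rw [a.toggle_label_self, ha] at h2
        exact hb h2.symm
    · rw [if_neg ha]
      by_cases hb : b.label l = .X
      · rw [if_pos hb]
        by_contra hne
        have h2 := label_eq_of_coef_ne_zero (Ne.symm hne) hl.1 hl.2
        rw [hba hb] at h2
        exact ha h2
      · rw [if_neg hb]

section Operators

variable (Q) in
/-- Multiplication by `X` on the cycle through the point `l`. -/
noncomputable def mulX (l : L) : (Q.Labelled → ℚ) →ₗ[ℚ] (Q.Labelled → ℚ) where
  toFun f b := if b.label l = .X then f (b.toggle l) else 0
  map_add' f g := by funext b; by_cases h : b.label l = .X <;> simp [h]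
  map_smul' r f := by funext b; by_cases h : b.label l = .X <;> simp [h]

theorem mulX_apply (l : L) (f : Q.Labelled → ℚ) (b : Q.Labelled) :
    Q.mulX l f b = if b.label l = .X then f (b.toggle l) else 0 := rfl

theorem mulX_comm (l l' : L) (f : Q.Labelled → ℚ) :
    Q.mulX l (Q.mulX l' f) = Q.mulX l' (Q.mulX l f) := by
  funext b
  simp only [mulX_apply]
  by_cases h : Q.rel b.state l l'
  · have h1 : b.label l = b.label l' := b.compat _ _ h
    have h2 : (b.toggle l).label l' = (b.label l').swap := by
      rw [Labelled.toggle_label, if_pos (Setoid.symm' _ h)]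
    have h3 : (b.toggle l').label l = (b.label l).swap := by
      rw [Labelled.toggle_label, if_pos h]
    rw [h2, h3, ← h1]
    cases b.label l <;> simp [Gen.swap]
  · have h' : ¬ Q.rel b.state l' l := fun h' => h (Setoid.symm' _ h')
    have h2 : (b.toggle l).label l' = b.label l' := if_neg h'
    have h3 : (b.toggle l').label l = b.label l := if_neg h
    have h4 : (b.toggle l).toggle l' = (b.toggle l').toggle l := by
      ext z
      · rfl
      · change (if Q.rel b.state z l' then (if Q.rel b.state z l then _ else _ : Gen).swap
          else (if Q.rel b.state z l then _ else _)) =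
          (if Q.rel b.state z l then (if Q.rel b.state z l' then _ else _ : Gen).swap
          else (if Q.rel b.state z l' then _ else _))
        by_cases hz : Q.rel b.state z l <;> by_cases hz' : Q.rel b.state z l' <;> simp [hz, hz']
    rw [h2, h3, h4]
    by_cases hl : b.label l = .X <;> by_cases hl' : b.label l' = .X <;> simp [hl, hl']

variable (Q) in
/-- The state `s` with all labels `1`. -/
def allOne (s : C → Bool) : Q.Labelled := ⟨s, fun _ => .one, fun _ _ _ => rfl⟩

variable (Q) in
/-- The basis vector of the state `s` with all labels `1`. -/
noncomputable def vac (s : C → Bool) : Q.Labelled → ℚ := Pi.single (Q.allOne s) 1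

theorem mulX_vac_congr {s : C → Bool} {l l' : L} (h : Q.rel s l l') :
    Q.mulX l (Q.vac s) = Q.mulX l' (Q.vac s) := by
  funext b
  rw [mulX_apply, mulX_apply]
  by_cases hb : b.state = s
  · subst hb
    rw [b.compat _ _ h]
    have : b.toggle l = b.toggle l' := by
      have hz : ∀ z, Q.rel b.state z l ↔ Q.rel b.state z l' := fun z =>
        ⟨fun h' => Setoid.trans' _ h' h, fun h' => Setoid.trans' _ h' (Setoid.symm' _ h)⟩
      ext z
      · rfl
      · simp only [Labelled.toggle_label, hz]
    rw [this]
  · have : ∀ l, Q.vac s (b.toggle l) = 0 := fun l => by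
      unfold vac
      refine Pi.single_eq_of_ne (fun h' => hb ?_) _
      exact congrArg Labelled.state h'
    rw [this, this, ite_self, ite_self]

variable [Fintype C] [Finite L]

variable (Q) in
/-- The sum of the edge maps that change the smoothing of `c`, without signs. -/
noncomputable def edgeMap (c : C) : (Q.Labelled → ℚ) →ₗ[ℚ] (Q.Labelled → ℚ) :=
  Matrix.mulVecLin (Matrix.of fun b a => if Step c a.state b.state then Q.coef c a b else 0)

theorem edgeMap_apply (c : C) (f : Q.Labelled → ℚ) (b : Q.Labelled) :
    Q.edgeMap c f b = ∑ a, (if Step c a.state b.state then Q.coef c a b else 0) * f a := rfl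

theorem edgeMap_mulX (c : C) (l : L) (f : Q.Labelled → ℚ) :
    Q.edgeMap c (Q.mulX l f) = Q.mulX l (Q.edgeMap c f) := by
  funext b
  rw [edgeMap_apply, mulX_apply, edgeMap_apply]
  have h1 : ∑ a, (if Step c a.state b.state then Q.coef c a b else 0) * Q.mulX l f a =
      ∑ a : Q.Labelled, (if Step c a.state b.state then Q.coef c (a.toggle l) b else 0) *
        (if a.label l = .one then f a else 0) := by
    refine Fintype.sum_bijective (fun a : Q.Labelled => a.toggle l)
      (Function.Involutive.bijective fun a => a.toggle_toggle l) _ _ fun a => ?_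
    rw [mulX_apply, Labelled.toggle_toggle]
    simp only [Labelled.toggle_label_self, Gen.swap_eq_one]
    rfl
  rw [h1]
  by_cases hb : b.label l = .X
  · rw [if_pos hb]
    refine Finset.sum_congr rfl fun a _ => ?_
    by_cases hs : Step c a.state b.state
    · have := coef_toggle_comm hs l
      rw [if_pos hb] at this
      rw [if_pos hs, if_pos (show Step c a.state (b.toggle l).state from hs), ← this]
      by_cases ha : a.label l = .one <;> simp [ha]
    · rw [if_neg hs, if_neg (show ¬ Step c a.state (b.toggle l).state from hs), zero_mul, zero_mul]
  · rw [if_neg hb]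
    refine Finset.sum_eq_zero fun a _ => ?_
    by_cases hs : Step c a.state b.state
    · have := coef_toggle_comm hs l
      rw [if_neg hb] at this
      by_cases ha : a.label l = .one
      · rw [if_pos ha] at this
        rw [this, ite_self, zero_mul]
      · rw [if_neg ha, mul_zero]
    · rw [if_neg hs, zero_mul]

/-- The states with all labels `1` generate under the multiplications by `X`, so that a linear map
that commutes with these is determined by its values on such states. -/
theorem eq_zero_of_vac {G : (Q.Labelled → ℚ) →ₗ[ℚ] (Q.Labelled → ℚ)}
    (hX : ∀ l f, G (Q.mulX l f) = Q.mulX l (G f)) (hG : ∀ s, G (Q.vac s) = 0) : G = 0 := by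
  suffices H : ∀ (n : ℕ) (a : Q.Labelled), {l | a.label l = .X}.ncard = n →
      G (Pi.single a 1) = 0 by
    refine LinearMap.pi_ext' fun a => LinearMap.ext_ring ?_
    simpa using H _ a rfl
  intro n
  induction n using Nat.strong_induction_on with
  | _ n ih =>
    intro a ha
    by_cases hex : ∃ l, a.label l = .X
    · obtain ⟨l, hl⟩ := hex
      have h1 : (Pi.single a 1 : Q.Labelled → ℚ) = Q.mulX l (Pi.single (a.toggle l) 1) := by
        funext b
        rw [mulX_apply]
        by_cases hb : b = a
        · subst hb; simp [hl]
        · rw [Pi.single_eq_of_ne hb, Pi.single_eq_of_ne, ite_self]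
          intro h
          apply hb
          rw [← b.toggle_toggle l, h, Labelled.toggle_toggle]
      rw [h1, hX, ih _ ?_ (a.toggle l) rfl, map_zero]
      rw [← ha]
      refine Set.ncard_lt_ncard ⟨?_, ?_⟩ (Set.toFinite _)
      · intro z hz
        by_cases hzl : Q.rel a.state z l
        · exact (a.compat z l hzl).trans hl
        · have h2 : (a.toggle l).label z = .X := hz
          rwa [Labelled.toggle_label, if_neg hzl] at h2
      · intro h
        have h2 : (a.toggle l).label l = .X := h hl
        rw [a.toggle_label_self, hl] at h2
        exact absurd h2 (by simp [Gen.swap])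
    · push Not at hex
      have : a = Q.allOne a.state := by
        ext l
        · rfl
        · have := hex l
          cases h : a.label l
          · rfl
          · exact absurd h this
      rw [this]
      exact hG _

variable (Q) in
/-- The value of an edge map on a state with all labels `1`, as an operator applied to the new
state with all labels `1`. -/
noncomputable def edgeFactor (s : C → Bool) (c : C) :
    (Q.Labelled → ℚ) →ₗ[ℚ] (Q.Labelled → ℚ) :=
  if Q.rel s (Q.p c) (Q.q c) then Q.mulX (Q.p c) + Q.mulX (Q.q c) else LinearMap.id

theorem edgeMap_vac_of_true {s : C → Bool} {c : C} (h : s c = true) :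
    Q.edgeMap c (Q.vac s) = 0 := by
  funext b
  rw [edgeMap_apply]
  refine Finset.sum_eq_zero fun a _ => ?_
  by_cases ha : a = Q.allOne s
  · subst ha
    have : ¬ Step c (Q.allOne s).state b.state := fun h' => by
      have := h'.1
      change s c = false at this
      rw [h] at this
      exact absurd this (by simp)
    rw [if_neg this, zero_mul]
  · unfold vac
    rw [Pi.single_eq_of_ne ha, mul_zero]

theorem edgeMap_vac {s : C → Bool} {c : C} (h : s c = false) :
    Q.edgeMap c (Q.vac s) = Q.edgeFactor s c (Q.vac (Function.update s c true)) := by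
  have hst : Step c s (Function.update s c true) := ⟨h, rfl⟩
  funext b
  rw [edgeMap_apply, Finset.sum_eq_single (Q.allOne s) (fun a _ ha => by
    unfold vac; rw [Pi.single_eq_of_ne ha, mul_zero]) (fun h => absurd (Finset.mem_univ _) h)]
  have h1 : Q.vac s (Q.allOne s) = 1 := Pi.single_eq_same _ _
  rw [h1, mul_one]
  have vac_ne : ∀ d : Q.Labelled, d.state ≠ Function.update s c true →
      Q.vac (Function.update s c true) d = 0 := fun d hd =>
    Pi.single_eq_of_ne (fun h' => hd (congrArg Labelled.state h')) _
  by_cases hb : b.state = Function.update s c true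
  swap
  · rw [if_neg (fun h' : Step c (Q.allOne s).state b.state => hb h'.2)]
    unfold edgeFactor
    by_cases hpq : Q.rel s (Q.p c) (Q.q c)
    · rw [if_pos hpq, LinearMap.add_apply, Pi.add_apply, mulX_apply, mulX_apply,
        vac_ne _ (show (b.toggle _).state ≠ _ from hb),
        vac_ne _ (show (b.toggle _).state ≠ _ from hb), ite_self, ite_self, add_zero]
    · rw [if_neg hpq, LinearMap.id_apply, vac_ne b hb]
  have hst' : Step c (Q.allOne s).state b.state := ⟨h, hb⟩
  rw [if_pos hst']
  have hoff := hst'.off_iff (Q := Q)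
  have vac_eq : ∀ d : Q.Labelled, d.state = Function.update s c true →
      Q.vac (Function.update s c true) d = if ∀ l, d.label l = .one then 1 else 0 := by
    intro d hd
    by_cases hd' : ∀ l, d.label l = .one
    · rw [if_pos hd']
      have : d = Q.allOne (Function.update s c true) := by
        ext l
        · rw [hd]; rfl
        · rw [hd' l]; rfl
      rw [this]
      exact Pi.single_eq_same _ _
    · rw [if_neg hd']
      refine Pi.single_eq_of_ne (fun h' => hd' fun l => ?_) _
      rw [h']; rfl
  unfold coef edgeFactor
  by_cases hpq : Q.rel s (Q.p c) (Q.q c)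
  · have hpq' : ¬ Q.rel b.state (Q.p c) (Q.q c) := fun h' => hst'.rel_iff.1 h' hpq
    have hpq'' : ¬ Q.rel b.state (Q.q c) (Q.p c) := fun h' => hpq' (Setoid.symm' _ h')
    rw [if_neg (fun h' => h'.1 hpq : ¬ (¬ Q.rel (Q.allOne s).state (Q.p c) (Q.q c) ∧ _)),
      if_pos (⟨hpq, hpq'⟩ : Q.rel (Q.allOne s).state (Q.p c) (Q.q c) ∧ _),
      if_pos hpq, LinearMap.add_apply, Pi.add_apply, mulX_apply, mulX_apply,
      vac_eq _ (show (b.toggle _).state = _ from hb),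
      vac_eq _ (show (b.toggle _).state = _ from hb)]
    change (if (∀ l, ¬ Q.rel s l (Q.p c) → ¬ Q.rel s l (Q.q c) → .one = b.label l) then
      comulCoeff .one (b.label (Q.p c)) (b.label (Q.q c)) else 0) = _
    have key : ∀ x y, (x = Q.p c ∧ y = Q.q c ∨ x = Q.q c ∧ y = Q.p c) → b.label x = .X →
        ((∀ l, (b.toggle x).label l = .one) ↔ b.label y = .one ∧
          ∀ l, ¬ Q.rel s l (Q.p c) → ¬ Q.rel s l (Q.q c) → .one = b.label l) := by
      intro x y hxy hx
      have hyx : ¬ Q.rel b.state y x := by rcases hxy with ⟨rfl, rfl⟩ | ⟨rfl, rfl⟩ <;> assumption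
      have hor : ∀ l, (Q.rel b.state l x ∨ Q.rel b.state l y) ↔
          (Q.rel s l (Q.p c) ∨ Q.rel s l (Q.q c)) := by
        intro l
        refine Iff.trans ?_ (hoff l)
        rcases hxy with ⟨rfl, rfl⟩ | ⟨rfl, rfl⟩
        · exact Iff.rfl
        · exact or_comm
      constructor
      · intro hall
        refine ⟨?_, fun l hp hq => ?_⟩
        · have := hall y
          rwa [Labelled.toggle_label, if_neg hyx] at this
        · have hlx : ¬ Q.rel b.state l x := fun h' => ((hor l).1 (Or.inl h')).elim hp hq
          have := hall l
          rw [Labelled.toggle_label, if_neg hlx] at this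
          exact this.symm
      · rintro ⟨hy, hall⟩ l
        rw [Labelled.toggle_label]
        by_cases hlx : Q.rel b.state l x
        · rw [if_pos hlx, b.compat _ _ hlx, hx]; rfl
        · rw [if_neg hlx]
          by_cases hly : Q.rel b.state l y
          · rw [b.compat _ _ hly, hy]
          · have := (not_congr (hor l)).1 (not_or.2 ⟨hlx, hly⟩)
            push Not at this
            exact (hall l this.1 this.2).symm
    have k1 := key _ _ (Or.inl ⟨rfl, rfl⟩)
    have k2 := key _ _ (Or.inr ⟨rfl, rfl⟩)
    by_cases hc : ∀ l, ¬ Q.rel s l (Q.p c) → ¬ Q.rel s l (Q.q c) → .one = b.label l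
    · rw [if_pos hc]
      cases hp : b.label (Q.p c) <;> cases hq : b.label (Q.q c)
      · simp [comulCoeff]
      · simp only [comulCoeff, reduceCtorEq, if_false, if_true, zero_add]
        rw [if_pos ((k2 hq).2 ⟨hp, hc⟩)]
      · simp only [comulCoeff, reduceCtorEq, if_false, if_true, add_zero]
        rw [if_pos ((k1 hp).2 ⟨hq, hc⟩)]
      · simp only [comulCoeff, if_true]
        rw [if_neg, if_neg, add_zero]
        · intro h'
          rw [((k2 hq).1 h').1] at hp
          exact absurd hp (by simp)
        · intro h'
          rw [((k1 hp).1 h').1] at hq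
          exact absurd hq (by simp)
    · rw [if_neg hc]
      by_cases hp : b.label (Q.p c) = .X <;> by_cases hq : b.label (Q.q c) = .X
      · rw [if_pos hp, if_pos hq, if_neg (fun h' => hc ((k1 hp).1 h').2),
          if_neg (fun h' => hc ((k2 hq).1 h').2), add_zero]
      · rw [if_pos hp, if_neg hq, if_neg (fun h' => hc ((k1 hp).1 h').2), add_zero]
      · rw [if_neg hp, if_pos hq, if_neg (fun h' => hc ((k2 hq).1 h').2), add_zero]
      · rw [if_neg hp, if_neg hq, add_zero]
  · have hpq' : Q.rel b.state (Q.p c) (Q.q c) := hst'.rel_iff.2 hpq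
    rw [if_pos (⟨hpq, hpq'⟩ : ¬ Q.rel (Q.allOne s).state (Q.p c) (Q.q c) ∧ _),
      if_neg hpq, LinearMap.id_apply, vac_eq b hb]
    change (if (∀ l, ¬ Q.rel s l (Q.p c) → ¬ Q.rel s l (Q.q c) → .one = b.label l) then
      mulCoeff .one .one (b.label (Q.p c)) else 0) = _
    have hglue := hst'.rel_eq_glue hpq
    by_cases hc : ∀ l, ¬ Q.rel s l (Q.p c) → ¬ Q.rel s l (Q.q c) → .one = b.label l
    · rw [if_pos hc]
      by_cases hp : b.label (Q.p c) = .one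
      · rw [hp, if_pos]
        · rfl
        · intro l
          by_cases hl : Q.rel s l (Q.p c) ∨ Q.rel s l (Q.q c)
          · have : Q.rel b.state l (Q.p c) := by
              rw [hglue]
              exact Or.inr ⟨hl, Or.inl (Setoid.refl' _ _)⟩
            rw [b.compat _ _ this, hp]
          · push Not at hl
            exact (hc l hl.1 hl.2).symm
      · rw [if_neg (fun h' => hp (h' _)), Gen.ne_one.1 hp]
        rfl
    · rw [if_neg hc, if_neg (fun h' => hc fun l _ _ => (h' l).symm)]

/-- The two ways around a face of the cube agree. -/
theorem edgeMap_comm {c c' : C} (hne : c ≠ c') (f : Q.Labelled → ℚ) :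
    Q.edgeMap c' (Q.edgeMap c f) = Q.edgeMap c (Q.edgeMap c' f) := by
  have factor_edge : ∀ (s : C → Bool) (c c' : C) f,
      Q.edgeMap c' (Q.edgeFactor s c f) = Q.edgeFactor s c (Q.edgeMap c' f) := by
    intro s c c' f
    unfold edgeFactor
    by_cases h : Q.rel s (Q.p c) (Q.q c)
    · simp only [if_pos h, LinearMap.add_apply, map_add, edgeMap_mulX]
    · simp only [if_neg h, LinearMap.id_apply]
  suffices H : Q.edgeMap c' ∘ₗ Q.edgeMap c - Q.edgeMap c ∘ₗ Q.edgeMap c' = 0 by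
    have := LinearMap.congr_fun H f
    simpa [sub_eq_zero] using this
  refine eq_zero_of_vac (fun l f => ?_) fun s => ?_
  · simp only [LinearMap.sub_apply, LinearMap.comp_apply, edgeMap_mulX, map_sub]
  simp only [LinearMap.sub_apply, LinearMap.comp_apply]
  have kill : ∀ c c' : C, c ≠ c' → s c = true →
      Q.edgeMap c (Q.edgeMap c' (Q.vac s)) = 0 := by
    intro c c' hne h
    cases h' : s c'
    · rw [edgeMap_vac h', factor_edge, edgeMap_vac_of_true, map_zero]
      rw [Function.update_of_ne hne, h]
    · rw [edgeMap_vac_of_true h', map_zero]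
  cases hc : s c
  swap
  · rw [edgeMap_vac_of_true hc, kill c c' hne hc, map_zero, sub_zero]
  cases hc' : s c'
  swap
  · rw [edgeMap_vac_of_true hc', kill c' c hne.symm hc', map_zero, sub_zero]
  have st₁ : Step c s (Function.update s c true) := ⟨hc, rfl⟩
  have st₁' : Step c' s (Function.update s c' true) := ⟨hc', rfl⟩
  have st₂ : Step c' (Function.update s c true)
      (Function.update (Function.update s c true) c' true) :=
    ⟨by rw [Function.update_of_ne hne.symm, hc'], rfl⟩
  have st₂' : Step c (Function.update s c' true)
      (Function.update (Function.update s c true) c' true) :=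
    ⟨by rw [Function.update_of_ne hne, hc], Function.update_comm hne _ _ _⟩
  rw [edgeMap_vac hc, factor_edge, edgeMap_vac st₂.1, edgeMap_vac hc', factor_edge,
    edgeMap_vac st₂'.1, Function.update_comm hne.symm]
  -- splits and merges along the two ways are equal in number
  have count : ∀ (c : C) (s s' : C → Bool), Step c s s' →
      (Q.rel s (Q.p c) (Q.q c) ∧ numClasses (Q.rel s') = numClasses (Q.rel s) + 1) ∨
      (¬ Q.rel s (Q.p c) (Q.q c) ∧ numClasses (Q.rel s) = numClasses (Q.rel s') + 1) := by
    intro c s s' h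
    by_cases h' : Q.rel s (Q.p c) (Q.q c)
    · refine Or.inl ⟨h', ?_⟩
      rw [h.rel_eq_glue' h', numClasses_glue fun h'' => h.rel_iff.1 h'' h']
    · refine Or.inr ⟨h', ?_⟩
      rw [h.rel_eq_glue h', numClasses_glue h']
  have n₁ := count _ _ _ st₁
  have n₁' := count _ _ _ st₁'
  have n₂ := count _ _ _ st₂
  have n₂' := count _ _ _ st₂'
  set u := Function.update (Function.update s c true) c' true with hu
  unfold edgeFactor
  by_cases hA : Q.rel s (Q.p c) (Q.q c) <;> by_cases hA' : Q.rel s (Q.p c') (Q.q c') <;>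
    by_cases hB : Q.rel (Function.update s c true) (Q.p c') (Q.q c') <;>
    by_cases hB' : Q.rel (Function.update s c' true) (Q.p c) (Q.q c) <;>
    simp only [hA, hA', hB, hB', if_true, if_false, not_true, not_false_iff, true_and,
      false_and, or_false, false_or, LinearMap.add_apply, LinearMap.id_apply, map_add]
      at n₁ n₁' n₂ n₂' ⊢ <;> first | omega | skip
  · rw [mulX_comm (Q.p c), mulX_comm (Q.p c), mulX_comm (Q.q c), mulX_comm (Q.q c)]
    abel
  · -- both strings run through the same cycle of the last state
    have r1 : Q.rel u (Q.p c') (Q.q c') := st₂.rel_iff.2 hB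
    have r2 : Q.rel u (Q.p c) (Q.q c) := st₂'.rel_iff.2 hB'
    have r3 : Q.rel (Function.update s c true) ≤ Q.rel u := by
      rw [st₂.rel_eq_glue hB]; exact le_glue _ _ _
    have r4 : Q.rel u (Q.p c') (Q.p c) := by
      have h1 := hA'
      rw [st₁.rel_eq_glue' hA] at h1
      rcases glue_cases h1 hB with ⟨h2, -⟩ | ⟨h2, -⟩
      · exact r3 h2
      · exact Setoid.trans' _ (r3 h2) (Setoid.symm' _ r2)
    rw [mulX_vac_congr (Setoid.symm' _ r1), mulX_vac_congr r4, mulX_vac_congr (Setoid.symm' _ r2),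
      sub_self]
  · rw [sub_self]
  · rw [sub_self]
  · have r1 : ¬ Q.rel u (Q.p c) (Q.q c) := fun h => st₂'.rel_iff.1 h hB'
    have r2 := st₁.rel_iff.2 hA
    rw [st₂.rel_eq_glue' hB] at r2
    rcases glue_cases r2 r1 with ⟨h1, h2⟩ | ⟨h1, h2⟩
    · rw [mulX_vac_congr h1, mulX_vac_congr h2, sub_self]
    · rw [mulX_vac_congr h1, mulX_vac_congr h2, add_comm, sub_self]
  · rw [sub_self]

/-- Edge signs that anticommute on every face give a differential. -/
theorem diff_sq_eq_zero {ε : (C → Bool) → C → ℤˣ}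
    (hε : ∀ s c c', c ≠ c' → s c = false → s c' = false →
      ε s c * ε (Function.update s c true) c' = -(ε s c' * ε (Function.update s c' true) c))
    (a b : Q.Labelled) : ∑ m, Q.diff ε b m * Q.diff ε m a = 0 := by
  let E : C → Q.Labelled → Q.Labelled → ℚ := fun c b a =>
    if Step c a.state b.state then Q.coef c a b else 0
  let S : C → C → ℚ := fun c c' => ∑ m, E c' b m * E c m a
  let w : C → C → ℚ := fun c c' =>
    ((ε (Function.update a.state c true) c' : ℤˣ) : ℤ) * ((ε a.state c : ℤˣ) : ℤ)
  have hS : ∀ c c', c ≠ c' → S c c' = S c' c := by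
    intro c c' hne
    have h := congrFun (edgeMap_comm (Q := Q) hne (Pi.single a 1)) b
    have h1 : ∀ c, Q.edgeMap c (Pi.single a 1) = fun m => E c m a := by
      intro c
      funext m
      rw [edgeMap_apply, Finset.sum_eq_single a (fun x _ hx => by
        rw [Pi.single_eq_of_ne hx, mul_zero]) (fun h => absurd (Finset.mem_univ _) h),
        Pi.single_eq_same, mul_one]
    rw [h1, h1, edgeMap_apply, edgeMap_apply] at h
    exact h
  have hS0 : ∀ c c', S c c' ≠ 0 → a.state c = false ∧ a.state c' = false ∧ c ≠ c' := by
    intro c c' h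
    obtain ⟨m, -, hm⟩ := Finset.exists_ne_zero_of_sum_ne_zero h
    have h1 : Step c a.state m.state := by
      by_contra h'
      exact right_ne_zero_of_mul hm (if_neg h')
    have h2 : Step c' m.state b.state := by
      by_contra h'
      exact left_ne_zero_of_mul hm (if_neg h')
    refine ⟨h1.1, h1.eq_false_of h2.1, ?_⟩
    rintro rfl
    have := h2.1
    rw [h1.2, Function.update_self] at this
    exact absurd this (by simp)
  have hdiff : ∀ a b : Q.Labelled, Q.diff ε b a =
      ∑ c, (((ε a.state c : ℤˣ) : ℤ) : ℚ) * E c b a := by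
    intro a b
    unfold diff
    rw [Finset.sum_filter]
    refine Finset.sum_congr rfl fun c _ => ?_
    by_cases h : Step c a.state b.state <;> simp [E, h]
  have hsum : ∑ m, Q.diff ε b m * Q.diff ε m a = ∑ c, ∑ c', w c c' * S c c' := by
    simp only [S, Finset.mul_sum]
    rw [Finset.sum_congr rfl (fun c _ => Finset.sum_comm), Finset.sum_comm]
    refine Finset.sum_congr rfl fun m _ => ?_
    rw [hdiff, hdiff, Finset.sum_mul_sum, Finset.sum_comm]
    refine Finset.sum_congr rfl fun c _ => Finset.sum_congr rfl fun c' _ => ?_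
    by_cases h : Step c a.state m.state
    · simp only [w, h.2]; ring
    · simp [E, h]
  have hanti : ∀ c c', w c c' * S c c' = -(w c' c * S c' c) := by
    intro c c'
    by_cases h : S c c' = 0
    · by_cases hcc : c = c'
      · subst hcc; rw [h]; simp
      · rw [← hS c c' hcc, h]; simp
    · obtain ⟨h1, h2, h3⟩ := hS0 c c' h
      rw [← hS c c' h3]
      have := hε a.state c c' h3 h1 h2
      have h4 : (((ε a.state c * ε (Function.update a.state c true) c' : ℤˣ) : ℤ) : ℚ) =
          ((-(ε a.state c' * ε (Function.update a.state c' true) c) : ℤˣ) : ℤ) := by rw [this]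
      push_cast at h4
      simp only [w]
      rw [mul_comm (((ε (Function.update a.state c true) c' : ℤˣ) : ℤ) : ℚ), h4]
      ring
  rw [hsum]
  have h2 : ∑ c, ∑ c', w c c' * S c c' = -∑ c, ∑ c', w c c' * S c c' := by
    conv_lhs => rw [Finset.sum_comm]
    rw [← Finset.sum_neg_distrib]
    refine Finset.sum_congr rfl fun c _ => ?_
    rw [← Finset.sum_neg_distrib]
    exact Finset.sum_congr rfl fun c' _ => hanti c' c
  linarith

end Operators

end Cube

/-! ### Permutations and transpositions -/

/-- Composing a permutation with the transposition of `x` and `y` splits their common cycle or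
merges their cycles.  It suffices that the permutations are related in this way on an invariant
set that contains `x` and `y`. -/
theorem sameCycle_swap_iff {α : Type*} [Finite α] [DecidableEq α] {f g : Equiv.Perm α} {U : Set α}
    (hU : ∀ z ∈ U, f z ∈ U) {x y : α} (hx : x ∈ U) (hxy : x ≠ y)
    (hg : ∀ z ∈ U, g z = Equiv.swap x y (f z)) : g.SameCycle x y ↔ ¬ f.SameCycle x y := by
  have not_sameCycle : ∀ (h : Equiv.Perm α) (N : ℕ), 0 < N → (h ^ N) x = x →
      (∀ m, 0 < m → m < N → (h ^ m) x ≠ y) → ¬ h.SameCycle x y := by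
    intro h N hN hret hne hsame
    obtain ⟨k, hk⟩ := hsame.exists_nat_pow_eq
    have h1 : ∀ t, (h ^ (N * t)) x = x := by
      intro t
      induction t with
      | zero => simp
      | succ t ih => rw [Nat.mul_succ, pow_add, Equiv.Perm.mul_apply, hret, ih]
    rw [← Nat.mod_add_div k N, pow_add, Equiv.Perm.mul_apply, h1] at hk
    rcases Nat.eq_zero_or_pos (k % N) with h0 | h0
    · rw [h0] at hk
      exact hxy (by simpa using hk)
    · exact hne _ h0 (Nat.mod_lt _ hN) hk
  -- the first return of `x` to `{x, y}`
  have hex : ∃ n, 0 < n ∧ ((f ^ n) x = x ∨ (f ^ n) x = y) :=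
    ⟨orderOf f, orderOf_pos f, Or.inl (by rw [pow_orderOf_eq_one]; rfl)⟩
  obtain ⟨hN, hret⟩ := Nat.find_spec hex
  have hmin : ∀ m, 0 < m → m < Nat.find hex → (f ^ m) x ≠ x ∧ (f ^ m) x ≠ y := by
    intro m hm hlt
    have := Nat.find_min hex hlt
    push Not at this
    exact this hm
  set N := Nat.find hex
  have hfU : ∀ m, (f ^ m) x ∈ U := by
    intro m
    induction m with
    | zero => exact hx
    | succ m ih => rw [pow_succ', Equiv.Perm.mul_apply]; exact hU _ ih
  have hstep : ∀ m, f ((f ^ m) x) = (f ^ (m + 1)) x := fun m => by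
    rw [pow_succ', Equiv.Perm.mul_apply]
  have hgf : ∀ m, m < N → (g ^ m) x = (f ^ m) x := by
    intro m
    induction m with
    | zero => intro _; rfl
    | succ m ih =>
      intro hm
      rw [pow_succ', Equiv.Perm.mul_apply, ih (by omega), hg _ (hfU m), hstep]
      exact Equiv.swap_apply_of_ne_of_ne (hmin _ (Nat.succ_pos m) hm).1
        (hmin _ (Nat.succ_pos m) hm).2
  have hgN : (g ^ N) x = Equiv.swap x y ((f ^ N) x) := by
    obtain ⟨m, hm⟩ : ∃ m, N = m + 1 := ⟨N - 1, by omega⟩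
    rw [hm, pow_succ', Equiv.Perm.mul_apply, hgf m (by omega), hg _ (hfU m), hstep]
  rcases hret with h | h
  · rw [h, Equiv.swap_apply_left] at hgN
    have h1 : g.SameCycle x y := ⟨N, by rw [zpow_natCast, hgN]⟩
    have h2 := not_sameCycle f N hN h fun m hm hlt => (hmin m hm hlt).2
    exact iff_of_true h1 h2
  · rw [h, Equiv.swap_apply_right] at hgN
    have h1 : f.SameCycle x y := ⟨N, by rw [zpow_natCast, h]⟩
    have h2 := not_sameCycle g N hN hgN fun m hm hlt => by
      rw [hgf m hlt]; exact (hmin m hm hlt).2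
    exact iff_of_false h2 (not_not.2 h1)

/-! ### The cube of an alternating diagram -/

section Smoothings

variable {C : Type*} (D : VirtualLinkDiagram C)

theorem arc_arc (l : D.Leg) : D.arc (D.arc l) = l := by
  obtain ⟨c, b, e⟩ := l
  cases e <;> simp [arc]

theorem flip_flip_strand (b : Strand) : b.flip.flip = b := by cases b <;> rfl

theorem smooth_smooth (s : D.State) (l : D.Leg) : D.smooth s (D.smooth s l) = l := by
  obtain ⟨c, b, e⟩ := l
  by_cases h : (D.sign c = 1 ↔ s c = false)
  · cases b <;> cases e <;> simp [smooth, h, Strand.flip, End.flip]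
  · cases b <;> cases e <;> simp [smooth, h, Strand.flip]

theorem smooth_strand (s : D.State) (l : D.Leg) : (D.smooth s l).2.1 = l.2.1.flip := by
  obtain ⟨c, b, e⟩ := l
  rfl

theorem smooth_crossing (s : D.State) (l : D.Leg) : (D.smooth s l).1 = l.1 := by
  obtain ⟨c, b, e⟩ := l
  rfl

theorem ccw_strand (l : D.Leg) : (D.ccw l).2.1 = l.2.1.flip := by
  obtain ⟨c, b, e⟩ := l
  cases b <;> rfl

variable {D} in
theorem IsAlternating.arc_strand (halt : D.IsAlternating) (l : D.Leg) :
    (D.arc l).2.1 = l.2.1.flip := by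
  obtain ⟨c, b, e⟩ := l
  cases e
  · have := halt (D.next.symm (c, b))
    rw [Equiv.apply_symm_apply] at this
    change (D.next.symm (c, b)).2 = b.flip
    have h := congrArg Strand.flip this
    rw [flip_flip_strand] at h
    exact h.symm
  · exact halt (c, b)

theorem cycle_arc (s : D.State) (l : D.Leg) : D.cycle s (D.arc l) = D.cycle s l :=
  congrArg Sum.inl (Quot.sound (Or.inl rfl) :
    Quot.mk (fun l l' : D.Leg => l' = D.arc l ∨ l' = D.smooth s l) l = Quot.mk _ (D.arc l)).symm

theorem cycle_smooth (s : D.State) (l : D.Leg) : D.cycle s (D.smooth s l) = D.cycle s l :=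
  congrArg Sum.inl (Quot.sound (Or.inr rfl) :
    Quot.mk (fun l l' : D.Leg => l' = D.arc l ∨ l' = D.smooth s l) l = Quot.mk _ _).symm

variable {D} in
theorem rel_of_cycle_eq {s : D.State} (F : Setoid D.Leg) (h1 : ∀ l, F l (D.arc l))
    (h2 : ∀ l, F l (D.smooth s l)) {l l' : D.Leg} (h : D.cycle s l = D.cycle s l') : F l l' := by
  have h3 := Quot.eqvGen_exact (Sum.inl_injective h)
  refine Setoid.eqvGen_le (s := F) ?_ h3
  rintro x y (rfl | rfl)
  · exact h1 x
  · exact h2 x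

/-- The points of a diagram: its legs, and one point on each crossingless component. -/
abbrev Point (_D : VirtualLinkDiagram C) : Type _ := (C × Strand × End) ⊕ Fin _D.loops

/-- The cycle of a state through a point. -/
def cycleOf (s : D.State) : D.Point → D.Cycle s
  | .inl l => D.cycle s l
  | .inr f => .inr f

theorem cycleOf_surjective (s : D.State) : Function.Surjective (D.cycleOf s) := by
  rintro (z | f)
  · induction z using Quot.ind with
    | mk l => exact ⟨.inl l, rfl⟩
  · exact ⟨.inr f, rfl⟩

/-- The partition of the points into the cycles of a state. -/
def cycleRel (s : D.State) : Setoid D.Point := Setoid.ker (D.cycleOf s)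

theorem not_cycleRel_inr {s : D.State} {f : Fin D.loops} {l : D.Leg} :
    ¬ D.cycleRel s (.inr f) (.inl l) := by
  intro h
  have : (Sum.inr f : D.Cycle s) = D.cycle s l := h
  exact absurd this (by simp [cycle])

/-- The outgoing end of the over-strand. -/
def overOut (c : C) : D.Point := .inl (c, .over, .outgoing)

/-- The incoming end of the over-strand. -/
def overIn (c : C) : D.Point := .inl (c, .over, .incoming)

/-- Both strings of a state at `c` pass through an end of the over-strand. -/
theorem cycleRel_over (s : D.State) (l : D.Leg) :
    D.cycleRel s (.inl l) (D.overOut l.1) ∨ D.cycleRel s (.inl l) (D.overIn l.1) := by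
  have hover : ∀ l : D.Leg, l.2.1 = .over →
      D.cycleRel s (.inl l) (D.overOut l.1) ∨ D.cycleRel s (.inl l) (D.overIn l.1) := by
    rintro ⟨c, b, e⟩ (rfl : b = .over)
    cases e
    · exact Or.inr (Setoid.refl' _ _)
    · exact Or.inl (Setoid.refl' _ _)
  by_cases h : l.2.1 = .over
  · exact hover l h
  · have h1 : (D.smooth s l).2.1 = .over := by
      rw [smooth_strand]
      cases hl : l.2.1
      · exact absurd hl h
      · rfl
    have h2 := hover _ h1
    rw [smooth_crossing] at h2
    have h3 : D.cycleRel s (.inl l) (.inl (D.smooth s l)) := (D.cycle_smooth s l).symm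
    exact h2.imp (Setoid.trans' _ h3) (Setoid.trans' _ h3)

theorem smooth_update_of_ne (s : D.State) {c : C} (x : Bool) {l : D.Leg} (h : l.1 ≠ c) :
    D.smooth (Function.update s c x) l = D.smooth s l := by
  obtain ⟨c', b, e⟩ := l
  have h' : c' ≠ c := h
  simp only [smooth, Function.update_of_ne h']

theorem cycleRel_le_glue_flip (s : D.State) (c : C) :
    D.cycleRel s ≤ glue (D.cycleRel (Function.update s c (!s c))) (D.overOut c) (D.overIn c) := by
  set G := glue (D.cycleRel (Function.update s c (!s c))) (D.overOut c) (D.overIn c) with hG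
  rintro (l | f) (l' | f') h
  · refine rel_of_cycle_eq (G.comap Sum.inl) (fun l => ?_) (fun l => ?_) h
    · exact Or.inl (D.cycle_arc _ l).symm
    · by_cases hc : l.1 = c
      · refine Or.inr ⟨?_, ?_⟩
        · have := D.cycleRel_over (Function.update s c (!s c)) l
          rwa [hc] at this
        · have := D.cycleRel_over (Function.update s c (!s c)) (D.smooth s l)
          rwa [smooth_crossing, hc] at this
      · rw [← D.smooth_update_of_ne s (!s c) hc]
        exact Or.inl (D.cycle_smooth _ l).symm
  · exact absurd (Setoid.symm' _ h) (D.not_cycleRel_inr)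
  · exact absurd h (D.not_cycleRel_inr)
  · have : f = f' := Sum.inr_injective (show (Sum.inr f : D.Cycle s) = Sum.inr f' from h)
    rw [this]

theorem glue_cycleRel_flip (s : D.State) (c : C) :
    glue (D.cycleRel (Function.update s c (!s c))) (D.overOut c) (D.overIn c) =
      glue (D.cycleRel s) (D.overOut c) (D.overIn c) := by
  apply le_antisymm
  · refine glue_le ?_ (glue_pair _ _ _)
    have := D.cycleRel_le_glue_flip (Function.update s c (!s c)) c
    simpa using this
  · exact glue_le (D.cycleRel_le_glue_flip s c) (glue_pair _ _ _)

/-- Running along the arc at a leg and then through the crossing at its other end. -/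
def walk (s : D.State) : Equiv.Perm D.Leg :=
  (Function.Involutive.toPerm D.arc D.arc_arc).trans
    (Function.Involutive.toPerm (D.smooth s) (D.smooth_smooth s))

theorem walk_apply (s : D.State) (l : D.Leg) : D.walk s l = D.smooth s (D.arc l) := rfl

theorem cycle_eq_of_sameCycle [Finite C] {s : D.State} {l l' : D.Leg}
    (h : (D.walk s).SameCycle l l') : D.cycle s l = D.cycle s l' := by
  obtain ⟨k, rfl⟩ := h.exists_nat_pow_eq
  induction k with
  | zero => rfl
  | succ k ih =>
    rw [pow_succ', Equiv.Perm.mul_apply, walk_apply, cycle_smooth, cycle_arc]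
    exact ih ⟨k, by rw [zpow_natCast]⟩

variable {D}

/-- In an alternating diagram every cycle runs along each arc from an under-leg to an over-leg, or
the other way around throughout, so that the cycles are the orbits of `walk` on the under-legs. -/
theorem IsAlternating.cycle_eq_iff_sameCycle [Finite C] (halt : D.IsAlternating) {s : D.State}
    {l l' : D.Leg} (hl : l.2.1 = .under) (hl' : l'.2.1 = .under) :
    D.cycle s l = D.cycle s l' ↔ (D.walk s).SameCycle l l' := by
  refine ⟨fun h => ?_, D.cycle_eq_of_sameCycle⟩
  -- a leg on the over-strand is replaced by the under-leg it is joined to at its crossing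
  let u : D.Leg → D.Leg := fun l => if l.2.1 = .under then l else D.smooth s l
  let F : Setoid D.Leg := Setoid.comap u (Equiv.Perm.SameCycle.setoid (D.walk s))
  have hF : ∀ x y, F x y ↔ (D.walk s).SameCycle (u x) (u y) := fun _ _ => Iff.rfl
  have h1 := rel_of_cycle_eq F (fun l => ?_) (fun l => ?_) h
  · rw [hF] at h1
    simpa only [u, if_pos hl, if_pos hl'] using h1
  · rw [hF]
    have h2 := halt.arc_strand l
    cases hs : l.2.1 <;> rw [hs] at h2
    · have h3 : (D.arc l).2.1 = .under := h2
      simp only [u, hs, h3, if_true, reduceCtorEq, if_false]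
      refine Equiv.Perm.SameCycle.symm ⟨1, ?_⟩
      rw [zpow_one, walk_apply, arc_arc]
    · have h3 : (D.arc l).2.1 = .over := h2
      simp only [u, hs, h3, if_true, reduceCtorEq, if_false]
      exact ⟨1, by rw [zpow_one, walk_apply]⟩
  · rw [hF]
    have h2 := D.smooth_strand s l
    cases hs : l.2.1 <;> rw [hs] at h2
    · have h3 : (D.smooth s l).2.1 = .under := h2
      simp only [u, hs, h3, if_true, reduceCtorEq, if_false]
      exact Equiv.Perm.SameCycle.refl _ _
    · have h3 : (D.smooth s l).2.1 = .over := h2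
      simp only [u, hs, h3, if_true, reduceCtorEq, if_false, smooth_smooth]
      exact Equiv.Perm.SameCycle.refl _ _

/-- There are no single cycle smoothings in an alternating diagram. -/
theorem IsAlternating.cycleRel_flip [Finite C] (halt : D.IsAlternating) (s : D.State) (c : C) :
    D.cycleRel (Function.update s c (!s c)) (D.overOut c) (D.overIn c) ↔
      ¬ D.cycleRel s (D.overOut c) (D.overIn c) := by
  set s' := Function.update s c (!s c) with hs'
  let p : D.Leg := (c, .over, .outgoing)
  let q : D.Leg := (c, .over, .incoming)
  have hflip : D.smooth s' p = D.smooth s q ∧ D.smooth s' q = D.smooth s p := by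
    by_cases h1 : D.sign c = 1 <;> cases h2 : s c <;>
      simp [p, q, smooth, hs', h1, h2, End.flip]
  have hne : D.smooth s p ≠ D.smooth s q := by
    intro h
    have := congrArg (D.smooth s) h
    rw [smooth_smooth, smooth_smooth] at this
    simp [p, q] at this
  have hp : (D.smooth s p).2.1 = .under := rfl
  have hq : (D.smooth s q).2.1 = .under := rfl
  have e1 : D.cycleRel s (D.overOut c) (D.overIn c) ↔
      (D.walk s).SameCycle (D.smooth s p) (D.smooth s q) := by
    rw [← halt.cycle_eq_iff_sameCycle hp hq, cycle_smooth, cycle_smooth]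
    exact Iff.rfl
  have e2 : D.cycleRel s' (D.overOut c) (D.overIn c) ↔
      (D.walk s').SameCycle (D.smooth s p) (D.smooth s q) := by
    rw [← halt.cycle_eq_iff_sameCycle hp hq, ← hflip.1, ← hflip.2, cycle_smooth, cycle_smooth]
    exact eq_comm
  rw [e1, e2]
  refine sameCycle_swap_iff (U := {l : D.Leg | l.2.1 = .under}) ?_ hp hne ?_
  · intro z hz
    change (D.smooth s (D.arc z)).2.1 = _
    rw [smooth_strand, halt.arc_strand, flip_flip_strand]
    exact hz
  · intro z hz
    rw [walk_apply, walk_apply]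
    have harc : (D.arc z).2.1 = .over := by
      rw [halt.arc_strand, show z.2.1 = _ from hz]; rfl
    by_cases hc : (D.arc z).1 = c
    · have : D.arc z = p ∨ D.arc z = q := by
        rcases hz' : D.arc z with ⟨c', b, e⟩
        rw [hz'] at hc harc
        obtain rfl : c' = c := hc
        obtain rfl : b = .over := harc
        cases e
        · exact Or.inr rfl
        · exact Or.inl rfl
      rcases this with h | h
      · rw [h, hflip.1, Equiv.swap_apply_left]
      · rw [h, hflip.2, Equiv.swap_apply_right]
    · rw [hs', D.smooth_update_of_ne s _ hc, Equiv.swap_apply_of_ne_of_ne]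
      · intro h
        apply hc
        rw [← D.smooth_crossing s, h]; rfl
      · intro h
        apply hc
        rw [← D.smooth_crossing s, h]; rfl

/-- The cube of resolutions of an alternating diagram. -/
def IsAlternating.cube [Finite C] (halt : D.IsAlternating) : Cube C D.Point where
  rel := D.cycleRel
  p := D.overOut
  q := D.overIn
  glue_flip := D.glue_cycleRel_flip
  rel_flip := halt.cycleRel_flip

section Transfer

theorem numClasses_cycleRel (s : D.State) : numClasses (D.cycleRel s) = Nat.card (D.Cycle s) :=
  Nat.card_congr (Setoid.quotientKerEquivOfSurjective _ (D.cycleOf_surjective s))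

variable [Finite C] (halt : D.IsAlternating)

/-- The partially resolved diagram with no smoothings is the diagram itself. -/
theorem IsConnected.numClasses_merge [Fintype C] (hconn : D.IsConnected) :
    numClasses (halt.cube.merge (fun _ => false) Finset.univ) = 1 := by
  set M := halt.cube.merge (fun _ => false) Finset.univ with hM
  have hle : D.cycleRel (fun _ => false) ≤ M := Cube.rel_le_merge (Q := halt.cube) _ _
  have hpair : ∀ c, M (D.overOut c) (D.overIn c) := fun c =>
    Cube.merge_pair (Q := halt.cube) _ (Finset.mem_univ c)
  have hleg : ∀ l : D.Leg, M (.inl l) (D.overOut l.1) := by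
    intro l
    rcases D.cycleRel_over (fun _ => false) l with h | h
    · exact hle h
    · exact Setoid.trans' _ (hle h) (Setoid.symm' _ (hpair _))
  let F : Setoid C := Setoid.comap D.overOut M
  have hF : ∀ c c' : C, (∃ b, (D.next (c, b)).1 = c') → F c c' := by
    rintro c c' ⟨b, rfl⟩
    have h1 : M (.inl (c, b, .outgoing)) (.inl (D.arc (c, b, .outgoing))) :=
      hle (D.cycle_arc _ _).symm
    exact Setoid.trans' M (Setoid.symm' _ (hleg (c, b, .outgoing)))
      (Setoid.trans' _ h1 (hleg (D.arc (c, b, .outgoing))))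
  have hsub := hconn.2
  have hall : ∀ x y : D.Point, M x y := by
    rintro (l | f) (l' | f')
    · have h1 := Quot.eqvGen_exact (Sum.inl_injective
        (hsub.elim (Sum.inl (Quot.mk _ l.1) : D.Piece) (Sum.inl (Quot.mk _ l'.1))))
      have h2 : F l.1 l'.1 := Setoid.eqvGen_le hF h1
      exact Setoid.trans' _ (hleg l) (Setoid.trans' _ h2 (Setoid.symm' _ (hleg l')))
    · have := hsub.elim (Sum.inl (Quot.mk _ l.1) : D.Piece) (Sum.inr f')
      exact absurd this (by simp)
    · have := hsub.elim (Sum.inl (Quot.mk _ l'.1) : D.Piece) (Sum.inr f)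
      exact absurd this (by simp)
    · have := Sum.inr_injective (hsub.elim (Sum.inr f : D.Piece) (Sum.inr f'))
      rw [this]
  have hne : Nonempty D.Point := by
    obtain ⟨z | f⟩ := hconn.1
    · induction z using Quot.ind with
      | mk c => exact ⟨D.overOut c⟩
    · exact ⟨.inr f⟩
  obtain ⟨x⟩ := hne
  have : Unique (Quotient M) :=
    { default := Quotient.mk M x
      uniq := fun z => by
        induction z using Quotient.ind with
        | _ y => exact Quotient.sound (hall y x) }
  exact Nat.card_unique

/-- Enhanced states, with labels on the cycles, as labelled states, with labels on the points. -/
def IsAlternating.labelledEquiv : D.Enhanced ≃ halt.cube.Labelled where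
  toFun e := ⟨e.1, fun x => e.2 (D.cycleOf e.1 x), fun x y h => congrArg e.2 h⟩
  invFun a := ⟨a.state, fun z => match z with
    | .inl z => Quot.lift (fun l => a.label (.inl l)) (by
        rintro l l' (rfl | rfl)
        · exact a.compat _ _ (D.cycle_arc _ l).symm
        · exact a.compat _ _ (D.cycle_smooth _ l).symm) z
    | .inr f => a.label (.inr f)⟩
  left_inv e := by
    refine Sigma.ext rfl (heq_of_eq (funext fun z => ?_))
    rcases z with z | f
    · induction z using Quot.ind with
      | mk l => rfl
    · rfl
  right_inv a := by
    refine Cube.Labelled.ext rfl (funext fun x => ?_)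
    rcases x with l | f <;> rfl

theorem IsAlternating.coef_labelledEquiv (c : C) (e e' : D.Enhanced) :
    halt.cube.coef c (halt.labelledEquiv e) (halt.labelledEquiv e') = D.edgeCoeff c e.2 e'.2 := by
  have hcond : (∀ x : D.Point, ¬ D.cycleRel e.1 x (D.overOut c) →
      ¬ D.cycleRel e.1 x (D.overIn c) → e.2 (D.cycleOf e.1 x) = e'.2 (D.cycleOf e'.1 x)) ↔
      ((∀ l : D.Leg, D.cycle e.1 l ≠ D.cycle e.1 (c, .over, .outgoing) →
        D.cycle e.1 l ≠ D.cycle e.1 (c, .over, .incoming) →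
        e.2 (D.cycle e.1 l) = e'.2 (D.cycle e'.1 l)) ∧
      ∀ f : Fin D.loops, e.2 (Sum.inr f) = e'.2 (Sum.inr f)) := by
    constructor
    · intro h
      exact ⟨fun l h1 h2 => h (.inl l) h1 h2,
        fun f => h (.inr f) D.not_cycleRel_inr D.not_cycleRel_inr⟩
    · rintro ⟨h1, h2⟩ (l | f)
      · exact h1 l
      · exact fun _ _ => h2 f
  unfold Cube.coef edgeCoeff
  exact if_congr hcond rfl rfl

theorem IsAlternating.deg_labelledEquiv (e : D.Enhanced) :
    halt.cube.deg (halt.labelledEquiv e) = ∑ z, (e.2 z).deg := by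
  have h : halt.cube.deg (halt.labelledEquiv e) =
      ∑ᶠ z : Quotient (D.cycleRel e.1), (e.2 (D.cycleOf e.1 z.out)).deg := rfl
  rw [h, ← finsum_eq_sum_of_fintype]
  refine finsum_eq_of_bijective (Setoid.quotientKerEquivOfSurjective _ (D.cycleOf_surjective e.1))
    (Equiv.bijective _) fun z => ?_
  conv_rhs => rw [← Quotient.out_eq z]
  rfl

end Transfer

end Smoothings

/-! ### Signatures of definite forms -/

section Definite

variable {ι : Type*}

/-- A positive definite form has signature equal to its rank. -/
theorem matrixSignature_of_pos [inst : Fintype ι] {A : Matrix ι ι ℤ}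
    (h : ∀ v : ι → ℝ, v ≠ 0 → 0 < ∑ i, ∑ j, (A i j : ℝ) * (v i * v j)) :
    Coloring.matrixSignature A = Fintype.card ι := by
  unfold Coloring.matrixSignature
  generalize Fintype.ofFinite ι = inst'
  obtain rfl : inst = inst' := Subsingleton.elim _ _
  set Q : QuadraticForm ℝ (ι → ℝ) := (A.map (fun a : ℤ => (a : ℝ))).toQuadraticForm' with hQ
  have hpos : (Q.restrict ⊤).PosDef := by
    rintro ⟨v, hv⟩ hne
    have h1 := h v fun h0 => hne (by simp [h0])
    have h2 : Q v = ∑ i, ∑ j, (A i j : ℝ) * (v i * v j) := by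
      simp only [hQ, Matrix.toQuadraticForm', LinearMap.BilinMap.toQuadraticMap_apply,
        Matrix.toLinearMap₂'_apply, smul_eq_mul, Matrix.map_apply]
      exact Finset.sum_congr rfl fun i _ => Finset.sum_congr rfl fun j _ => by ring
    change 0 < Q v
    rwa [h2]
  have h1 := le_sigPos_of_posDef Q hpos
  have h2 := QuadraticForm.sigPos_add_sigNeg_add_radical (Q := Q)
  rw [finrank_top, Module.finrank_fintype_fun_eq_card] at h1
  rw [Module.finrank_fintype_fun_eq_card] at h2
  change ((sigPos Q : ℤ) - sigNeg Q) = _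
  omega

theorem matrixSignature_of_neg [inst : Fintype ι] {A : Matrix ι ι ℤ}
    (h : ∀ v : ι → ℝ, v ≠ 0 → ∑ i, ∑ j, (A i j : ℝ) * (v i * v j) < 0) :
    Coloring.matrixSignature A = -Fintype.card ι := by
  have h1 := matrixSignature_of_pos (A := -A) fun v hv => by
    have := h v hv
    simp only [Matrix.neg_apply, Int.cast_neg, neg_mul, Finset.sum_neg_distrib]
    linarith
  rw [← h1]
  unfold Coloring.matrixSignature
  generalize Fintype.ofFinite ι = inst'
  obtain rfl : inst = inst' := Subsingleton.elim _ _
  have h2 : ((-A).map fun a : ℤ => (a : ℝ)).toQuadraticForm' =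
      -(A.map fun a : ℤ => (a : ℝ)).toQuadraticForm' := by
    have : (-A).map (fun a : ℤ => (a : ℝ)) = -A.map (fun a : ℤ => (a : ℝ)) := by
      ext i j; simp
    rw [this]
    ext v
    simp [Matrix.toQuadraticForm', Matrix.toLinearMap₂'_apply']
  simp only [h2, sigPos_neg, sigNeg_neg]
  ring

end Definite

/-! ### Checkerboard colorings of an alternating diagram -/

section Colorings

variable {C : Type*} {D : VirtualLinkDiagram C}

/-- The checkerboard coloring in which the corners to the left of the over-legs are white. -/
def IsAlternating.coloring (halt : D.IsAlternating) : D.Coloring where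
  black := Sum.elim (Quot.lift (fun l : D.Leg => decide (l.2.1 = .under)) (by
    intro l l' h
    have h1 := congrArg (fun m : D.Leg => m.2.1.flip) h
    simp only [ccw_strand, halt.arc_strand, flip_flip_strand] at h1
    rw [h1])) Prod.snd
  black_ccw l := by
    change decide ((D.ccw l).2.1 = .under) = !decide (l.2.1 = .under)
    rw [ccw_strand]
    cases l.2.1 <;> rfl
  black_loop _ := rfl

theorem IsAlternating.incidence_coloring (halt : D.IsAlternating) (c : C) :
    halt.coloring.incidence c = -1 := rfl

/-- In a coloring all of whose incidences are `-1` the corners are colored as in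
`IsAlternating.coloring`. -/
theorem Coloring.black_corner {ξ : D.Coloring} (hη : ∀ c, ξ.incidence c = -1) (l : D.Leg) :
    ξ.black (D.corner l) = decide (l.2.1 = .under) := by
  obtain ⟨c, b, e⟩ := l
  have h0 : ξ.black (D.corner (c, .over, .outgoing)) = false := by
    have := hη c
    unfold Coloring.incidence at this
    split_ifs at this with h
    simpa using h
  have h1 := ξ.black_ccw (c, .over, .outgoing)
  have h2 := ξ.black_ccw (D.ccw (c, .over, .outgoing))
  have h3 := ξ.black_ccw (D.ccw (D.ccw (c, .over, .outgoing)))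
  rw [h0] at h1
  rw [h1] at h2
  rw [h2] at h3
  by_cases hs : D.sign c = 1 <;> simp only [ccw, hs, if_true, if_false, End.flip] at h1 h2 h3 <;>
    cases b <;> cases e <;> simp [h0, h1, h2, h3]

/-- The state whose smoothings turn each leg on the strand `b` to its counterclockwise
neighbour. -/
def turn (D : VirtualLinkDiagram C) (b : Strand) : D.State := fun _ => decide (b = .over)

theorem ccw_eq_smooth_turn (l : D.Leg) : D.ccw l = D.smooth (D.turn l.2.1) l := by
  obtain ⟨c, b, e⟩ := l
  by_cases hs : D.sign c = 1 <;> cases b <;> simp [ccw, smooth, turn, Strand.flip, hs]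

theorem IsAlternating.walk_strand (halt : D.IsAlternating) (s : D.State) (l : D.Leg) :
    (D.walk s l).2.1 = l.2.1 := by
  rw [walk_apply, smooth_strand, halt.arc_strand, flip_flip_strand]

/-- The boundary of a region to the left of a leg on the strand `b` is followed by `walk`. -/
theorem IsAlternating.corner_walk (halt : D.IsAlternating) {b : Strand} {l : D.Leg}
    (hl : l.2.1 = b) :
    D.corner (D.walk (D.turn b) l) = D.corner l := by
  refine congrArg Sum.inl (Quot.sound ?_).symm
  rw [ccw_eq_smooth_turn, halt.walk_strand, hl, walk_apply, smooth_smooth]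

/-- A region to the left of legs on the strand `b` has a connected boundary, which is a cycle of
`turn b`. -/
theorem IsAlternating.cycle_eq_of_corner_eq (halt : D.IsAlternating) {b : Strand} {l l' : D.Leg}
    (hl : l.2.1 = b)
    (h : D.corner l = D.corner l') : D.cycle (D.turn b) l = D.cycle (D.turn b) l' := by
  -- the relation that generates the regions preserves strands in an alternating diagram
  let G : Setoid D.Leg :=
    { r := fun x y => x.2.1 = y.2.1 ∧ (x.2.1 = b → D.cycle (D.turn b) x = D.cycle (D.turn b) y)
      iseqv := ⟨fun _ => ⟨rfl, fun _ => rfl⟩,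
        fun h => ⟨h.1.symm, fun h' => (h.2 (h.1.trans h')).symm⟩,
        fun h h' => ⟨h.1.trans h'.1, fun h0 => (h.2 h0).trans (h'.2 (h.1.symm.trans h0))⟩⟩ }
  have h1 := Quot.eqvGen_exact (Sum.inl_injective h)
  refine (Setoid.eqvGen_le (s := G) ?_ h1).2 hl
  intro x y hxy
  have hs : x.2.1 = y.2.1 := by
    have h2 := congrArg (fun m : D.Leg => m.2.1.flip) hxy
    simpa only [ccw_strand, halt.arc_strand, flip_flip_strand] using h2.symm
  refine ⟨hs, fun hx => ?_⟩
  rw [ccw_eq_smooth_turn, ← hs, hx] at hxy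
  rw [← D.cycle_arc _ x, ← hxy, cycle_smooth]

/-- If the white corners are those to the left of the legs on the strand `b`, the white regions are
bounded by the cycles of the state `turn b`. -/
theorem IsAlternating.card_white (halt : D.IsAlternating) {b : Strand} {ξ : D.Coloring}
    (hb : ∀ l, ξ.black (D.corner l) = false ↔ l.2.1 = b) :
    Nat.card ξ.White = Nat.card (D.Cycle (D.turn b)) := by
  -- of the two legs that a cycle joins at a crossing, the one on the strand `b`
  let u : D.Leg → D.Leg := fun l => if l.2.1 = b then l else D.smooth (D.turn b) l
  have hflip : ∀ {x : Strand}, x ≠ b → x.flip = b := by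
    intro x hx
    cases x <;> cases b <;> simp_all [Strand.flip]
  have hflip' : ∀ {x : Strand}, x = b → x.flip ≠ b := by
    rintro x rfl
    cases x <;> simp [Strand.flip]
  have hu : ∀ l, (u l).2.1 = b := by
    intro l
    by_cases h : l.2.1 = b
    · simp only [u, if_pos h]
      exact h
    · simp only [u, if_neg h]
      exact hflip h
  have hcyc : ∀ l, D.cycle (D.turn b) (u l) = D.cycle (D.turn b) l := by
    intro l
    by_cases h : l.2.1 = b
    · simp only [u, if_pos h]
    · simp only [u, if_neg h, cycle_smooth]
  have hcompat : ∀ l l' : D.Leg, l' = D.arc l ∨ l' = D.smooth (D.turn b) l →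
      D.corner (u l) = D.corner (u l') := by
    rintro l l' (rfl | rfl)
    · by_cases h : l.2.1 = b
      · have h1 : (D.arc l).2.1 ≠ b := by rw [halt.arc_strand]; exact hflip' h
        simp only [u, if_pos h, if_neg h1]
        exact (halt.corner_walk h).symm
      · have h1 : (D.arc l).2.1 = b := by rw [halt.arc_strand]; exact hflip h
        simp only [u, if_neg h, if_pos h1]
        rw [← halt.corner_walk h1, walk_apply, arc_arc]
    · by_cases h : l.2.1 = b
      · have h1 : (D.smooth (D.turn b) l).2.1 ≠ b := by rw [smooth_strand]; exact hflip' h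
        simp only [u, if_pos h, if_neg h1, smooth_smooth]
      · have h1 : (D.smooth (D.turn b) l).2.1 = b := by rw [smooth_strand]; exact hflip h
        simp only [u, if_neg h, if_pos h1]
  have hloop : ∀ f : Fin D.loops, ξ.black (Sum.inr (f, !ξ.black (Sum.inr (f, true)))) = false := by
    intro f
    have h1 := ξ.black_loop f
    cases h : ξ.black (Sum.inr (f, true))
    · simpa using h
    · rw [h] at h1
      simpa using h1
  let φ : D.Cycle (D.turn b) → ξ.White := Sum.elim
    (Quot.lift (fun l => ⟨D.corner (u l), (hb _).2 (hu l)⟩)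
      fun l l' h => Subtype.ext (hcompat l l' h))
    fun f => ⟨Sum.inr (f, !ξ.black (Sum.inr (f, true))), hloop f⟩
  refine (Nat.card_eq_of_bijective φ ⟨?_, ?_⟩).symm
  · rintro (z | f) (z' | f') h
    · induction z using Quot.ind with
      | mk l =>
      induction z' using Quot.ind with
      | mk l' =>
      have h1 : D.corner (u l) = D.corner (u l') := congrArg Subtype.val h
      have h2 := halt.cycle_eq_of_corner_eq (hu l) h1
      rw [hcyc, hcyc] at h2
      exact h2
    · induction z using Quot.ind with
      | mk l =>
      have h1 : D.corner (u l) = Sum.inr (f', _) := congrArg Subtype.val h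
      exact absurd h1 (by simp [corner])
    · induction z' using Quot.ind with
      | mk l =>
      have h1 : Sum.inr (f, _) = D.corner (u l) := congrArg Subtype.val h
      exact absurd h1 (by simp [corner])
    · have h1 : (Sum.inr (f, _) : D.Region) = Sum.inr (f', _) := congrArg Subtype.val h
      exact congrArg Sum.inr (Prod.ext_iff.1 (Sum.inr_injective h1)).1
  · rintro ⟨r | ⟨f, t⟩, hr⟩
    · induction r using Quot.ind with
      | mk l =>
      have hl := (hb l).1 hr
      refine ⟨D.cycle _ l, Subtype.ext ?_⟩
      change D.corner (u l) = D.corner l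
      simp only [u, if_pos hl]
    · refine ⟨Sum.inr f, Subtype.ext ?_⟩
      change (Sum.inr (f, !ξ.black (Sum.inr (f, true))) : D.Region) = Sum.inr (f, t)
      cases t
      · rw [ξ.black_loop, hr]; rfl
      · rw [hr]; rfl

/-- Two white regions can be joined by a path of white regions and crossings. -/
theorem IsAlternating.eq_of_adjacent (halt : D.IsAlternating) {b : Strand} {ξ : D.Coloring}
    (hb : ∀ l, ξ.black (D.corner l) = false ↔ l.2.1 = b) (hconn : D.IsConnected) {α : Type*}
    (f : ξ.White → α)
    (hf : ∀ c x y, Coloring.Adjacent D c x.1 → Coloring.Adjacent D c y.1 → f x = f y)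
    (x y : ξ.White) : f x = f y := by
  let h : C → α := fun c => f ⟨D.corner (c, b, .outgoing), (hb _).2 rfl⟩
  have hh : ∀ (l : D.Leg) (hl : ξ.black (D.corner l) = false), f ⟨D.corner l, hl⟩ = h l.1 :=
    fun l _ => hf l.1 _ _ ⟨_, _, rfl⟩ ⟨_, _, rfl⟩
  have harc : ∀ l : D.Leg, l.2.1 = b → h l.1 = h (D.arc l).1 := by
    intro l hl
    have h1 : (D.walk (D.turn b) l).2.1 = b := by rw [halt.walk_strand, hl]
    rw [← hh l ((hb l).2 hl), ← D.smooth_crossing (D.turn b) (D.arc l), ← walk_apply,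
      ← hh _ ((hb _).2 h1)]
    congr 2
    exact (halt.corner_walk hl).symm
  have hstep : ∀ c c' : C, (∃ b, (D.next (c, b)).1 = c') → (Setoid.ker h) c c' := by
    rintro c c' ⟨b', rfl⟩
    change h c = h (D.arc (c, b', .outgoing)).1
    by_cases hb' : b' = b
    · exact harc (c, b', .outgoing) hb'
    · have h1 := harc (D.arc (c, b', .outgoing)) (by
        rw [halt.arc_strand]
        cases b' <;> cases b <;> simp_all [Strand.flip])
      rw [arc_arc] at h1
      exact h1.symm
  have hsub := hconn.2
  obtain ⟨r | ⟨i, t⟩, hr⟩ := x <;> obtain ⟨r' | ⟨i', t'⟩, hr'⟩ := y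
  · induction r using Quot.ind with
    | mk l =>
    induction r' using Quot.ind with
    | mk l' =>
    have h1 := Quot.eqvGen_exact (Sum.inl_injective
      (hsub.elim (Sum.inl (Quot.mk _ l.1) : D.Piece) (Sum.inl (Quot.mk _ l'.1))))
    have h2 : h l.1 = h l'.1 := Setoid.eqvGen_le hstep h1
    exact (hh l hr).trans (h2.trans (hh l' hr').symm)
  · induction r using Quot.ind with
    | mk l => exact absurd (hsub.elim (Sum.inl (Quot.mk _ l.1) : D.Piece) (Sum.inr i')) (by simp)
  · induction r' using Quot.ind with
    | mk l => exact absurd (hsub.elim (Sum.inl (Quot.mk _ l.1) : D.Piece) (Sum.inr i)) (by simp)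
  · obtain rfl : i = i' := Sum.inr_injective (hsub.elim (Sum.inr i : D.Piece) (Sum.inr i'))
    have := ξ.black_loop i
    obtain rfl : t = t' := by
      cases t <;> cases t' <;> simp_all
    rfl

theorem Coloring.dual_incidence (ξ : D.Coloring) (c : C) : ξ.dual.incidence c = -ξ.incidence c := by
  unfold Coloring.incidence Coloring.dual
  cases h : ξ.black (D.corner (c, .over, .outgoing)) <;> simp [h]

theorem Coloring.white_iff {ξ : D.Coloring} (hη : ∀ c, ξ.incidence c = -1) (l : D.Leg) :
    ξ.black (D.corner l) = false ↔ l.2.1 = .over := by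
  rw [black_corner hη]
  cases l.2.1 <;> simp

theorem Coloring.dual_white_iff {ξ : D.Coloring} (hη : ∀ c, ξ.incidence c = -1) (l : D.Leg) :
    ξ.dual.black (D.corner l) = false ↔ l.2.1 = .under := by
  change (!ξ.black (D.corner l)) = false ↔ _
  rw [black_corner hη]
  cases l.2.1 <;> simp

theorem IsConnected.nonempty_white (hconn : D.IsConnected) {b : Strand} {ξ : D.Coloring}
    (hb : ∀ l, ξ.black (D.corner l) = false ↔ l.2.1 = b) : Nonempty ξ.White := by
  obtain ⟨z | f⟩ := hconn.1
  · induction z using Quot.ind with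
    | mk c => exact ⟨⟨D.corner (c, b, .outgoing), (hb _).2 rfl⟩⟩
  · have h1 := ξ.black_loop f
    cases h : ξ.black (Sum.inr (f, false))
    · exact ⟨⟨_, h⟩⟩
    · rw [h] at h1
      exact ⟨⟨_, h1⟩⟩

end Colorings

/-! ### Goeritz matrices -/

section Goeritz

/-- The quadratic form of a weighted graph Laplacian is a weighted sum of squared differences. -/
theorem sum_laplacian {W : Type*} [Fintype W] (a : W → W → ℝ) (ha : ∀ x y, a x y = a y x)
    (f : W → ℝ) :
    ∑ x, ∑ y, (if x = y then -∑ z with z ≠ x, a x z else a x y) * (f x * f y) =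
      -(1 / 2) * ∑ x, ∑ y, a x y * (f x - f y) ^ 2 := by
  have h1 : ∀ x, ∑ y, (if x = y then -∑ z with z ≠ x, a x z else a x y) * (f x * f y) =
      ∑ y, a x y * (f x * f y - f x * f x) := by
    intro x
    rw [Fintype.sum_eq_add_sum_subtype_ne _ x, Fintype.sum_eq_add_sum_subtype_ne _ x, if_pos rfl,
      sub_self, mul_zero, zero_add]
    have h2 : ∑ z with z ≠ x, a x z = ∑ z : {z // z ≠ x}, a x z :=
      Finset.sum_subtype _ (by simp) _
    rw [h2, neg_mul, Finset.sum_mul, ← Finset.sum_neg_distrib, ← Finset.sum_add_distrib]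
    refine Finset.sum_congr rfl fun y _ => ?_
    rw [if_neg (Ne.symm y.2)]
    ring
  have h3 : ∑ x, ∑ y, a x y * (f x * f y - f x * f x) =
      ∑ x, ∑ y, a x y * (f x * f y - f y * f y) := by
    rw [Finset.sum_comm]
    refine Finset.sum_congr rfl fun x _ => Finset.sum_congr rfl fun y _ => ?_
    rw [ha]
    ring
  have h4 : ∑ x, ∑ y, a x y * (f x - f y) ^ 2 =
      -(∑ x, ∑ y, a x y * (f x * f y - f x * f x)) -
        ∑ x, ∑ y, a x y * (f x * f y - f y * f y) := by
    simp only [← Finset.sum_neg_distrib, ← Finset.sum_sub_distrib]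
    refine Finset.sum_congr rfl fun x _ => Finset.sum_congr rfl fun y _ => ?_
    ring
  rw [Finset.sum_congr rfl fun x _ => h1 x, h4, ← h3]
  ring

variable {C : Type*} [Fintype C] {D : VirtualLinkDiagram C}

/-- The number of crossings adjacent to two white regions. -/
noncomputable def Coloring.common (ξ : D.Coloring) (x y : ξ.White) : ℕ :=
  (Finset.univ.filter fun c => Adjacent D c x.1 ∧ Adjacent D c y.1).card

theorem Coloring.common_comm (ξ : D.Coloring) (x y : ξ.White) : ξ.common x y = ξ.common y x := by
  unfold Coloring.common
  congr 1
  ext c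
  simp [and_comm]

theorem Coloring.goeritzEntry_eq {ξ : D.Coloring} {η : ℤ} (hη : ∀ c, ξ.incidence c = η)
    (x y : ξ.White) : ξ.goeritzEntry x y = -(η * ξ.common x y) := by
  unfold Coloring.goeritzEntry Coloring.common
  rw [Finset.sum_congr rfl fun c _ => hη c, Finset.sum_const, nsmul_eq_mul, mul_comm]

/-- If all incidences are equal to `η`, the Goeritz form is `η / 2` times a sum of squares. -/
theorem Coloring.sum_goeritz {ξ : D.Coloring} {η : ℤ} (hη : ∀ c, ξ.incidence c = η) (x₀ : ξ.White)
    (f : ξ.White → ℝ) (hf : f x₀ = 0) :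
    ∑ x : {x // x ≠ x₀}, ∑ y : {x // x ≠ x₀}, (ξ.goeritz x₀ x y : ℝ) * (f x * f y) =
      η * (1 / 2 * ∑ x, ∑ y, (ξ.common x y : ℝ) * (f x - f y) ^ 2) := by
  have h1 : ∑ x, ∑ y, (ξ.preGoeritz x y : ℝ) * (f x * f y) =
      ∑ x : {x // x ≠ x₀}, ∑ y : {x // x ≠ x₀}, (ξ.goeritz x₀ x y : ℝ) * (f x * f y) := by
    rw [Fintype.sum_eq_add_sum_subtype_ne _ x₀]
    simp only [hf, zero_mul, mul_zero, Finset.sum_const_zero, zero_add]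
    refine Finset.sum_congr rfl fun x _ => ?_
    rw [Fintype.sum_eq_add_sum_subtype_ne _ x₀, hf, mul_zero, mul_zero, zero_add]
    rfl
  rw [← h1]
  have h2 := sum_laplacian (fun x y => (ξ.goeritzEntry x y : ℝ))
    (fun x y => by rw [goeritzEntry_eq hη, goeritzEntry_eq hη, ξ.common_comm]) f
  have h3 : ∀ x y, (ξ.preGoeritz x y : ℝ) =
      if x = y then -∑ z with z ≠ x, (ξ.goeritzEntry x z : ℝ) else (ξ.goeritzEntry x y : ℝ) := by
    intro x y
    unfold Coloring.preGoeritz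
    split_ifs <;> push_cast <;> rfl
  simp only [h3]
  rw [h2]
  simp only [goeritzEntry_eq hη, Finset.mul_sum]
  refine Finset.sum_congr rfl fun x _ => Finset.sum_congr rfl fun y _ => ?_
  push_cast
  ring

/-- Because the diagram is connected, the sum of squares vanishes on constant functions only. -/
theorem IsAlternating.sum_common_pos (halt : D.IsAlternating) {b : Strand} {ξ : D.Coloring}
    (hb : ∀ l, ξ.black (D.corner l) = false ↔ l.2.1 = b) (hconn : D.IsConnected)
    {f : ξ.White → ℝ} {x y : ξ.White} (hxy : f x ≠ f y) :
    0 < ∑ x, ∑ y, (ξ.common x y : ℝ) * (f x - f y) ^ 2 := by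
  have hnn : ∀ x y, 0 ≤ (ξ.common x y : ℝ) * (f x - f y) ^ 2 := fun x y => by positivity
  refine lt_of_le_of_ne (Finset.sum_nonneg fun x _ => Finset.sum_nonneg fun y _ => hnn x y) ?_
  intro h0
  refine hxy (halt.eq_of_adjacent hb hconn f (fun c x y hx hy => ?_) x y)
  have h1 := (Finset.sum_eq_zero_iff_of_nonneg fun x _ =>
    Finset.sum_nonneg fun y _ => hnn x y).1 h0.symm x (Finset.mem_univ _)
  have h2 := (Finset.sum_eq_zero_iff_of_nonneg fun y _ => hnn x y).1 h1 y (Finset.mem_univ _)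
  have h3 : (ξ.common x y : ℝ) ≠ 0 := by
    rw [Nat.cast_ne_zero]
    exact Finset.card_ne_zero_of_mem (Finset.mem_filter.2 ⟨Finset.mem_univ c, hx, hy⟩)
  have h4 := (mul_eq_zero.1 h2).resolve_left h3
  exact sub_eq_zero.1 (pow_eq_zero_iff two_ne_zero |>.1 h4)

/-- The Goeritz matrix is definite if all incidences are equal. -/
theorem IsAlternating.matrixSignature_goeritz (halt : D.IsAlternating) {b : Strand}
    {ξ : D.Coloring} (hb : ∀ l, ξ.black (D.corner l) = false ↔ l.2.1 = b) (hconn : D.IsConnected)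
    {η : ℤ} (hη : ∀ c, ξ.incidence c = η) (h1 : η = 1 ∨ η = -1) (x₀ : ξ.White) :
    Coloring.matrixSignature (ξ.goeritz x₀) = η * ((Nat.card ξ.White : ℤ) - 1) := by
  have hcard : (Fintype.card {x : ξ.White // x ≠ x₀} : ℤ) = (Nat.card ξ.White : ℤ) - 1 := by
    have : Fintype.card {x : ξ.White // x ≠ x₀} = Fintype.card ξ.White - 1 := by
      simp
    have h0 : 0 < Fintype.card ξ.White := Fintype.card_pos_iff.2 ⟨x₀⟩
    rw [this, Nat.card_eq_fintype_card]
    omega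
  have key : ∀ v : {x : ξ.White // x ≠ x₀} → ℝ, v ≠ 0 → ∃ r : ℝ, 0 < r ∧
      ∑ x, ∑ y, (ξ.goeritz x₀ x y : ℝ) * (v x * v y) = η * r := by
    intro v hv
    obtain ⟨x, hx⟩ := Function.ne_iff.1 hv
    -- a vector on the remaining white regions, extended by zero to the removed one
    let f : ξ.White → ℝ := fun x => if h : x ≠ x₀ then v ⟨x, h⟩ else 0
    have hf0 : f x₀ = 0 := by simp [f]
    have hf : ∀ x : {x : ξ.White // x ≠ x₀}, f x = v x := fun x => by simp [f, x.2]
    refine ⟨_, mul_pos (by norm_num : (0 : ℝ) < 1 / 2)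
      (halt.sum_common_pos hb hconn (f := f) (x := x.1) (y := x₀) ?_), ?_⟩
    · rw [hf, hf0]
      exact hx
    · rw [← Coloring.sum_goeritz hη x₀ f hf0]
      simp only [hf]
  rcases h1 with rfl | rfl
  · rw [matrixSignature_of_pos, hcard, one_mul]
    intro v hv
    obtain ⟨r, hr, h⟩ := key v hv
    rw [h]
    simpa using hr
  · rw [matrixSignature_of_neg, hcard, neg_mul, one_mul]
    intro v hv
    obtain ⟨r, hr, h⟩ := key v hv
    rw [h]
    simpa using hr

theorem nPos_add_nNeg (D : VirtualLinkDiagram C) : D.nPos + D.nNeg = Fintype.card C := by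
  have h : (Finset.univ.filter fun c => D.sign c = -1) =
      Finset.univ.filter fun c => ¬ D.sign c = 1 := by
    refine Finset.filter_congr fun c _ => ?_
    rcases Int.units_eq_one_or (D.sign c) with h | h <;> rw [h] <;> decide
  unfold nPos nNeg
  rw [h, Finset.card_filter_add_card_filter_not]
  rfl

theorem Coloring.correction_eq {ξ : D.Coloring} (hη : ∀ c, ξ.incidence c = -1) :
    ξ.correction = -D.nNeg := by
  unfold Coloring.correction nNeg
  rw [Finset.sum_congr rfl fun c _ => hη c, Finset.sum_const, nsmul_eq_mul, mul_neg_one]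
  congr 3
  refine Finset.filter_congr fun c _ => ?_
  rw [hη]
  rcases Int.units_eq_one_or (D.sign c) with h | h <;> rw [h] <;> decide

theorem Coloring.dual_correction_eq {ξ : D.Coloring} (hη : ∀ c, ξ.incidence c = -1) :
    ξ.dual.correction = D.nPos := by
  have hη' : ∀ c, ξ.dual.incidence c = 1 := fun c => by rw [dual_incidence, hη]; rfl
  unfold Coloring.correction nPos
  rw [Finset.sum_congr rfl fun c _ => hη' c, Finset.sum_const, nsmul_eq_mul, mul_one]
  congr 2
  refine Finset.filter_congr fun c _ => ?_
  rw [hη']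
  rcases Int.units_eq_one_or (D.sign c) with h | h <;> rw [h] <;> decide

/-- The signature of the coloring with incidences `-1` in terms of the cycles of the state in which
all smoothings are `1`-smoothings. -/
theorem IsAlternating.signature_eq (halt : D.IsAlternating) (hconn : D.IsConnected)
    {ξ : D.Coloring} (hη : ∀ c, ξ.incidence c = -1) (x₀ : ξ.White) :
    ξ.signature x₀ = 1 - numClasses (D.cycleRel fun _ => true) + D.nNeg := by
  have h1 := halt.card_white (Coloring.white_iff hη)
  have h2 := halt.matrixSignature_goeritz (Coloring.white_iff hη) hconn hη (Or.inr rfl) x₀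
  rw [Coloring.signature, h2, Coloring.correction_eq hη, h1, ← numClasses_cycleRel]
  have h3 : D.turn .over = fun _ => true := rfl
  rw [h3]
  ring

/-- The signature of the dual coloring in terms of the cycles of the state in which all smoothings
are `0`-smoothings. -/
theorem IsAlternating.dual_signature_eq (halt : D.IsAlternating) (hconn : D.IsConnected)
    {ξ : D.Coloring} (hη : ∀ c, ξ.incidence c = -1) (y₀ : ξ.dual.White) :
    ξ.dual.signature y₀ = numClasses (D.cycleRel fun _ => false) - 1 - D.nPos := by
  have hη' : ∀ c, ξ.dual.incidence c = 1 := fun c => by rw [Coloring.dual_incidence, hη]; rfl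
  have h1 := halt.card_white (Coloring.dual_white_iff hη)
  have h2 := halt.matrixSignature_goeritz (Coloring.dual_white_iff hη) hconn hη' (Or.inl rfl) y₀
  rw [Coloring.signature, h2, Coloring.dual_correction_eq hη, h1, ← numClasses_cycleRel]
  have h3 : D.turn .under = fun _ => false := rfl
  rw [h3]
  ring

theorem Coloring.card_region (ξ : D.Coloring) :
    Nat.card D.Region = Nat.card ξ.White + Nat.card ξ.dual.White := by
  have : Finite D.Region := by unfold Region; infer_instance
  let := Fintype.ofFinite D.Region
  have h1 : Nat.card ξ.White = (Finset.univ.filter fun r => ξ.black r = false).card := by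
    rw [← Fintype.card_subtype, ← Nat.card_eq_fintype_card]; rfl
  have h2 : Nat.card ξ.dual.White = (Finset.univ.filter fun r => ¬ ξ.black r = false).card := by
    rw [← Fintype.card_subtype, ← Nat.card_eq_fintype_card]
    refine Nat.card_congr (Equiv.subtypeEquivRight fun r => ?_)
    change (!ξ.black r) = false ↔ _
    cases ξ.black r <;> simp
  rw [h1, h2, Finset.card_filter_add_card_filter_not, Nat.card_eq_fintype_card]
  rfl

end Goeritz

/-! ### Parity of the diagonal degree -/

section Parity

variable {C L : Type*} [Finite L] {Q : Cube C L}

/-- Each step changes the number of cycles by one. -/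
theorem Cube.even_numClasses_add_ht [Fintype C] (n : ℕ) : ∀ s : C → Bool, Cube.ht s = n →
    Even ((numClasses (Q.rel s) : ℤ) + n - numClasses (Q.rel fun _ => false)) := by
  induction n with
  | zero =>
    intro s hs
    obtain rfl : s = fun _ => false := by
      funext c
      have := Finset.card_eq_zero.1 hs
      by_contra h
      have h1 : c ∈ Finset.univ.filter fun c => s c = true := by simpa using h
      rw [this] at h1
      simp at h1
    simp
  | succ n ih =>
    intro s hs
    obtain ⟨c, hc⟩ : ∃ c, s c = true := by
      have : 0 < Cube.ht s := by omega
      obtain ⟨c, hc⟩ := Finset.card_pos.1 this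
      exact ⟨c, (Finset.mem_filter.1 hc).2⟩
    have hstep : Cube.Step c (Function.update s c false) s :=
      ⟨by simp, by simp [← hc]⟩
    have h1 := ih (Function.update s c false) (by have := hstep.ht_eq; omega)
    have h2 : (numClasses (Q.rel s) : ℤ) = numClasses (Q.rel (Function.update s c false)) + 1 ∨
        (numClasses (Q.rel (Function.update s c false)) : ℤ) = numClasses (Q.rel s) + 1 := by
      by_cases h : Q.rel (Function.update s c false) (Q.p c) (Q.q c)
      · left
        rw [numClasses_glue fun h' => hstep.rel_iff.1 h' h, ← hstep.rel_eq_glue' h]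
        push_cast; ring
      · right
        rw [numClasses_glue h, ← hstep.rel_eq_glue h]
        push_cast; ring
    rw [Int.even_iff] at h1 ⊢
    push_cast
    omega

/-- Each cycle contributes `1` or `-1` to the degree. -/
theorem Cube.even_deg_sub (a : Q.Labelled) :
    Even (Q.deg a - numClasses (Q.rel a.state)) := by
  have : Fintype (Quotient (Q.rel a.state)) := Fintype.ofFinite _
  rw [← classSum_one]
  unfold Cube.deg classSum
  rw [finsum_eq_sum_of_fintype, finsum_eq_sum_of_fintype, ← Finset.sum_sub_distrib]
  refine Finset.even_sum _ fun z _ => ?_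
  cases h : a.label z.out <;> simp [h, Gen.deg]

/-- The parity of the diagonal degree is constant. -/
theorem Cube.even_gr_sub [Fintype C] (a : Q.Labelled) :
    Even (Q.gr a - numClasses (Q.rel fun _ => false)) := by
  have h1 := Cube.even_deg_sub a
  have h2 := Cube.even_numClasses_add_ht (Q := Q) _ a.state rfl
  unfold Cube.gr
  rw [Int.even_iff] at *
  omega

end Parity

/-! ### The supporting genus -/

section Genus

variable {C : Type*} [Fintype C] {D : VirtualLinkDiagram C}

/-- The white and black regions are the cycles of the two extreme states, so that the genus is
expressed by their numbers.  That `χ` is even and at most `2` is a property of the cube, and it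
makes the truncated quotient in `supportingGenus` exact. -/
theorem IsAlternating.two_mul_supportingGenus (halt : D.IsAlternating) (hconn : D.IsConnected)
    {ξ : D.Coloring} (hη : ∀ c, ξ.incidence c = -1) :
    2 * (D.supportingGenus : ℤ) = Fintype.card C + 2 - numClasses (D.cycleRel fun _ => false) -
      numClasses (D.cycleRel fun _ => true) := by
  have h1 : Nat.card ξ.White = numClasses (D.cycleRel fun _ => true) := by
    rw [halt.card_white (Coloring.white_iff hη), numClasses_cycleRel]; rfl
  have h2 : Nat.card ξ.dual.White = numClasses (D.cycleRel fun _ => false) := by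
    rw [halt.card_white (Coloring.dual_white_iff hη), numClasses_cycleRel]; rfl
  have h3 := ξ.card_region
  have h4 := halt.cube.numClasses_add_le _ Finset.univ (fun _ => false) (fun _ => true) rfl
    (fun _ _ => rfl) fun c => by simp
  rw [hconn.numClasses_merge halt] at h4
  change numClasses (D.cycleRel _) + numClasses (D.cycleRel _) ≤ _ at h4
  have h5 := Cube.even_numClasses_add_ht (Q := halt.cube) _ (fun _ => true) rfl
  have h6 : Cube.ht (fun _ : C => true) = Fintype.card C := by simp [Cube.ht]
  change Even ((numClasses (D.cycleRel _) : ℤ) + _ - numClasses (D.cycleRel _)) at h5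
  rw [h6, Int.even_iff] at h5
  rw [Finset.card_univ] at h4
  unfold supportingGenus eulerChar
  rw [h3, h1, h2, Nat.card_eq_fintype_card]
  push_cast
  omega

end Genus

/-! ### The support of the homology -/

section Homology

variable {C : Type*} [Fintype C] {D : VirtualLinkDiagram C}

/-- The matrix of the differential in terms of the cube of resolutions. -/
noncomputable def IsAlternating.diffMatrix (halt : D.IsAlternating) (ε : D.EdgeSigns) :
    Matrix D.Enhanced D.Enhanced ℚ :=
  fun e' e => halt.cube.diff ε (halt.labelledEquiv e') (halt.labelledEquiv e)

theorem IsAlternating.differential_eq (halt : D.IsAlternating) (ε : D.EdgeSigns) :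
    D.differential ε = (halt.diffMatrix ε).mulVecLin := by
  unfold differential
  congr 1
  ext e' e
  rw [Matrix.of_apply]
  unfold IsAlternating.diffMatrix Cube.diff
  refine Finset.sum_congr ?_ fun c _ => ?_
  · ext c
    simp only [Finset.mem_filter, Finset.mem_univ, true_and]
    exact Iff.rfl
  · rw [halt.coef_labelledEquiv]
    rfl

theorem IsAlternating.differential_apply (halt : D.IsAlternating) (ε : D.EdgeSigns)
    (y : D.Enhanced → ℚ) (e' : D.Enhanced) :
    D.differential ε y e' = ∑ e, halt.diffMatrix ε e' e * y e := by
  rw [halt.differential_eq]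
  rfl

theorem IsAlternating.differential_comp_self_eq_zero_iff (halt : D.IsAlternating)
    (ε : D.EdgeSigns) :
    D.differential ε ∘ₗ D.differential ε = 0 ↔
      ∀ a b, ∑ m, halt.cube.diff ε b m * halt.cube.diff ε m a = 0 := by
  have h1 : ∀ e e', (halt.diffMatrix ε * halt.diffMatrix ε) e' e =
      ∑ m, halt.cube.diff ε (halt.labelledEquiv e') m *
        halt.cube.diff ε m (halt.labelledEquiv e) := by
    intro e e'
    rw [Matrix.mul_apply, ← halt.labelledEquiv.sum_comp]
    rfl
  rw [halt.differential_eq, ← Matrix.mulVecLin_mul]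
  constructor
  · intro h a b
    obtain ⟨e, rfl⟩ := halt.labelledEquiv.surjective a
    obtain ⟨e', rfl⟩ := halt.labelledEquiv.surjective b
    have h2 := congrFun (LinearMap.congr_fun h (Pi.single e 1)) e'
    rw [Matrix.mulVecLin_apply, Matrix.mulVec_single_one] at h2
    rw [← h1]
    exact h2
  · intro h
    have h2 : halt.diffMatrix ε * halt.diffMatrix ε = 0 := by
      ext e' e
      rw [h1, h]
      rfl
    rw [h2, Matrix.mulVecLin_zero]

theorem IsAlternating.gr_labelledEquiv (halt : D.IsAlternating) (e : D.Enhanced) :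
    halt.cube.gr (halt.labelledEquiv e) = D.qDeg e - 2 * D.homDeg e - D.nPos := by
  have h : Cube.ht (halt.labelledEquiv e).state = D.height e.1 := by
    unfold Cube.ht height
    congr 1
  unfold Cube.gr qDeg homDeg
  rw [halt.deg_labelledEquiv, h]
  ring

/-- The differential has bidegree `(1, 0)`. -/
theorem IsAlternating.bidegree_of_diffMatrix_ne_zero (halt : D.IsAlternating)
    {ε : D.EdgeSigns} {e e' : D.Enhanced}
    (h : halt.diffMatrix ε e' e ≠ 0) :
    D.homDeg e' = D.homDeg e + 1 ∧ D.qDeg e' = D.qDeg e := by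
  have h3 := Cube.gr_of_diff_ne_zero h
  rw [halt.gr_labelledEquiv, halt.gr_labelledEquiv] at h3
  obtain ⟨c, hc, -⟩ := Cube.exists_step_of_diff_ne_zero h
  have h1 := hc.ht_eq
  have h2 : ∀ e : D.Enhanced, Cube.ht (halt.labelledEquiv e).state = D.height e.1 := by
    intro e
    unfold Cube.ht height
    congr 1
  rw [h2, h2] at h1
  have h4 : D.homDeg e' = D.homDeg e + 1 := by
    unfold homDeg
    rw [h1]
    push_cast
    ring
  exact ⟨h4, by omega⟩

/-- A preimage under the differential can be chosen homogeneous. -/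
theorem IsAlternating.mem_coboundaries (halt : D.IsAlternating) {ε : D.EdgeSigns}
    {i j : ℤ} {x y : D.Enhanced → ℚ}
    (hx : x ∈ D.chains i j) (h : D.differential ε y = x) : x ∈ D.coboundaries ε i j := by
  refine ⟨fun e => if D.homDeg e = i - 1 ∧ D.qDeg e = j then y e else 0, fun e he => ?_, ?_⟩
  · by_contra hcon
    exact he (if_neg hcon)
  · funext e'
    have h' := congrFun h e'
    rw [halt.differential_apply] at h' ⊢
    by_cases he' : D.homDeg e' = i ∧ D.qDeg e' = j
    · rw [← h']
      refine Finset.sum_congr rfl fun e _ => ?_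
      by_cases h0 : halt.diffMatrix ε e' e = 0
      · rw [h0, zero_mul, zero_mul]
      · have h1 := halt.bidegree_of_diffMatrix_ne_zero h0
        rw [if_pos ⟨by omega, by omega⟩]
    · have h2 : x e' = 0 := by
        by_contra hne
        exact he' (hx e' hne)
      rw [h2]
      refine Finset.sum_eq_zero fun e _ => ?_
      by_cases h0 : halt.diffMatrix ε e' e = 0
      · rw [h0, zero_mul]
      · have h1 := halt.bidegree_of_diffMatrix_ne_zero h0
        rw [if_neg (fun h3 => he' ⟨by omega, by omega⟩), mul_zero]

/-- In the diagonal degree of a nontrivial homology class the complex is not exact. -/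
theorem IsAlternating.not_exactOn (halt : D.IsAlternating) {ε : D.EdgeSigns}
    {i j : ℤ} {x : D.Enhanced → ℚ}
    (hx : x ∈ D.cocycles ε i j) (hx' : x ∉ D.coboundaries ε i j) :
    ¬ ExactOn (halt.cube.diff ε) halt.cube.gr Set.univ (j - 2 * i - D.nPos) := by
  intro hex
  obtain ⟨hker, hch⟩ := hx
  have happ : ∀ (z : halt.cube.Labelled → ℚ) (e' : D.Enhanced),
      D.differential ε (fun e => z (halt.labelledEquiv e)) e' =
        ∑ a, halt.cube.diff ε (halt.labelledEquiv e') a * z a := by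
    intro z e'
    rw [halt.differential_apply, ← halt.labelledEquiv.sum_comp]
    rfl
  let φ := halt.labelledEquiv
  have hxφ : (fun e => (fun a => x (φ.symm a)) (φ e)) = x := by
    funext e
    simp
  obtain ⟨y, -, hy⟩ := hex (fun a => x (φ.symm a)) (fun b hb => ⟨Set.mem_univ _, by
      have h1 := hch _ hb
      rw [← φ.apply_symm_apply b, halt.gr_labelledEquiv, h1.1, h1.2]⟩) (fun b _ => by
      have h1 := happ (fun a => x (φ.symm a)) (φ.symm b)
      rw [hxφ, show D.differential ε x = 0 from hker] at h1
      rw [← φ.apply_symm_apply b]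
      exact h1.symm)
  refine hx' (halt.mem_coboundaries hch (y := fun e => y (φ e)) (funext fun e' => ?_))
  rw [happ, hy _ (Set.mem_univ _), φ.symm_apply_apply]

theorem exists_of_nontrivial_Kh {ε : D.EdgeSigns} {i j : ℤ} (h : Nontrivial (D.Kh ε i j)) :
    ∃ x ∈ D.cocycles ε i j, x ∉ D.coboundaries ε i j := by
  by_contra hcon
  push Not at hcon
  have h1 : (D.coboundaries ε i j).submoduleOf (D.cocycles ε i j) = ⊤ :=
    Submodule.eq_top_iff'.2 fun x => hcon x.1 x.2
  exact Submodule.Quotient.nontrivial_iff.1 h h1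

/-- The homology lives in diagonal degrees between `k₁ - n - 2` and `2 - k₀`, where `k₀` and `k₁`
are the numbers of cycles of the two extreme states, and of the parity of `k₀`. -/
theorem IsAlternating.diagonal_bounds (halt : D.IsAlternating) (hconn : D.IsConnected)
    {ε : D.EdgeSigns}
    (hε : D.differential ε ∘ₗ D.differential ε = 0) {i j : ℤ} (h : Nontrivial (D.Kh ε i j)) :
    j - 2 * i - D.nPos ≤ 2 - numClasses (D.cycleRel fun _ => false) ∧
    (numClasses (D.cycleRel fun _ => true) : ℤ) - Fintype.card C - 2 ≤ j - 2 * i - D.nPos ∧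
    Even (j - 2 * i - D.nPos - numClasses (D.cycleRel fun _ => false)) := by
  obtain ⟨x, hx, hx'⟩ := exists_of_nontrivial_Kh h
  have hd := (halt.differential_comp_self_eq_zero_iff ε).1 hε
  have hex := halt.not_exactOn hx hx'
  refine ⟨?_, ?_, ?_⟩
  · by_contra hlt
    exact hex (Cube.exactOn_univ hd (hconn.numClasses_merge halt) (not_le.1 hlt))
  · by_contra hlt
    exact hex (Cube.exactOn_univ_of_lt hd (hconn.numClasses_merge halt) (not_le.1 hlt))
  · obtain ⟨e, he⟩ : ∃ e, x e ≠ 0 := by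
      by_contra h0
      push Not at h0
      obtain rfl : x = 0 := funext h0
      exact hx' (Submodule.zero_mem _)
    have h1 := hx.2 e he
    have h2 := Cube.even_gr_sub (halt.labelledEquiv e)
    rw [halt.gr_labelledEquiv, h1.1, h1.2] at h2
    exact h2

end Homology

end VirtualLinkDiagram

theorem mainTheorem1 {C : Type*} [Fintype C] [LinearOrder C] (D : VirtualLinkDiagram C)
    (hconn : D.IsConnected) (halt : D.IsAlternating) :
    (∃ ξ : D.Coloring, (∀ c, ξ.incidence c = -1) ∧ Nonempty ξ.White ∧ Nonempty ξ.dual.White) ∧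
    D.differential D.standardSigns ∘ₗ D.differential D.standardSigns = 0 ∧
    ∀ ξ : D.Coloring, (∀ c, ξ.incidence c = -1) → ∀ (x₀ : ξ.White) (y₀ : ξ.dual.White),
      ξ.signature x₀ = ξ.dual.signature y₀ + 2 * (D.supportingGenus : ℤ) ∧
      ∀ ε : D.EdgeSigns, D.differential ε ∘ₗ D.differential ε = 0 →
        ∀ i j : ℤ, Nontrivial (D.Kh ε i j) →
          ∃ k : ℕ, k ≤ D.supportingGenus + 1 ∧
            j = 2 * i - ξ.dual.signature y₀ + 1 - 2 * (k : ℤ) := by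
  refine ⟨⟨halt.coloring, halt.incidence_coloring,
    hconn.nonempty_white (VirtualLinkDiagram.Coloring.white_iff halt.incidence_coloring),
    hconn.nonempty_white (VirtualLinkDiagram.Coloring.dual_white_iff halt.incidence_coloring)⟩,
    ?_, ?_⟩
  · exact (halt.differential_comp_self_eq_zero_iff _).2
      (VirtualLinkDiagram.Cube.diff_sq_eq_zero fun s c c' hne hc hc' => by
        convert D.standardSigns_anticomm s c c' hne hc hc')
  · intro ξ hη x₀ y₀
    have hg := halt.two_mul_supportingGenus hconn hη
    have hn := D.nPos_add_nNeg
    rw [halt.signature_eq hconn hη, halt.dual_signature_eq hconn hη]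
    refine ⟨by omega, fun ε hε i j hKh => ?_⟩
    obtain ⟨h1, h2, h3⟩ := halt.diagonal_bounds hconn hε hKh
    obtain ⟨r, hr⟩ := h3
    refine ⟨(1 - VirtualLinkDiagram.numClasses (D.cycleRel fun _ => false) - r : ℤ).toNat, ?_, ?_⟩
    · omega
    · omega
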